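/- Let $X$ be a metric Lie group, i.e. a simply connected three-dimensional Lie group with a left invariant Riemannian metric $\langle\,,\rangle$ and identity $e$. Let $\{E_1,E_2,E_3\}$ be a canonical basis of $X$, i.e. an orthonormal frame of left invariant vector fields such that: * if $X$ is unimodular, $[E_2,E_3]=c_1E_1$, $[E_3,E_1]=c_2E_2$, $[E_1,E_2]=c_3E_3$ with $c_1,c_2,c_3\in\mathbb{R}$, at most one of them negative; * if $X$ is non-unimodular (with its metric rescaled so that the matrix $A$ below has trace $2$), $[E_1,E_2]=0$, $[E_3,E_1]=(1+a)E_1+(1+a)bE_2$, $[E_3,E_2]=-(1-a)bE_1+(1-a)E_2$ with $a,b\ge 0$; equivalently, $X$ is isomorphic and isometric to $\mathbb{R}^2\rtimes_A\mathbb{R}$ with its canonical metric, where $A=\begin{pmatrix}1+a&-(1-a)b\\(1+a)b&1-a\end{pmatrix}$. For $H\in\mathbb{R}$, the $H$-potential of $X$ is the function $R$ of $q\in\mathbb{C}$ given by $$R(q)=H(1+|q|^2)^2-\tfrac i2\left(\mu_2|1+q^2|^2+\mu_1|1-q^2|^2+4\mu_3|q|^2\right)$$ in the unimodular case, where $\mu_1=\frac12(-c_1+c_2+c_3)$,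 $\mu_2=\frac12(c_1-c_2+c_3)$, $\mu_3=\frac12(c_1+c_2-c_3)$, and by $$R(q)=H(1+|q|^2)^2-(1-|q|^4)-a(q^2-\overline q^2)-ib\left(2|q|^2-a(q^2+\overline q^2)\right)$$ in the non-unimodular case; we say that $R$ has a zero at $\infty$ if $\lim_{q\to\infty}R(q)/|q|^4=0$. Let $\Sigma$ be a connected surface and $f\colon\Sigma\to X$ a smooth immersion, oriented by a smooth unit normal field $N$, with constant mean curvature $H$ with respect to $N$ (half the trace of $(v,w)\mapsto-\langle\nabla_vN,df(w)\rangle$). Let $G\colon\Sigma\to\mathbb{S}^2\subset T_eX$, $(dl_{f(p)})_e(G(p))=N_p$, where $l_x$ denotes left translation by $x$, and let its left invariant Gauss map $g\colon\Sigma\to\overline{\mathbb{C}}=\mathbb{C}\cup\{\infty\}$ be the stereographic projection of $G$ from the south pole $-(E_3)_e$, that is, $g=(G_1+iG_2)/(1+G_3)$ in the basis $(E_i)_e$. Assume that $R$ has no zero on $g(\Sigma)$. We say that $f$ is invariant under the flow $(\theta_t)$ of a vector field on $X$ if this flow acts on $f$ as a local flow ($\Sigma$ is not assumed complete): every point of $\Sigma$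 has a neighbourhood $U$ on which, for small $|t|$, there are maps $\Phi_t\colon U\to\Sigma$, jointly continuous in $t$ and the point, with $\Phi_0=\mathrm{id}$ and $f\circ\Phi_t=\theta_t\circ f$. Then the differential of $g$ has rank at most $1$ everywhere on $\Sigma$ if and only if $f$ is invariant under the flow of a nonzero right invariant vector field on $X$. Furthermore, if $f$ is invariant under the flow of a nonzero right invariant vector field on $X$, then the rank of the differential of $g$ is $1$ everywhere on $\Sigma$, and the Gauss map image $g(\Sigma)$ is a regular curve in $\overline{\mathbb{C}}$, i.e. $g(\Sigma)=\gamma(\mathbb{R})$ for a smooth curve $\gamma\colon\mathbb{R}\to\overline{\mathbb{C}}$ with nowhere vanishing velocity. -/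

import Mathlib

open Set Filter Topology Manifold
open scoped ContDiff

noncomputable section

/-! ### The Riemann sphere as a smooth surface -/

namespace RiemannSphere

/-- The inversion `q ↦ 1 / q` of the Riemann sphere, exchanging `0` and `∞`. -/
def inv (q : OnePoint ℂ) : OnePoint ℂ :=
  q.elim ((0 : ℂ) : OnePoint ℂ)
    (fun z => if z = 0 then OnePoint.infty else ((z⁻¹ : ℂ) : OnePoint ℂ))

@[simp] theorem inv_infty : inv OnePoint.infty = ((0 : ℂ) : OnePoint ℂ) := rfl

@[simp] theorem inv_zero : inv ((0 : ℂ) : OnePoint ℂ) = OnePoint.infty := by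
  change (if (0 : ℂ) = 0 then _ else _) = _
  simp

theorem inv_coe {z : ℂ} (hz : z ≠ 0) :
    inv (z : OnePoint ℂ) = ((z⁻¹ : ℂ) : OnePoint ℂ) := by
  change (if z = 0 then _ else _) = _
  simp [hz]

theorem inv_inv (q : OnePoint ℂ) : inv (inv q) = q := by
  induction q using OnePoint.rec with
  | infty => simp
  | coe z =>
    by_cases hz : z = 0
    · subst hz; simp
    · rw [inv_coe hz, inv_coe (inv_ne_zero hz), _root_.inv_inv]

theorem continuous_inv : Continuous inv := by
  rw [OnePoint.continuous_iff]
  refine ⟨?_, ?_⟩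
  · rw [inv_infty, coclosedCompact_eq_cocompact]
    have h1 : Tendsto (fun z : ℂ => z⁻¹) (cocompact ℂ) (𝓝 0) := by
      rw [← Metric.cobounded_eq_cocompact]
      exact tendsto_inv₀_cobounded
    refine ((OnePoint.continuous_coe.tendsto (0 : ℂ)).comp h1).congr' ?_
    have h0 : ∀ᶠ z : ℂ in cocompact ℂ, z ≠ 0 := by
      have := (isCompact_singleton (x := (0 : ℂ))).compl_mem_cocompact
      filter_upwards [this] with z hz using hz
    filter_upwards [h0] with z hz
    simp [inv_coe hz]
  · rw [continuous_iff_continuousAt]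
    intro z
    by_cases hz : z = 0
    · subst hz
      rw [continuousAt_iff_punctured_nhds, inv_zero]
      have h1 : Tendsto (fun z : ℂ => z⁻¹) (𝓝[≠] 0) (coclosedCompact ℂ) := by
        rw [coclosedCompact_eq_cocompact, ← Metric.cobounded_eq_cocompact]
        exact tendsto_inv₀_nhdsNE_zero
      refine (OnePoint.tendsto_coe_infty.comp h1).congr' ?_
      filter_upwards [self_mem_nhdsWithin] with w hw
      simp [inv_coe hw]
    · have h1 : ContinuousAt (fun w : ℂ => ((w⁻¹ : ℂ) : OnePoint ℂ)) z :=
        OnePoint.continuous_coe.continuousAt.comp (continuousAt_inv₀ hz)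
      refine h1.congr ?_
      filter_upwards [isOpen_ne.mem_nhds hz] with w hw
      simp [inv_coe hw]

/-- Inversion as a homeomorphism of the Riemann sphere. -/
def invHomeomorph : OnePoint ℂ ≃ₜ OnePoint ℂ where
  toFun := inv
  invFun := inv
  left_inv := inv_inv
  right_inv := inv_inv
  continuous_toFun := continuous_inv
  continuous_invFun := continuous_inv

/-- The affine chart `q ↦ q`, defined away from `∞`. -/
def chartZero : OpenPartialHomeomorph (OnePoint ℂ) ℂ :=
  (OnePoint.isOpenEmbedding_coe (X := ℂ)).toOpenPartialHomeomorph.symm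

/-- The chart `q ↦ 1 / q`, defined away from `0` and sending `∞` to `0`. -/
def chartInfty : OpenPartialHomeomorph (OnePoint ℂ) ℂ :=
  invHomeomorph.toOpenPartialHomeomorph.trans chartZero

/-- The Riemann sphere `ℂ ∪ {∞}` with the two charts `q` and `1 / q`. -/
instance : ChartedSpace ℂ (OnePoint ℂ) where
  atlas := {chartZero, chartInfty}
  chartAt q := q.elim chartInfty (fun _ => chartZero)
  mem_chart_source q := by
    induction q using OnePoint.rec with
    | infty =>
      change OnePoint.infty ∈ chartInfty.source
      simp [chartInfty, chartZero, invHomeomorph]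
    | coe z =>
      change (z : OnePoint ℂ) ∈ chartZero.source
      simp [chartZero]
  chart_mem_atlas q := by
    induction q using OnePoint.rec with
    | infty => exact Or.inr rfl
    | coe z => exact Or.inl rfl

/-- The two charts are compatible: the Riemann sphere is a smooth surface. -/
instance : IsManifold 𝓘(ℝ, ℂ) ∞ (OnePoint ℂ) := by
  have hinv : ∀ (s : Set ℂ) (φ : ℂ → ℂ), (∀ z ∈ s, z ≠ 0 ∧ φ z = z⁻¹) → ContDiffOn ℝ ∞ φ s := by
    intro s φ h
    refine ContDiffOn.congr (f := fun z : ℂ => z⁻¹) ?_ (fun z hz => (h z hz).2)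
    exact fun z hz => (contDiffAt_inv ℝ (h z hz).1).contDiffWithinAt
  have key : ∀ z : ℂ, inv (z : OnePoint ℂ) ∈ range ((↑) : ℂ → OnePoint ℂ) →
      z ≠ 0 ∧ chartZero (inv (z : OnePoint ℂ)) = z⁻¹ := by
    intro z hz
    have hz0 : z ≠ 0 := by
      rintro rfl
      obtain ⟨w, hw⟩ := hz
      simp at hw
    refine ⟨hz0, ?_⟩
    rw [inv_coe hz0]
    exact (OnePoint.isOpenEmbedding_coe (X := ℂ)).toOpenPartialHomeomorph_left_inv
  have self : ∀ e : OpenPartialHomeomorph (OnePoint ℂ) ℂ,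
      ContDiffOn ℝ ∞ (e.symm.trans e) (e.symm.trans e).source := by
    intro e
    refine contDiffOn_id.congr ?_
    intro z hz
    rw [OpenPartialHomeomorph.trans_source] at hz
    exact e.right_inv hz.1
  apply isManifold_of_contDiffOn
  intro e e' he he'
  simp only [modelWithCornersSelf_coe, modelWithCornersSelf_coe_symm, Function.id_comp,
    Function.comp_id, preimage_id, range_id, inter_univ]
  rcases he with rfl | rfl <;> rcases he' with rfl | rfl
  · exact self _
  · refine hinv _ _ (fun z hz => key z ?_)
    simpa [chartInfty, chartZero, invHomeomorph] using hz
  · refine hinv _ _ (fun z hz => key z ?_)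
    simpa [chartInfty, chartZero, invHomeomorph] using hz
  · exact self _

end RiemannSphere

/-! ### Metric Lie groups -/

/-- The model space of a three-dimensional manifold. -/
abbrev E3 : Type := EuclideanSpace ℝ (Fin 3)

/-- The model space of a surface. -/
abbrev E2 : Type := EuclideanSpace ℝ (Fin 2)

section MetricLieGroup

variable {X : Type*} [TopologicalSpace X] [ChartedSpace E3 X] [Group X] [LieGroup (𝓡 3) ∞ X]

variable (X) in
/-- A left invariant Riemannian metric on the three-dimensional Lie group `X`: a smooth Riemannian
metric for which all left translations `y ↦ x * y` are isometries. -/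
structure LeftInvariantMetric extends
    Bundle.ContMDiffRiemannianMetric (𝓡 3) ∞ E3 (fun x : X => TangentSpace (𝓡 3) x) where
  left_invariant : ∀ (x y : X) (v w : TangentSpace (𝓡 3) y),
    inner (x * y) (mfderiv (𝓡 3) (𝓡 3) (fun z : X => x * z) y v)
      (mfderiv (𝓡 3) (𝓡 3) (fun z : X => x * z) y w) = inner y v w

/-- The inner product that a left invariant metric induces on the Lie algebra `T_e X`. -/
def LeftInvariantMetric.lieInner (g : LeftInvariantMetric X) (v w : GroupLieAlgebra (𝓡 3) X) : ℝ :=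
  g.inner 1 v w

/-- The Levi-Civita connection of a left invariant metric on left invariant vector fields, by
Koszul's formula: `⟨∇_x y, z⟩ = (⟨[x, y], z⟩ - ⟨[y, z], x⟩ + ⟨[z, x], y⟩) / 2`. (The other three terms
of the formula are derivatives of inner products of left invariant fields, which are constant.) -/
def LeftInvariantMetric.koszul (g : LeftInvariantMetric X) (x y z : GroupLieAlgebra (𝓡 3) X) : ℝ :=
  (g.lieInner ⁅x, y⁆ z - g.lieInner ⁅y, z⁆ x + g.lieInner ⁅z, x⁆ y) / 2

/-- The inverse `(dl_x)_e⁻¹ : T_x X → T_e X` of the differential of left translation by `x`,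
as the differential at `x` of left translation by `x⁻¹`. -/
def toLieAlgebra (x : X) (v : TangentSpace (𝓡 3) x) : GroupLieAlgebra (𝓡 3) X :=
  (mfderiv (𝓡 3) (𝓡 3) (fun z : X => x⁻¹ * z) x v : E3)

/-- `toLieAlgebra x` is indeed inverse to the differential at `e` of left translation by `x`. -/
theorem mulInvariantVectorField_toLieAlgebra (x : X) (v : TangentSpace (𝓡 3) x) :
    mulInvariantVectorField (toLieAlgebra x v) x = v := by
  have hd : ∀ (a b : X), MDifferentiableAt (𝓡 3) (𝓡 3) (fun z : X => a * z) b := fun a b =>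
    ((contMDiff_mul_left (I := 𝓡 3) (n := ∞) (a := a)).contMDiffAt).mdifferentiableAt (by simp)
  have h := mfderiv_comp_apply_of_eq (I := 𝓡 3) (I' := 𝓡 3) (I'' := 𝓡 3)
    (g := fun z : X => x * z) (f := fun z : X => x⁻¹ * z) (x := x) (y := 1)
    (hd x 1) (hd x⁻¹ x) (inv_mul_cancel x) v
  have hid : (fun z : X => x * z) ∘ (fun z : X => x⁻¹ * z) = id := by
    funext z; simp
  rw [hid, mfderiv_id] at h
  exact h.symm

/-- The right invariant vector field on `X` with value `v` at the identity: `x ↦ (dr_x)_e v`, where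
`r_x` is the right translation `y ↦ y * x`. -/
def rightInvariantField (v : GroupLieAlgebra (𝓡 3) X) (x : X) : TangentSpace (𝓡 3) x :=
  (mfderiv (𝓡 3) (𝓡 3) (fun y : X => y * x) 1 v : E3)

/-- The vectors `e 0, e 1, e 2` of the Lie algebra are orthonormal. -/
def LeftInvariantMetric.OrthonormalFrame (g : LeftInvariantMetric X)
    (e : Fin 3 → GroupLieAlgebra (𝓡 3) X) : Prop :=
  ∀ i j, g.lieInner (e i) (e j) = if i = j then 1 else 0

/-- `e` is a canonical basis of the unimodular metric Lie group `X`, with structure constants `c`. -/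
structure LeftInvariantMetric.IsUnimodularBasis (g : LeftInvariantMetric X)
    (e : Fin 3 → GroupLieAlgebra (𝓡 3) X) (c : Fin 3 → ℝ) : Prop where
  orthonormal : g.OrthonormalFrame e
  bracket_12 : ⁅e 1, e 2⁆ = c 0 • e 0
  bracket_20 : ⁅e 2, e 0⁆ = c 1 • e 1
  bracket_01 : ⁅e 0, e 1⁆ = c 2 • e 2
  at_most_one_neg : ∀ i j, c i < 0 → c j < 0 → i = j

/-- `e` is the canonical basis of a non-unimodular metric Lie group `X` isomorphic and isometric to
`ℝ² ⋊_A ℝ` with its canonical metric, where `A` is the matrix with rows `(1 + a, -(1 - a) b)` and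
`((1 + a) b, 1 - a)`, of trace `2`, and `a, b ≥ 0`. -/
structure LeftInvariantMetric.IsNonUnimodularBasis (g : LeftInvariantMetric X)
    (e : Fin 3 → GroupLieAlgebra (𝓡 3) X) (a b : ℝ) : Prop where
  orthonormal : g.OrthonormalFrame e
  nonneg_left : 0 ≤ a
  nonneg_right : 0 ≤ b
  bracket_01 : ⁅e 0, e 1⁆ = 0
  bracket_20 : ⁅e 2, e 0⁆ = (1 + a) • e 0 + ((1 + a) * b) • e 1
  bracket_21 : ⁅e 2, e 1⁆ = (-((1 - a) * b)) • e 0 + (1 - a) • e 1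

/-- The `H`-potential (on `ℂ`) of a unimodular metric Lie group with structure constants `c`. -/
def unimodularPotential (c : Fin 3 → ℝ) (H : ℝ) (q : ℂ) : ℂ :=
  let m₁ : ℝ := (-c 0 + c 1 + c 2) / 2
  let m₂ : ℝ := (c 0 - c 1 + c 2) / 2
  let m₃ : ℝ := (c 0 + c 1 - c 2) / 2
  H * (1 + ‖q‖ ^ 2) ^ 2 -
    Complex.I / 2 * (m₂ * ‖1 + q ^ 2‖ ^ 2 + m₁ * ‖1 - q ^ 2‖ ^ 2 + 4 * m₃ * ‖q‖ ^ 2)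

/-- The `H`-potential (on `ℂ`) of a non-unimodular metric Lie group with constants `a`, `b`. -/
def nonUnimodularPotential (a b H : ℝ) (q : ℂ) : ℂ :=
  H * (1 + ‖q‖ ^ 2) ^ 2 - (1 - ‖q‖ ^ 4) - a * (q ^ 2 - (starRingEnd ℂ q) ^ 2) -
    Complex.I * b * (2 * ‖q‖ ^ 2 - a * (q ^ 2 + (starRingEnd ℂ q) ^ 2))

/-- `e` is a canonical basis of the metric Lie group `(X, g)`, and `R` is the `H`-potential of `X`
in that basis. -/
def LeftInvariantMetric.IsHPotential (g : LeftInvariantMetric X)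
    (e : Fin 3 → GroupLieAlgebra (𝓡 3) X) (H : ℝ) (R : ℂ → ℂ) : Prop :=
  (∃ c, g.IsUnimodularBasis e c ∧ R = unimodularPotential c H) ∨
    (∃ a b, g.IsNonUnimodularBasis e a b ∧ R = nonUnimodularPotential a b H)

/-- The `H`-potential has a zero at `q ∈ ℂ ∪ {∞}`. Since `R q / |q| ^ 4` has a finite limit
at `∞`, a zero at `∞` means by definition that this limit is `0`. -/
def PotentialZeroAt (R : ℂ → ℂ) (q : OnePoint ℂ) : Prop :=
  q.elim (Tendsto (fun z : ℂ => R z / (‖z‖ : ℂ) ^ 4) (cocompact ℂ) (𝓝 0)) (fun z => R z = 0)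

open Classical in
/-- Stereographic projection from the south pole `-e 2` of the unit sphere of `T_e X`. -/
def LeftInvariantMetric.stereographic (g : LeftInvariantMetric X)
    (e : Fin 3 → GroupLieAlgebra (𝓡 3) X) (n : GroupLieAlgebra (𝓡 3) X) : OnePoint ℂ :=
  if g.lieInner n (e 2) = -1 then OnePoint.infty
  else ((((g.lieInner n (e 0) : ℂ) + Complex.I * (g.lieInner n (e 1) : ℂ)) /
    (1 + (g.lieInner n (e 2) : ℂ)) : ℂ) : OnePoint ℂ)

/-! ### Immersed surfaces -/

variable {S : Type*} [TopologicalSpace S] [ChartedSpace E2 S]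

/-- The `T_e X`-valued left invariant Gauss map `p ↦ (dl_{f p})_e⁻¹ (N p)` of an immersed surface `f`
with unit normal `N`. -/
def gaussMap (f : S → X) (N : ∀ p, TangentSpace (𝓡 3) (f p)) (p : S) : GroupLieAlgebra (𝓡 3) X :=
  toLieAlgebra (f p) (N p)

/-- The differential of the `T_e X`-valued Gauss map. -/
def gaussDifferential (f : S → X) (N : ∀ p, TangentSpace (𝓡 3) (f p)) (p : S)
    (v : TangentSpace (𝓡 2) p) : GroupLieAlgebra (𝓡 3) X :=
  (mfderiv (𝓡 2) 𝓘(ℝ, E3) (M' := E3) (fun q => gaussMap f N q) p v : E3)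

/-- The differential of `f` at `p`, followed by left translation back to the identity. -/
def leftDifferential (f : S → X) (p : S) (v : TangentSpace (𝓡 2) p) : GroupLieAlgebra (𝓡 3) X :=
  toLieAlgebra (f p) (mfderiv (𝓡 2) (𝓡 3) f p v)

/-- The left invariant Gauss map with values in the Riemann sphere: the stereographic projection of
the `T_e X`-valued Gauss map. -/
def LeftInvariantMetric.sphereGaussMap (g : LeftInvariantMetric X)
    (e : Fin 3 → GroupLieAlgebra (𝓡 3) X) (f : S → X) (N : ∀ p, TangentSpace (𝓡 3) (f p)) (p : S) :
    OnePoint ℂ :=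
  g.stereographic e (gaussMap f N p)

/-- The second fundamental form `II(v, w) = -⟨∇_v N, df w⟩` of `f` with respect to `N`.
Writing `N = ∑ Nᵢ Eᵢ` in a left invariant frame, `∇_v N = ∑ dNᵢ(v) Eᵢ + ∑ Nᵢ ∇_{df v} Eᵢ`; the
first sum is the differential of the Gauss map, left translated to `f p`. -/
def LeftInvariantMetric.secondFundamentalForm (g : LeftInvariantMetric X) (f : S → X)
    (N : ∀ p, TangentSpace (𝓡 3) (f p)) (p : S) (v w : TangentSpace (𝓡 2) p) : ℝ :=
  -(g.lieInner (gaussDifferential f N p v) (leftDifferential f p w) +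
    g.koszul (leftDifferential f p v) (gaussMap f N p) (leftDifferential f p w))

/-- The first fundamental form (induced metric) of `f`. -/
def LeftInvariantMetric.firstFundamentalForm (g : LeftInvariantMetric X) (f : S → X) (p : S)
    (v w : TangentSpace (𝓡 2) p) : ℝ :=
  g.inner (f p) (mfderiv (𝓡 2) (𝓡 3) f p v) (mfderiv (𝓡 2) (𝓡 3) f p w)

/-- `f : S → X` is an immersed surface, oriented by the smooth unit normal field `N`, of constant
mean curvature `H`: half the trace of the second fundamental form is `H` at every point. -/
structure LeftInvariantMetric.IsHSurface (g : LeftInvariantMetric X) (f : S → X)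
    (N : ∀ p, TangentSpace (𝓡 3) (f p)) (H : ℝ) : Prop where
  smooth : ContMDiff (𝓡 2) (𝓡 3) ∞ f
  immersion : ∀ p, Function.Injective (mfderiv (𝓡 2) (𝓡 3) f p)
  smooth_normal : ContMDiff (𝓡 2) (𝓡 3).tangent ∞
    (fun p => (⟨f p, N p⟩ : TangentBundle (𝓡 3) X))
  unit_normal : ∀ p, g.inner (f p) (N p) (N p) = 1
  normal : ∀ p v, g.inner (f p) (N p) (mfderiv (𝓡 2) (𝓡 3) f p v) = 0
  mean_curvature : ∀ (p : S) (u v : TangentSpace (𝓡 2) p),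
    g.firstFundamentalForm f p u u = 1 → g.firstFundamentalForm f p v v = 1 →
    g.firstFundamentalForm f p u v = 0 →
    (g.secondFundamentalForm f N p u u + g.secondFundamentalForm f N p v v) / 2 = H

/-- `f` is invariant under the flow `(θ_t)` of the vector field `F` on `X`. Since the surface is
not assumed complete (it can be a small disk), the flow acts on it as a local flow: near every
point of `S` and for small `t` there is `Φ_t` with `Φ_0 = id` and `f ∘ Φ_t = θ_t ∘ f`, the
latter saying that `t ↦ f (Φ_t q)` is the integral curve of `F` through `f q`. -/
def InvariantUnderFlow (f : S → X) (F : ∀ x : X, TangentSpace (𝓡 3) x) : Prop :=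
  ∀ p : S, ∃ U ∈ 𝓝 p, ∃ ε > (0 : ℝ), ∃ Φ : ℝ → S → S,
    ContinuousOn (Function.uncurry Φ) (Ioo (-ε) ε ×ˢ U) ∧
    (∀ q ∈ U, Φ 0 q = q) ∧
    ∀ q ∈ U, IsMIntegralCurveOn (I := 𝓡 3) (fun t => f (Φ t q)) F (Ioo (-ε) ε)

/-- `f` is invariant under the flow of some nonzero right invariant vector field on `X`. -/
def InvariantUnderRightInvariantField (f : S → X) : Prop :=
  ∃ v : GroupLieAlgebra (𝓡 3) X, v ≠ 0 ∧ InvariantUnderFlow f (rightInvariantField v)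

/-- The rank at `p` of the differential of a map from a surface to the Riemann sphere. -/
def rankAt (γ : S → OnePoint ℂ) (p : S) : ℕ :=
  Module.finrank ℝ (LinearMap.range (mfderiv (𝓡 2) 𝓘(ℝ, ℂ) γ p).toLinearMap)

end MetricLieGroup

/-- A subset of the Riemann sphere is a regular curve if it is the trace of a smooth parametrized
curve with nowhere vanishing velocity. -/
def IsRegularCurve (C : Set (OnePoint ℂ)) : Prop :=
  ∃ γ : ℝ → OnePoint ℂ, ContMDiff 𝓘(ℝ, ℝ) 𝓘(ℝ, ℂ) ∞ γ ∧
    (∀ t, mfderiv 𝓘(ℝ, ℝ) 𝓘(ℝ, ℂ) γ t ≠ 0) ∧ range γ = C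

end

/-!
In an orthonormal frame of left invariant fields, a surface `f : S → X` has a Gauss map `G` with
values in the unit sphere of `ℝ³` and a left translated differential `η = f⁻¹ df`. They satisfy
`⟪G, η⟫ = 0` and the Maurer–Cartan equation `dη + [η, η] / 2 = 0` (`darboux_maurerCartan`).

*The potential.* The normal derivative `∇N` differs from `dG` by the algebraic term `∇_{η} G` of the
Levi-Civita connection. So constancy of the mean curvature prescribes the trace of `dG ∘ η⁻¹`, and
symmetry of the second fundamental form prescribes its skew part, as functions `tracePart` and
`skewPart` of `G` alone (`GaussData`). Up to a nonvanishing real factor the potential at the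
stereographic projection of `G` is `tracePart + i skewPart` (`unimodularPotential_eq`,
`nonUnimodularPotential_eq`; `potentialZeroAt_stereo` includes the point at infinity). Where the
potential does not vanish, trace and skew part do not both vanish. Hence `dG` is not zero, and if it
has a kernel, with `η`-image spanned by the unit vector `κ`, then it is completely determined:
`dG = ⟪G × κ, η⟫ gaussVelocity(G, κ)` (`GaussData.apply_eq`).

*From rank one to invariance.* A right invariant field with value `v` at the identity reads
`h = Ad(f⁻¹) v` along the surface, and these are the solutions of `dh = -[η, h]` (`fderiv_adInv`).
Symmetry of the second derivative of `G`, applied to the formula for `dG`, together with the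
Maurer–Cartan equation, gives `dκ = -[η, κ]` up to multiples of `κ`
(`GaussChart.fderiv_kernel_field`). Hence `κ` has near each point the direction of a right invariant
field (`GaussChart.exists_parallel_kernel`), unique up to scaling because the kernel is a line, and
so the same field serves on all of the connected surface (`exists_isKernelAt`). This field is tangent
to the surface; its restriction to the surface is a smooth field, the flow of which lifts the flow on
`X` (`IsTangent.invariantUnderFlow`).

*From invariance to rank one.* A right invariant field whose flow preserves the surface is tangent to
it (`isTangent_of_invariantUnderFlow`). For `h` tangent with `dh = -[η, h]`, the derivative of
`⟪G, h⟫ = 0` and the formula for the skew part show that `h` lies in the kernel of `dG`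
(`GaussChart.fderiv_eq_zero_of_tangent`).

*The image.* In this situation `dG` and `dκ` are multiples by the same nonvanishing one-form of
functions of `(G, κ)`. So `(G, κ)` maps the connected surface onto an open arc of an integral curve of
the autonomous field `gaussField` (`exists_image_integralCurve_eq_range`). The velocity of the first
component of that curve does not vanish, and stereographic projection, restricted to the sphere, is
an immersion (`mfderiv_stereo_comp_eq_zero_iff`).
-/

noncomputable section

open scoped RealInnerProductSpace NNReal

/-! ### The Maurer–Cartan equation -/

section Darboux

set_option linter.unusedSectionVars false

variable {X : Type*} [TopologicalSpace X] [ChartedSpace E3 X] [Group X] [LieGroup (𝓡 3) ∞ X]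
variable {E : Type*} [NormedAddCommGroup E] [NormedSpace ℝ E]
variable {E' : Type*} [NormedAddCommGroup E'] [NormedSpace ℝ E']

/-- The Darboux derivative of a map `F` from a normed space to the Lie group `X`: the pullback
`F⁻¹ dF` of the Maurer–Cartan form. At `q` it is the differential of `z ↦ F(q)⁻¹ F(z)`, read in the
preferred chart at the identity. -/
def darboux (F : E → X) (q : E) : E →L[ℝ] E3 :=
  fderiv ℝ (fun z => extChartAt (𝓡 3) (1 : X) ((F q)⁻¹ * F z)) q

theorem darboux_congr {F F' : E → X} {q : E} (h : F =ᶠ[𝓝 q] F') :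
    darboux F q = darboux F' q := by
  unfold darboux
  apply Filter.EventuallyEq.fderiv_eq
  filter_upwards [h] with z hz
  rw [hz, h.self_of_nhds]

theorem darboux_mul_left (x : X) (F : E → X) : darboux (fun z => x * F z) = darboux F := by
  funext q
  simp only [darboux, mul_inv_rev, mul_assoc, inv_mul_cancel_left]

theorem mdifferentiableAt_mul_left' (x y : X) :
    MDifferentiableAt (𝓡 3) (𝓡 3) (fun z : X => x * z) y :=
  ((contMDiff_mul_left (I := 𝓡 3) (n := ∞) (a := x)).contMDiffAt).mdifferentiableAt (by simp)

theorem differentiableAt_chart_inv_mul {F : E → X} {q : E}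
    (hF : MDifferentiableAt 𝓘(ℝ, E) (𝓡 3) F q) :
    DifferentiableAt ℝ (fun z => extChartAt (𝓡 3) (1 : X) ((F q)⁻¹ * F z)) q := by
  rw [← mdifferentiableAt_iff_differentiableAt]
  have h : MDifferentiableAt 𝓘(ℝ, E) (𝓡 3) (fun z => (F q)⁻¹ * F z) q :=
    (mdifferentiableAt_mul_left' (F q)⁻¹ (F q)).comp q hF
  refine MDifferentiableAt.comp (g := extChartAt (𝓡 3) (1 : X)) q ?_ h
  simp only [inv_mul_cancel]
  exact (contMDiffAt_extChartAt (n := ∞)).mdifferentiableAt (by simp)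

theorem darboux_eq_mfderiv {F : E → X} {q : E} (hF : MDifferentiableAt 𝓘(ℝ, E) (𝓡 3) F q) :
    darboux F q = (mfderiv 𝓘(ℝ, E) (𝓡 3) (fun z => (F q)⁻¹ * F z) q : E →L[ℝ] E3) := by
  have h : MDifferentiableAt 𝓘(ℝ, E) (𝓡 3) (fun z => (F q)⁻¹ * F z) q :=
    (mdifferentiableAt_mul_left' (F q)⁻¹ (F q)).comp q hF
  have h2 : HasMFDerivAt 𝓘(ℝ, E) (𝓡 3) (fun z => (F q)⁻¹ * F z) q (darboux (E := E) F q) := by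
    refine ⟨h.continuousAt, ?_⟩
    have h3 := (differentiableAt_chart_inv_mul hF).hasFDerivAt
    simp only [writtenInExtChartAt, inv_mul_cancel, extChartAt_model_space_eq_id,
      PartialEquiv.refl_symm, PartialEquiv.refl_coe, Function.comp_id, id,
      modelWithCornersSelf_coe, range_id]
    exact h3.hasFDerivWithinAt
  exact h2.mfderiv.symm

theorem darboux_apply {F : E → X} {q : E} (hF : MDifferentiableAt 𝓘(ℝ, E) (𝓡 3) F q) (v : E) :
    darboux F q v = toLieAlgebra (F q) (mfderiv 𝓘(ℝ, E) (𝓡 3) F q v) := by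
  rw [darboux_eq_mfderiv hF]
  have := mfderiv_comp (I := 𝓘(ℝ, E)) (I' := 𝓡 3) (I'' := 𝓡 3) q
    (mdifferentiableAt_mul_left' (F q)⁻¹ (F q)) hF
  exact congrArg (fun L : E →L[ℝ] E3 => L v) this

theorem contDiffAt_chart_inv_mul {F : E → X} {p : E} (hF : ContMDiffAt 𝓘(ℝ, E) (𝓡 3) ∞ F p) :
    ContDiffAt ℝ ∞ (fun w : E × E => extChartAt (𝓡 3) (1 : X) ((F w.1)⁻¹ * F w.2)) (p, p) := by
  rw [← contMDiffAt_iff_contDiffAt]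
  have h1 : ContMDiffAt 𝓘(ℝ, E × E) (𝓡 3) ∞ (fun w : E × E => F w.1) (p, p) :=
    ContMDiffAt.comp (p, p) (g := F) (f := Prod.fst) hF contDiffAt_fst.contMDiffAt
  have h2 : ContMDiffAt 𝓘(ℝ, E × E) (𝓡 3) ∞ (fun w : E × E => F w.2) (p, p) :=
    ContMDiffAt.comp (p, p) (g := F) (f := Prod.snd) hF contDiffAt_snd.contMDiffAt
  have h3 := h1.inv.mul h2
  refine ContMDiffAt.comp (p, p) (g := extChartAt (𝓡 3) (1 : X)) ?_ h3
  simp only [inv_mul_cancel]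
  exact contMDiffAt_extChartAt

theorem contDiffAt_darboux {F : E → X} {p : E} (hF : ContMDiffAt 𝓘(ℝ, E) (𝓡 3) ∞ F p) :
    ContDiffAt ℝ ∞ (darboux F) p :=
  ContDiffAt.fderiv (f := fun q z => extChartAt (𝓡 3) (1 : X) ((F q)⁻¹ * F z)) (g := id)
    (contDiffAt_chart_inv_mul hF) contDiffAt_id (by simp)

theorem darboux_comp {F : E' → X} {φ : E → E'} {q : E}
    (hF : MDifferentiableAt 𝓘(ℝ, E') (𝓡 3) F (φ q)) (hφ : DifferentiableAt ℝ φ q) :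
    darboux (fun z => F (φ z)) q = (darboux F (φ q)).comp (fderiv ℝ φ q) :=
  fderiv_comp q (differentiableAt_chart_inv_mul hF) hφ

variable (X) in
/-- The Maurer–Cartan form of `X` in the preferred chart at the identity. -/
def chartMC : E3 → E3 →L[ℝ] E3 := darboux (fun y => (extChartAt (𝓡 3) (1 : X)).symm y)

variable (X) in
theorem contMDiffAt_chart_symm {y : E3} (hy : y ∈ (extChartAt (𝓡 3) (1 : X)).target) :
    ContMDiffAt 𝓘(ℝ, E3) (𝓡 3) ∞ (fun y => (extChartAt (𝓡 3) (1 : X)).symm y) y :=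
  haveI : IsManifold (𝓡 3) ∞ X := inferInstance
  (contMDiffOn_extChartAt_symm (n := ∞) (1 : X)).contMDiffAt
    ((isOpen_extChartAt_target (1 : X)).mem_nhds hy)

variable (X) in
theorem contDiffAt_chartMC {y : E3} (hy : y ∈ (extChartAt (𝓡 3) (1 : X)).target) :
    ContDiffAt ℝ ∞ (chartMC X) y :=
  contDiffAt_darboux (contMDiffAt_chart_symm X hy)

variable (X) in
theorem chartMC_chart_one : chartMC X (extChartAt (𝓡 3) (1 : X) 1) = ContinuousLinearMap.id ℝ E3 := by
  unfold chartMC darboux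
  have : (fun z => extChartAt (𝓡 3) (1 : X)
      (((extChartAt (𝓡 3) (1 : X)).symm (extChartAt (𝓡 3) (1 : X) 1))⁻¹ *
        (extChartAt (𝓡 3) (1 : X)).symm z)) =ᶠ[𝓝 (extChartAt (𝓡 3) (1 : X) 1)] id := by
    filter_upwards [extChartAt_target_mem_nhds (I := 𝓡 3) (1 : X)] with z hz
    rw [extChartAt_to_inv]
    rw [inv_one, one_mul, (extChartAt (𝓡 3) (1 : X)).right_inv hz, id]
  rw [this.fderiv_eq, fderiv_id]

/-- The left invariant vector field with value `u` at the identity, read in the preferred chart at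
the identity. -/
def chartField (u : GroupLieAlgebra (𝓡 3) X) (y : E3) : E3 :=
  (mfderiv 𝓘(ℝ, E3) (𝓡 3) (extChartAt (𝓡 3) (1 : X)).symm y).inverse
    (mulInvariantVectorField u ((extChartAt (𝓡 3) (1 : X)).symm y))

theorem bracket_eq_lieBracket (u v : GroupLieAlgebra (𝓡 3) X) :
    ⁅u, v⁆ = VectorField.lieBracket ℝ (chartField u) (chartField v)
      (extChartAt (𝓡 3) (1 : X) 1) := by
  rw [GroupLieAlgebra.bracket_def, ← VectorField.mlieBracketWithin_univ,
    VectorField.mlieBracketWithin_apply, mfderiv_extChartAt_self]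
  have : ∀ w : GroupLieAlgebra (𝓡 3) X,
      VectorField.mpullbackWithin 𝓘(ℝ, E3) (𝓡 3) (extChartAt (𝓡 3) (1 : X)).symm
        (mulInvariantVectorField w) (range (𝓡 3)) = chartField w := by
    intro w
    funext y
    simp only [VectorField.mpullbackWithin_apply, chartField, modelWithCornersSelf_coe, range_id,
      mfderivWithin_univ]
  rw [this, this]
  simp only [preimage_univ, univ_inter, modelWithCornersSelf_coe, range_id,
    VectorField.lieBracketWithin_univ]
  exact congrArg (fun L : E3 →L[ℝ] E3 => L _) (ContinuousLinearMap.inverse_id)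

theorem toLieAlgebra_mulInvariantVectorField (x : X) (u : GroupLieAlgebra (𝓡 3) X) :
    toLieAlgebra x (mulInvariantVectorField u x) = u := by
  have h := mfderiv_comp_apply_of_eq (I := 𝓡 3) (I' := 𝓡 3) (I'' := 𝓡 3)
    (g := fun z : X => x⁻¹ * z) (f := fun z : X => x * z) (x := 1) (y := x)
    (mdifferentiableAt_mul_left' x⁻¹ x) (mdifferentiableAt_mul_left' x 1) (mul_one x) u
  have hid : (fun z : X => x⁻¹ * z) ∘ (fun z : X => x * z) = id := by
    funext z; simp
  rw [hid, mfderiv_id] at h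
  exact h.symm

theorem chartMC_chartField {y : E3} (hy : y ∈ (extChartAt (𝓡 3) (1 : X)).target)
    (u : GroupLieAlgebra (𝓡 3) X) : chartMC X y (chartField u y) = u := by
  have hd := (contMDiffAt_chart_symm X hy).mdifferentiableAt (by simp)
  rw [chartMC, darboux_apply hd]
  have hinv := isInvertible_mfderivWithin_extChartAt_symm (I := 𝓡 3) hy
  simp only [modelWithCornersSelf_coe, range_id, mfderivWithin_univ] at hinv
  rw [chartField]
  have h2 := hinv.self_apply_inverse (mulInvariantVectorField u ((extChartAt (𝓡 3) (1 : X)).symm y))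
  refine Eq.trans ?_ (toLieAlgebra_mulInvariantVectorField ((extChartAt (𝓡 3) (1 : X)).symm y) u)
  exact congrArg (toLieAlgebra _) h2

theorem differentiableAt_chartField (u : GroupLieAlgebra (𝓡 3) X) :
    DifferentiableAt ℝ (chartField u) (extChartAt (𝓡 3) (1 : X) 1) := by
  set o := extChartAt (𝓡 3) (1 : X) 1
  have ho : o ∈ (extChartAt (𝓡 3) (1 : X)).target := mem_extChartAt_target 1
  have hC := contDiffAt_chartMC X ho
  have hone : chartMC X o = ((ContinuousLinearEquiv.refl ℝ E3 : E3 ≃L[ℝ] E3) : E3 →L[ℝ] E3) :=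
    chartMC_chart_one X
  have hinv : ContDiffAt ℝ ∞ (fun y => (chartMC X y).inverse) o := by
    have := contDiffAt_map_inverse (𝕜 := ℝ) (n := ∞) (ContinuousLinearEquiv.refl ℝ E3)
    rw [← hone] at this
    exact this.comp o hC
  have hd : DifferentiableAt ℝ (fun y => (chartMC X y).inverse u) o :=
    (hinv.differentiableAt (by simp)).clm_apply (differentiableAt_const _)
  refine hd.congr_of_eventuallyEq ?_
  have hev : ∀ᶠ y in 𝓝 o, chartMC X y ∈ range ((↑) : (E3 ≃L[ℝ] E3) → E3 →L[ℝ] E3) := by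
    apply hC.continuousAt
    rw [hone]
    exact ContinuousLinearEquiv.nhds _
  filter_upwards [hev, extChartAt_target_mem_nhds (I := 𝓡 3) (1 : X)] with y hy hy2
  obtain ⟨L, hL⟩ := hy
  have := chartMC_chartField hy2 u
  rw [← hL] at this ⊢
  rw [ContinuousLinearMap.inverse_equiv]
  exact (L.symm_apply_eq.2 this.symm).symm

variable (X) in
/-- The bracket of the Lie algebra `T_e X`, as an operation on the model space. -/
def lieBr (u v : E3) : E3 :=
  @Bracket.bracket (GroupLieAlgebra (𝓡 3) X) (GroupLieAlgebra (𝓡 3) X) _ u v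

/-- The Maurer–Cartan equation at the identity. The bracket is by definition that of left invariant
fields, whose chart representatives `chartField a` satisfy `chartMC (chartField a) = a`; the
derivative of this identity turns their Lie bracket into the exterior derivative of `chartMC`. -/
theorem chartMC_maurerCartan (u v : E3) :
    fderiv ℝ (chartMC X) (extChartAt (𝓡 3) (1 : X) 1) u v -
      fderiv ℝ (chartMC X) (extChartAt (𝓡 3) (1 : X) 1) v u =
      -lieBr X u v := by
  set o := extChartAt (𝓡 3) (1 : X) 1 with ho'
  have ho : o ∈ (extChartAt (𝓡 3) (1 : X)).target := mem_extChartAt_target 1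
  have hC := ((contDiffAt_chartMC X ho).differentiableAt (by simp))
  have key : ∀ a b : E3, fderiv ℝ (chartMC X) o b a =
      - fderiv ℝ (chartField (X := X) a) o b := by
    intro a b
    have h1 : (fun y => chartMC X y (chartField (X := X) a y)) =ᶠ[𝓝 o] fun _ => a := by
      filter_upwards [extChartAt_target_mem_nhds (I := 𝓡 3) (1 : X)] with y hy
      exact chartMC_chartField hy a
    have h2 := hC.hasFDerivAt.clm_apply (differentiableAt_chartField (X := X) a).hasFDerivAt
    have h3 := h2.unique ((hasFDerivAt_const a o).congr_of_eventuallyEq h1)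
    have h4 := congrArg (fun L : E3 →L[ℝ] E3 => L b) h3
    have h5 : chartField (X := X) a o = a := by
      have := chartMC_chartField ho (X := X) a
      rwa [ho', chartMC_chart_one X] at this
    rw [ho', chartMC_chart_one X, ← ho'] at h4
    simp only [h5] at h4
    simp only [add_apply, ContinuousLinearMap.flip_apply,
      zero_apply, ContinuousLinearMap.comp_apply,
      ContinuousLinearMap.id_apply] at h4
    exact eq_neg_of_add_eq_zero_right h4
  have h5 : ∀ a, chartField (X := X) a o = a := by
    intro a
    have := chartMC_chartField ho (X := X) a
    rwa [ho', chartMC_chart_one X] at this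
  have hb : lieBr X u v = VectorField.lieBracket ℝ (chartField (X := X) u) (chartField (X := X) v) o :=
    bracket_eq_lieBracket (X := X) u v
  have hu : chartField (X := X) u o = u := h5 u
  have hv : chartField (X := X) v o = v := h5 v
  rw [hb, key, key, VectorField.lieBracket, hu, hv]
  abel

/-- The **Maurer–Cartan equation** `dη + [η, η] / 2 = 0` for the Darboux derivative `η` of a map
into a Lie group. The Darboux derivative of `F` is that of `F(p)⁻¹ F`, which takes values near `p` in
the chart at the identity, so the equation at the identity suffices. -/
theorem darboux_maurerCartan {F : E → X} {p : E} (hF : ContMDiffAt 𝓘(ℝ, E) (𝓡 3) ∞ F p)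
    (u v : E) :
    fderiv ℝ (darboux F) p u v - fderiv ℝ (darboux F) p v u =
      -lieBr X (darboux F p u) (darboux F p v) := by
  set o := extChartAt (𝓡 3) (1 : X) 1 with ho'
  set ψ : E → E3 := fun z => extChartAt (𝓡 3) (1 : X) ((F p)⁻¹ * F z) with hψ'
  have hM : ContMDiffAt 𝓘(ℝ, E) (𝓡 3) ∞ (fun z => (F p)⁻¹ * F z) p :=
    contMDiffAt_const.mul hF
  have hψp : ψ p = o := by simp [hψ', ho']
  have hψ : ContDiffAt ℝ ∞ ψ p := by
    rw [← contMDiffAt_iff_contDiffAt]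
    refine ContMDiffAt.comp p (g := extChartAt (𝓡 3) (1 : X)) ?_ hM
    simp only [inv_mul_cancel]
    exact contMDiffAt_extChartAt
  have hev : darboux F =ᶠ[𝓝 p] fun q => (chartMC X (ψ q)).comp (fderiv ℝ ψ q) := by
    have h1 : ∀ᶠ q in 𝓝 p, (F p)⁻¹ * F q ∈ (extChartAt (𝓡 3) (1 : X)).source := by
      refine hM.continuousAt.eventually_mem ?_
      rw [inv_mul_cancel]
      exact extChartAt_source_mem_nhds 1
    have h2 : ∀ᶠ q in 𝓝 p, DifferentiableAt ℝ ψ q :=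
      ((hψ.of_le (m := 1) (by norm_cast)).eventually (by simp)).mono fun q hq => hq.differentiableAt (by simp)
    filter_upwards [h1.eventually_nhds, h2, h1] with q hq hq2 hq1
    rw [← darboux_mul_left (F p)⁻¹ F]
    have : (fun z => (F p)⁻¹ * F z) =ᶠ[𝓝 q]
        fun z => (extChartAt (𝓡 3) (1 : X)).symm (ψ z) := by
      filter_upwards [hq] with z hz
      exact ((extChartAt (𝓡 3) (1 : X)).left_inv hz).symm
    rw [darboux_congr this, darboux_comp (F := fun y => (extChartAt (𝓡 3) (1 : X)).symm y) _ hq2]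
    · rfl
    · exact (contMDiffAt_chart_symm X ((extChartAt (𝓡 3) (1 : X)).map_source hq1)).mdifferentiableAt
        (by simp)
  have ho : o ∈ (extChartAt (𝓡 3) (1 : X)).target := mem_extChartAt_target 1
  have hC := ((contDiffAt_chartMC X ho).differentiableAt (by simp))
  have hC' : DifferentiableAt ℝ (chartMC X) (ψ p) := by rw [hψp]; exact hC
  have hψ1 := (hψ.differentiableAt (by simp)).hasFDerivAt
  have hψ2 : DifferentiableAt ℝ (fderiv ℝ ψ) p :=
    (hψ.fderiv_right (m := 1) (by norm_cast)).differentiableAt (by simp)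
  have hsymm := (hψ.isSymmSndFDerivAt (by simp; norm_cast)) u v
  have hD := (hC'.hasFDerivAt.comp p hψ1).clm_comp hψ2.hasFDerivAt
  have hval : darboux F p = fderiv ℝ ψ p := by
    rw [hev.self_of_nhds]
    simp only
    rw [hψp, chartMC_chart_one X, ContinuousLinearMap.id_comp]
  rw [hev.fderiv_eq, hval, ← chartMC_maurerCartan (X := X)]
  erw [hD.fderiv]
  simp only [hψp, hsymm, add_apply, ContinuousLinearMap.comp_apply, Function.comp_apply,
    ContinuousLinearMap.compL_apply, ContinuousLinearMap.flip_apply, ho', chartMC_chart_one X,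
    ContinuousLinearMap.id_apply]
  abel

end Darboux

/-! ### The adjoint representation and sections along a map -/

section Adjoint

set_option linter.unusedSectionVars false

variable {X : Type*} [TopologicalSpace X] [ChartedSpace E3 X] [Group X] [LieGroup (𝓡 3) ∞ X]
variable {E : Type*} [NormedAddCommGroup E] [NormedSpace ℝ E]

/-- The adjoint action of `x⁻¹` on `T_e X`: the value at `x` of the right invariant field with value
`v` at `e`, translated back to `e` on the left. -/
def adInv (x : X) : E3 →L[ℝ] E3 :=
  (mfderiv (𝓡 3) (𝓡 3) (fun z : X => x⁻¹ * z) x : E3 →L[ℝ] E3).comp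
    (mfderiv (𝓡 3) (𝓡 3) (fun y : X => y * x) 1 : E3 →L[ℝ] E3)

theorem adInv_apply (x : X) (v : GroupLieAlgebra (𝓡 3) X) :
    adInv x v = toLieAlgebra x (rightInvariantField v x) := by
  rfl

theorem toLieAlgebra_of_eq_one {x : X} (hx : x = 1) (v : TangentSpace (𝓡 3) x) :
    toLieAlgebra x v = (v : E3) := by
  subst hx
  unfold toLieAlgebra
  have : (fun z : X => 1⁻¹ * z) = id := by funext z; simp
  rw [this, mfderiv_id]
  rfl

theorem mdifferentiableAt_mul_right' (x y : X) :
    MDifferentiableAt (𝓡 3) (𝓡 3) (fun z : X => z * x) y :=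
  ((contMDiff_mul_right (I := 𝓡 3) (n := ∞) (a := x)).contMDiffAt).mdifferentiableAt (by simp)

variable (X) in
/-- The parametrization of a neighbourhood of `e` by the preferred chart, recentred at `0`. -/
def chartParam (s : E3) : X :=
  (extChartAt (𝓡 3) (1 : X)).symm (extChartAt (𝓡 3) (1 : X) 1 + s)

variable (X) in
theorem chartParam_zero : chartParam X 0 = 1 := by simp [chartParam]

variable (X) in
theorem contMDiffAt_chartParam : ContMDiffAt 𝓘(ℝ, E3) (𝓡 3) ∞ (chartParam X) 0 := by
  refine ContMDiffAt.comp (0 : E3) (g := fun y => (extChartAt (𝓡 3) (1 : X)).symm y)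
    (f := fun s => extChartAt (𝓡 3) (1 : X) 1 + s) ?_ (contDiffAt_const.add contDiffAt_id).contMDiffAt
  rw [add_zero]
  exact contMDiffAt_chart_symm X (mem_extChartAt_target 1)

theorem darboux_chartParam_mul (x : X) : darboux (fun s => chartParam X s * x) 0 = adInv x := by
  have hc := (contMDiffAt_chartParam X).mdifferentiableAt (by simp)
  have hd : MDifferentiableAt 𝓘(ℝ, E3) (𝓡 3) (fun s => chartParam X s * x) 0 :=
    (mdifferentiableAt_mul_right' x (chartParam X 0)).comp (0 : E3) hc
  have hone : ∀ v : E3, darboux (chartParam X) 0 v = v := by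
    intro v
    have : darboux (chartParam X) 0 = (chartMC X (extChartAt (𝓡 3) (1 : X) 1 + 0)).comp
        (fderiv ℝ (fun s => extChartAt (𝓡 3) (1 : X) 1 + s) 0) := by
      refine darboux_comp (F := fun y => (extChartAt (𝓡 3) (1 : X)).symm y) ?_ (by fun_prop)
      rw [add_zero]
      exact (contMDiffAt_chart_symm X (mem_extChartAt_target 1)).mdifferentiableAt (by simp)
    rw [this, add_zero, chartMC_chart_one, fderiv_const_add, fderiv_fun_id]
    rfl
  ext1 v
  have h1 := hone v
  rw [darboux_apply hc, toLieAlgebra_of_eq_one (chartParam_zero X)] at h1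
  rw [darboux_apply hd]
  have h2 := mfderiv_comp_apply_of_eq (I := 𝓘(ℝ, E3)) (I' := 𝓡 3) (I'' := 𝓡 3)
    (g := fun z : X => z * x) (f := chartParam X) (x := 0) (y := 1)
    (mdifferentiableAt_mul_right' x 1) hc (chartParam_zero X) v
  have h3 : ∀ {y : X} (hy : y = x) (w : E3), toLieAlgebra y w = toLieAlgebra x w := by
    rintro y rfl w; rfl
  refine (h3 (by rw [chartParam_zero, one_mul]) _).trans ?_
  refine Eq.trans (congrArg (toLieAlgebra x) h2) ?_
  refine Eq.trans (congrArg (fun w : E3 => toLieAlgebra x (rightInvariantField w x)) h1) ?_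
  rfl

/-- The map `(s, q) ↦ c(s) F(q)`, `c` being the chart at the identity recentred at `0`: its Darboux
derivative at `s = 0` combines the adjoint action of `F⁻¹` with the Darboux derivative of `F`. -/
def leftVariation (F : E → X) (w : E3 × E) : X := chartParam X w.1 * F w.2

theorem contMDiffAt_leftVariation {F : E → X} {p : E} (hF : ContMDiffAt 𝓘(ℝ, E) (𝓡 3) ∞ F p) :
    ContMDiffAt 𝓘(ℝ, E3 × E) (𝓡 3) ∞ (leftVariation F) (0, p) :=
  (ContMDiffAt.comp ((0 : E3), p) (g := chartParam X) (f := Prod.fst) (contMDiffAt_chartParam X)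
    contDiffAt_fst.contMDiffAt).mul
  (ContMDiffAt.comp ((0 : E3), p) (g := F) (f := Prod.snd) hF contDiffAt_snd.contMDiffAt)

theorem darboux_leftVariation_left {F : E → X} {q : E}
    (hK : MDifferentiableAt 𝓘(ℝ, E3 × E) (𝓡 3) (leftVariation F) (0, q)) :
    (darboux (leftVariation F) (0, q)).comp (ContinuousLinearMap.inl ℝ E3 E) = adInv (F q) := by
  rw [← darboux_chartParam_mul]
  have h := darboux_comp (F := leftVariation F) (φ := fun s : E3 => (s, q)) (q := 0) hK (by fun_prop)
  rw [(hasFDerivAt_prodMk_left (𝕜 := ℝ) (0 : E3) q).fderiv] at h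
  exact h.symm

theorem darboux_leftVariation_right {F : E → X} {s : E3} {q : E}
    (hK : MDifferentiableAt 𝓘(ℝ, E3 × E) (𝓡 3) (leftVariation F) (s, q)) :
    (darboux (leftVariation F) (s, q)).comp (ContinuousLinearMap.inr ℝ E3 E) = darboux F q := by
  rw [← darboux_mul_left (chartParam X s) F]
  have h := darboux_comp (F := leftVariation F) (φ := fun z : E => (s, z)) (q := q) hK (by fun_prop)
  rw [(hasFDerivAt_prodMk_right (𝕜 := ℝ) s q).fderiv] at h
  exact h.symm

theorem eventually_mdifferentiableAt {F : E → X} {p : E}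
    (hF : ContMDiffAt 𝓘(ℝ, E) (𝓡 3) ∞ F p) :
    ∀ᶠ q in 𝓝 p, MDifferentiableAt 𝓘(ℝ, E) (𝓡 3) F q := by
  have h : ContMDiffAt 𝓘(ℝ, E) (𝓡 3) 1 F p := hF.of_le (by norm_cast)
  exact ((contMDiffAt_iff_contMDiffAt_nhds (by simp)).1 h).mono fun q hq => hq.mdifferentiableAt (by simp)

theorem contDiffAt_adInv {F : E → X} {p : E} (hF : ContMDiffAt 𝓘(ℝ, E) (𝓡 3) ∞ F p) :
    ContDiffAt ℝ ∞ (fun q => adInv (F q)) p := by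
  have hK := contMDiffAt_leftVariation hF
  have h1 : ContDiffAt ℝ ∞ (fun q : E => (darboux (leftVariation F) (0, q)).comp
      (ContinuousLinearMap.inl ℝ E3 E)) p := by
    refine ContDiffAt.clm_comp ?_ contDiffAt_const
    exact ContDiffAt.comp p (contDiffAt_darboux hK) (contDiffAt_const.prodMk contDiffAt_id)
  refine h1.congr_of_eventuallyEq ?_
  have hc : ContinuousAt (fun q : E => ((0 : E3), q)) p := by fun_prop
  filter_upwards [hc.eventually (eventually_mdifferentiableAt hK)] with q hq
  exact (darboux_leftVariation_left hq).symm

/-- Along a map `F` with Darboux derivative `η`, the field `h = Ad(F⁻¹) v` satisfies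
`dh = -[η, h]`. This is the Maurer–Cartan equation of `leftVariation F`. -/
theorem fderiv_adInv {F : E → X} {p : E} (hF : ContMDiffAt 𝓘(ℝ, E) (𝓡 3) ∞ F p) (v : E3) (u : E) :
    fderiv ℝ (fun q => adInv (F q)) p u v = -lieBr X (darboux F p u) (adInv (F p) v) := by
  have hK := contMDiffAt_leftVariation hF
  have hMC := darboux_maurerCartan hK (0, u) (v, 0)
  have hev := eventually_mdifferentiableAt hK
  have hd : DifferentiableAt ℝ (darboux (leftVariation F)) (0, p) :=
    (contDiffAt_darboux hK).differentiableAt (by simp)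
  have hA0 : ∀ w, darboux (leftVariation F) (0, p) (w, 0) = adInv (F p) w := fun w =>
    congrArg (fun L : E3 →L[ℝ] E3 => L w) (darboux_leftVariation_left hev.self_of_nhds)
  have hw0 : ∀ w, darboux (leftVariation F) (0, p) (0, w) = darboux F p w := fun w =>
    congrArg (fun L : E →L[ℝ] E3 => L w) (darboux_leftVariation_right hev.self_of_nhds)
  have h1 : fderiv ℝ (darboux (leftVariation F)) (0, p) (0, u) (v, 0) =
      fderiv ℝ (fun q => adInv (F q)) p u v := by
    have hc : ContinuousAt (fun q : E => ((0 : E3), q)) p := by fun_prop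
    have he : (fun q => adInv (F q)) =ᶠ[𝓝 p] fun q => (darboux (leftVariation F) (0, q)).comp
        (ContinuousLinearMap.inl ℝ E3 E) := by
      filter_upwards [hc.eventually hev] with q hq
      exact (darboux_leftVariation_left hq).symm
    have hd2 := (hd.hasFDerivAt.comp p (hasFDerivAt_prodMk_right (𝕜 := ℝ) (0 : E3) p)).clm_comp
      (hasFDerivAt_const (ContinuousLinearMap.inl ℝ E3 E) p)
    rw [he.fderiv_eq]
    erw [hd2.fderiv]
    simp
  have h2 : fderiv ℝ (darboux (leftVariation F)) (0, p) (v, 0) (0, u) = 0 := by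
    have hc : ContinuousAt (fun s : E3 => (s, p)) 0 := by fun_prop
    have he : (fun s : E3 => (darboux (leftVariation F) (s, p)).comp
        (ContinuousLinearMap.inr ℝ E3 E)) =ᶠ[𝓝 0] fun _ => darboux F p := by
      filter_upwards [hc.eventually hev] with q hq
      exact darboux_leftVariation_right hq
    have hd2 := (hd.hasFDerivAt.comp (0 : E3) (hasFDerivAt_prodMk_left (𝕜 := ℝ) (0 : E3) p)).clm_comp
      (hasFDerivAt_const (ContinuousLinearMap.inr ℝ E3 E) (0 : E3))
    have h3 := hd2.unique ((hasFDerivAt_const (darboux F p) (0 : E3)).congr_of_eventuallyEq he)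
    have h4 := congrArg (fun L : E3 →L[ℝ] E →L[ℝ] E3 => L v u) h3
    simpa using h4
  rw [h1, h2, sub_zero, hA0, hw0] at hMC
  exact hMC

/-- A smooth vector field `V` along a map `F` into `X`, translated back to `T_e X`, is smooth: `V` is
the velocity at `t = 0` of a variation of `F`, and Darboux derivatives of smooth maps are smooth. -/
theorem contDiffAt_toLieAlgebra {F : E → X} {V : ∀ q, TangentSpace (𝓡 3) (F q)} {p : E}
    (hV : ContMDiffAt 𝓘(ℝ, E) (𝓡 3).tangent ∞ (fun q => (⟨F q, V q⟩ : TangentBundle (𝓡 3) X)) p) :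
    ContDiffAt (F := E3) ℝ ∞ (fun q => toLieAlgebra (F q) (V q)) p := by
  have : IsManifold (𝓡 3) ∞ X := inferInstance
  obtain ⟨hF, hN⟩ := (Bundle.contMDiffAt_totalSpace).1 hV
  simp only at hF hN
  set χ := extChartAt (𝓡 3) (F p) with hχ
  have hsrc : ∀ᶠ q in 𝓝 p, F q ∈ (chartAt E3 (F p)).source :=
    hF.continuousAt.eventually_mem (chart_source_mem_nhds E3 (F p))
  set Nt : E → E3 := fun q => (trivializationAt E3 (TangentSpace (𝓡 3)) (F p) ⟨F q, V q⟩).2 with hNt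
  have hNt' : ∀ᶠ q in 𝓝 p, Nt q = mfderiv (𝓡 3) 𝓘(ℝ, E3) χ (F q) (V q) := by
    filter_upwards [hsrc] with q hq
    have h1 : (trivializationAt E3 (TangentSpace (𝓡 3)) (F p)).continuousLinearMapAt ℝ (F q) (V q)
        = Nt q := by
      rw [Bundle.Trivialization.continuousLinearMapAt_apply,
        Bundle.Trivialization.coe_linearMapAt_of_mem]
      exact hq
    exact h1.symm.trans (congrArg (fun L : E3 →L[ℝ] E3 => L (V q))
      (TangentBundle.continuousLinearMapAt_trivializationAt (I := 𝓡 3) hq))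
  -- a variation of `F` with velocity `V` at time zero, linear in time in the chart at `F p`
  let K : ℝ × E → X := fun w => χ.symm (χ (F w.2) + w.1 • Nt w.2)
  have hKs : ContMDiffAt 𝓘(ℝ, ℝ × E) (𝓡 3) ∞ K (0, p) := by
    have hχF : ContDiffAt ℝ ∞ (fun q => χ (F q)) p := by
      rw [← contMDiffAt_iff_contDiffAt]
      exact ContMDiffAt.comp p (g := χ) contMDiffAt_extChartAt hF
    have hsm : ContDiffAt ℝ ∞ (fun w : ℝ × E => χ (F w.2) + w.1 • Nt w.2) (0, p) := by
      refine ContDiffAt.add ?_ (contDiffAt_fst.smul ?_)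
      · exact ContDiffAt.comp (0, p) (g := fun q => χ (F q)) (f := Prod.snd) hχF contDiffAt_snd
      · exact ContDiffAt.comp (0, p) (g := Nt) (f := Prod.snd) hN.contDiffAt contDiffAt_snd
    refine ContMDiffAt.comp (0, p) (g := fun y => χ.symm y) ?_ hsm.contMDiffAt
    simp only [zero_smul, add_zero]
    exact (contMDiffOn_extChartAt_symm (n := ∞) (F p)).contMDiffAt
      ((isOpen_extChartAt_target (F p)).mem_nhds (mem_extChartAt_target (F p)))
  have h1 : ContDiffAt ℝ ∞ (fun q : E => darboux K (0, q) (1, 0)) p :=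
    (ContDiffAt.comp p (g := darboux K) (f := fun q => ((0 : ℝ), q)) (contDiffAt_darboux hKs)
      (contDiffAt_const.prodMk contDiffAt_id)).clm_apply contDiffAt_const
  refine h1.congr_of_eventuallyEq ?_
  have hc : ContinuousAt (fun q : E => ((0 : ℝ), q)) p := by fun_prop
  filter_upwards [hsrc, hNt', hc.eventually (eventually_mdifferentiableAt hKs)] with q hq hq2 hq3
  have hqs : F q ∈ χ.source := by rwa [hχ, extChartAt_source]
  have hline : HasFDerivAt (fun t : ℝ => χ (F q) + t • Nt q)
      ((1 : ℝ →L[ℝ] ℝ).smulRight (Nt q)) 0 :=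
    ((ContinuousLinearMap.hasFDerivAt (1 : ℝ →L[ℝ] ℝ)).smul_const (Nt q)).const_add _
  have e1 : darboux K (0, q) (1, 0) = darboux (fun t : ℝ => K (t, q)) 0 1 := by
    have h := darboux_comp (F := K) (φ := fun t : ℝ => (t, q)) (q := 0) hq3 (by fun_prop)
    rw [(hasFDerivAt_prodMk_left (𝕜 := ℝ) (0 : ℝ) q).fderiv] at h
    exact (congrArg (fun L : ℝ →L[ℝ] E3 => L 1) h).symm
  have hsymm : MDifferentiableAt 𝓘(ℝ, E3) (𝓡 3) χ.symm (χ (F q) + (0 : ℝ) • Nt q) := by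
    rw [zero_smul, add_zero]
    exact ((contMDiffOn_extChartAt_symm (n := ∞) (F p)).contMDiffAt
      ((isOpen_extChartAt_target (F p)).mem_nhds (χ.map_source hqs))).mdifferentiableAt (by simp)
  have hKd : MDifferentiableAt 𝓘(ℝ, ℝ) (𝓡 3) (fun t : ℝ => K (t, q)) 0 :=
    MDifferentiableAt.comp (0 : ℝ) (g := χ.symm) (f := fun t : ℝ => χ (F q) + t • Nt q)
      hsymm hline.differentiableAt.mdifferentiableAt
  rw [e1, darboux_apply hKd]
  have h3 : ∀ {y : X} (hy : y = F q) (w : E3), toLieAlgebra y w = toLieAlgebra (F q) w := by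
    rintro y rfl w; rfl
  have hK0 : K (0, q) = F q := by
    simp only [K, zero_smul, add_zero]
    exact χ.left_inv hqs
  refine Eq.trans ?_ (h3 hK0 _).symm
  refine congrArg (toLieAlgebra (F q)) (Eq.symm ?_)
  have hsymm' : MDifferentiableAt 𝓘(ℝ, E3) (𝓡 3) χ.symm (χ (F q)) := by
    rwa [zero_smul, add_zero] at hsymm
  have hcomp := mfderiv_comp_apply_of_eq (I := 𝓘(ℝ, ℝ)) (I' := 𝓘(ℝ, E3)) (I'' := 𝓡 3)
    (g := χ.symm) (f := fun t : ℝ => χ (F q) + t • Nt q) (x := 0) (y := χ (F q))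
    hsymm' hline.differentiableAt.mdifferentiableAt (by simp) 1
  refine Eq.trans hcomp ?_
  have hl : (mfderiv 𝓘(ℝ, ℝ) 𝓘(ℝ, E3) (fun t : ℝ => χ (F q) + t • Nt q) 0 : ℝ →L[ℝ] E3) 1
      = mfderiv (𝓡 3) 𝓘(ℝ, E3) χ (F q) (V q) := by
    rw [mfderiv_eq_fderiv, hline.fderiv, ← hq2]
    exact one_smul ℝ (Nt q)
  have hid := mfderivWithin_extChartAt_symm_comp_mfderiv_extChartAt' (I := 𝓡 3) hqs
  simp only [modelWithCornersSelf_coe, range_id, mfderivWithin_univ] at hid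
  refine Eq.trans (congrArg (fun w : E3 => (mfderiv 𝓘(ℝ, E3) (𝓡 3) χ.symm (χ (F q)) :
    E3 →L[ℝ] E3) w) hl) ?_
  exact congrArg (fun L : E3 →L[ℝ] E3 => L (V q)) hid

theorem toLieAlgebra_injective (x : X) : Function.Injective (toLieAlgebra x) := by
  intro v w h
  rw [← mulInvariantVectorField_toLieAlgebra x v, h, mulInvariantVectorField_toLieAlgebra]

theorem rightInvariantField_injective (x : X) :
    Function.Injective (fun v : GroupLieAlgebra (𝓡 3) X => rightInvariantField v x) := by
  have key : ∀ v : GroupLieAlgebra (𝓡 3) X,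
      (mfderiv (𝓡 3) (𝓡 3) (fun z : X => z * x⁻¹) x : E3 →L[ℝ] E3) (rightInvariantField v x)
        = v := by
    intro v
    have h := mfderiv_comp_apply_of_eq (I := 𝓡 3) (I' := 𝓡 3) (I'' := 𝓡 3)
      (g := fun z : X => z * x⁻¹) (f := fun z : X => z * x) (x := 1) (y := x)
      (mdifferentiableAt_mul_right' x⁻¹ x) (mdifferentiableAt_mul_right' x 1) (one_mul x) v
    have hid : (fun z : X => z * x⁻¹) ∘ (fun z : X => z * x) = id := by
      funext z; simp
    rw [hid, mfderiv_id] at h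
    exact h.symm
  intro v w h
  simp only at h
  rw [← key v, h, key]

theorem adInv_injective (x : X) : Function.Injective (adInv x) := by
  intro v w h
  have hv := adInv_apply (X := X) x v
  have hw := adInv_apply (X := X) x w
  rw [hv, hw] at h
  exact rightInvariantField_injective x (toLieAlgebra_injective x h)

variable (X) in
/-- The bracket of `T_e X` as a bilinear map on the model space. -/
def lieBrₗ : E3 →ₗ[ℝ] E3 →ₗ[ℝ] E3 :=
  have : LieGroup (𝓡 3) (minSmoothness ℝ 3) X := LieGroup.of_le (n := ∞) (by simp; norm_cast)
  LinearMap.mk₂ ℝ (lieBr X)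
    (fun u u' v => add_lie (L := GroupLieAlgebra (𝓡 3) X) (M := GroupLieAlgebra (𝓡 3) X) u u' v)
    (fun c u v => smul_lie (L := GroupLieAlgebra (𝓡 3) X) (M := GroupLieAlgebra (𝓡 3) X) c u v)
    (fun u v v' => lie_add (L := GroupLieAlgebra (𝓡 3) X) (M := GroupLieAlgebra (𝓡 3) X) u v v')
    (fun c u v => lie_smul (L := GroupLieAlgebra (𝓡 3) X) (M := GroupLieAlgebra (𝓡 3) X) c u v)

variable (X) in
theorem lieBrₗ_apply (u v : E3) : lieBrₗ X u v = lieBr X u v := rfl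

variable (X) in
theorem lieBrₗ_self (u : E3) : lieBrₗ X u u = 0 :=
  have : LieGroup (𝓡 3) (minSmoothness ℝ 3) X := LieGroup.of_le (n := ∞) (by simp; norm_cast)
  lie_self (L := GroupLieAlgebra (𝓡 3) X) u

end Adjoint

/-! ### Linear algebra of oriented orthonormal frames -/

/-- The cross product of Euclidean three-space. -/
def cross (x y : E3) : E3 :=
  !₂[x 1 * y 2 - x 2 * y 1, x 2 * y 0 - x 0 * y 2, x 0 * y 1 - x 1 * y 0]

/-- The `i`-th vector of the standard basis of Euclidean three-space. -/
def stdE (i : Fin 3) : E3 := EuclideanSpace.single i 1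

theorem inner_E3 (x y : E3) : ⟪x, y⟫ = x 0 * y 0 + x 1 * y 1 + x 2 * y 2 := by
  simp [PiLp.inner_apply, Fin.sum_univ_three]; ring

theorem cross_apply_zero (x y : E3) : cross x y 0 = x 1 * y 2 - x 2 * y 1 := rfl
theorem cross_apply_one (x y : E3) : cross x y 1 = x 2 * y 0 - x 0 * y 2 := rfl
theorem cross_apply_two (x y : E3) : cross x y 2 = x 0 * y 1 - x 1 * y 0 := rfl

theorem E3_ext {x y : E3} (h0 : x 0 = y 0) (h1 : x 1 = y 1) (h2 : x 2 = y 2) : x = y := by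
  ext i; fin_cases i <;> assumption

theorem inner_cross_left (x y : E3) : ⟪x, cross x y⟫ = 0 := by
  rw [inner_E3, cross_apply_zero, cross_apply_one, cross_apply_two]; ring

theorem inner_cross_right (x y : E3) : ⟪y, cross x y⟫ = 0 := by
  rw [inner_E3, cross_apply_zero, cross_apply_one, cross_apply_two]; ring

theorem inner_cross_self (x y : E3) :
    ⟪cross x y, cross x y⟫ = ⟪x, x⟫ * ⟪y, y⟫ - ⟪x, y⟫ ^ 2 := by
  simp only [inner_E3, cross_apply_zero, cross_apply_one, cross_apply_two]; ring

theorem cross_cross_left (x y : E3) : cross x (cross x y) = ⟪x, y⟫ • x - ⟪x, x⟫ • y := by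
  apply E3_ext <;>
    simp only [inner_E3, cross_apply_zero, cross_apply_one, cross_apply_two, PiLp.sub_apply,
      PiLp.smul_apply, smul_eq_mul] <;> ring

theorem cross_cross_right (x y : E3) : cross y (cross x y) = ⟪y, y⟫ • x - ⟪x, y⟫ • y := by
  apply E3_ext <;>
    simp only [inner_E3, cross_apply_zero, cross_apply_one, cross_apply_two, PiLp.sub_apply,
      PiLp.smul_apply, smul_eq_mul] <;> ring

theorem cross_add_right (x y z : E3) : cross x (y + z) = cross x y + cross x z := by
  apply E3_ext <;>
    simp only [cross_apply_zero, cross_apply_one, cross_apply_two, PiLp.add_apply] <;> ring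

theorem cross_smul_right (x y : E3) (c : ℝ) : cross x (c • y) = c • cross x y := by
  apply E3_ext <;>
    simp only [cross_apply_zero, cross_apply_one, cross_apply_two, PiLp.smul_apply,
      smul_eq_mul] <;> ring

theorem contDiff_cross : ContDiff ℝ ∞ (fun w : E3 × E3 => cross w.1 w.2) := by
  rw [contDiff_euclidean]
  intro i
  fin_cases i <;> simp [cross] <;> fun_prop

/-- `κ` is a unit vector orthogonal to the unit vector `G`; then `(κ, G × κ, G)` is an oriented
orthonormal frame. -/
structure IsFrame (G κ : E3) : Prop where
  unit_left : ⟪G, G⟫ = 1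
  unit_right : ⟪κ, κ⟫ = 1
  orth : ⟪G, κ⟫ = 0

namespace IsFrame

variable {G κ : E3}

theorem inner_cross_self_eq_one (h : IsFrame G κ) : ⟪cross G κ, cross G κ⟫ = 1 := by
  rw [inner_cross_self, h.unit_left, h.unit_right, h.orth]; norm_num

theorem cross_left (h : IsFrame G κ) : cross G (cross G κ) = -κ := by
  rw [cross_cross_left, h.unit_left, h.orth, zero_smul, one_smul, zero_sub]

theorem cross_right (h : IsFrame G κ) : cross κ (cross G κ) = G := by
  rw [cross_cross_right, h.unit_right, h.orth, zero_smul, one_smul, sub_zero]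

theorem orthonormal (h : IsFrame G κ) : Orthonormal ℝ ![κ, cross G κ, G] := by
  rw [orthonormal_iff_ite]
  have h1 := inner_cross_left G κ
  have h2 := inner_cross_right G κ
  have h3 := h.orth
  have h4 := h.inner_cross_self_eq_one
  have h1' : ⟪cross G κ, G⟫ = 0 := by rw [real_inner_comm]; exact h1
  have h2' : ⟪cross G κ, κ⟫ = 0 := by rw [real_inner_comm]; exact h2
  have h3' : ⟪κ, G⟫ = 0 := by rw [real_inner_comm]; exact h3
  have h5 := h.unit_left
  have h6 := h.unit_right
  intro i j
  fin_cases i <;> fin_cases j <;> assumption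

/-- The orthonormal basis `(κ, G × κ, G)`. -/
def basis (h : IsFrame G κ) : OrthonormalBasis (Fin 3) ℝ E3 :=
  OrthonormalBasis.mk h.orthonormal (by
    have := h.orthonormal.linearIndependent.span_eq_top_of_card_eq_finrank' (by simp)
    exact this.ge)

theorem basis_zero (h : IsFrame G κ) : h.basis 0 = κ := by simp [basis]
theorem basis_one (h : IsFrame G κ) : h.basis 1 = cross G κ := by simp [basis]
theorem basis_two (h : IsFrame G κ) : h.basis 2 = G := by simp [basis]

theorem expand (h : IsFrame G κ) (x : E3) :
    x = ⟪κ, x⟫ • κ + ⟪cross G κ, x⟫ • cross G κ + ⟪G, x⟫ • G := by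
  have := h.basis.sum_repr' x
  rw [Fin.sum_univ_three, h.basis_zero, h.basis_one, h.basis_two] at this
  exact this.symm

theorem expand_tangent (h : IsFrame G κ) {x : E3} (hx : ⟪G, x⟫ = 0) :
    x = ⟪κ, x⟫ • κ + ⟪cross G κ, x⟫ • cross G κ := by
  have := h.expand x
  rwa [hx, zero_smul, add_zero] at this

theorem trace_eq (h : IsFrame G κ) (T : E3 →ₗ[ℝ] E3) :
    LinearMap.trace ℝ E3 T =
      ⟪T κ, κ⟫ + ⟪T (cross G κ), cross G κ⟫ + ⟪T G, G⟫ := by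
  rw [LinearMap.trace_eq_sum_inner T h.basis, Fin.sum_univ_three, h.basis_zero, h.basis_one,
    h.basis_two]
  simp only [real_inner_comm]

end IsFrame

theorem exists_isFrame {G : E3} (hG : ⟪G, G⟫ = 1) : ∃ κ, IsFrame G κ := by
  have hne : (ℝ ∙ G)ᗮ ≠ ⊥ := by
    intro h
    have h1 := Submodule.finrank_add_finrank_orthogonal (ℝ ∙ G)
    rw [h, finrank_bot] at h1
    have h2 := finrank_span_le_card (R := ℝ) ({G} : Set E3)
    simp at h1 h2
    omega
  obtain ⟨x, hx, hx0⟩ := Submodule.exists_mem_ne_zero_of_ne_bot hne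
  rw [Submodule.mem_orthogonal_singleton_iff_inner_right] at hx
  have hn : ‖x‖ ≠ 0 := by simpa using hx0
  refine ⟨‖x‖⁻¹ • x, hG, ?_, ?_⟩
  · rw [real_inner_smul_left, real_inner_smul_right, real_inner_self_eq_norm_sq]
    field_simp
  · rw [real_inner_smul_right, hx, mul_zero]

/-! ### The algebra of the differential of the Gauss map at a point -/

/-- The linear map `L` such that `[x, y] = L (x × y)`. -/
def crossBr (br : E3 →ₗ[ℝ] E3 →ₗ[ℝ] E3) (w : E3) : E3 :=
  w 0 • br (stdE 1) (stdE 2) + w 1 • br (stdE 2) (stdE 0) + w 2 • br (stdE 0) (stdE 1)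

/-- The skew part of the differential of the Gauss map, as a function of the Gauss map. -/
def skewPart (br : E3 →ₗ[ℝ] E3 →ₗ[ℝ] E3) (G : E3) : ℝ := ⟪G, crossBr br G⟫

/-- The trace of the differential of the Gauss map of a surface of constant mean curvature `H`, as a
function of the Gauss map. -/
def tracePart (br : E3 →ₗ[ℝ] E3 →ₗ[ℝ] E3) (H : ℝ) (G : E3) : ℝ :=
  -2 * H + LinearMap.trace ℝ E3 (br G)

theorem stdE_sum (x : E3) : x = x 0 • stdE 0 + x 1 • stdE 1 + x 2 • stdE 2 := by
  apply E3_ext <;> simp [stdE]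

theorem br_swap {br : E3 →ₗ[ℝ] E3 →ₗ[ℝ] E3} (hbr : ∀ x, br x x = 0) (x y : E3) :
    br y x = -br x y := by
  have h := hbr (x + y)
  simp only [map_add, LinearMap.add_apply, hbr, zero_add, add_zero] at h
  exact eq_neg_of_add_eq_zero_left h

theorem crossBr_cross {br : E3 →ₗ[ℝ] E3 →ₗ[ℝ] E3} (hbr : ∀ x, br x x = 0) (x y : E3) :
    crossBr br (cross x y) = br x y := by
  conv_rhs => rw [stdE_sum x, stdE_sum y]
  simp only [map_add, LinearMap.add_apply, map_smul, LinearMap.smul_apply, hbr, crossBr,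
    cross_apply_zero, cross_apply_one, cross_apply_two]
  rw [br_swap hbr (stdE 0) (stdE 1), br_swap hbr (stdE 1) (stdE 2), br_swap hbr (stdE 2) (stdE 0)]
  module

theorem contDiff_crossBr (br : E3 →ₗ[ℝ] E3 →ₗ[ℝ] E3) : ContDiff ℝ ∞ (crossBr br) := by
  unfold crossBr; fun_prop

theorem contDiff_skewPart (br : E3 →ₗ[ℝ] E3 →ₗ[ℝ] E3) : ContDiff ℝ ∞ (skewPart br) :=
  contDiff_id.inner ℝ (contDiff_crossBr br)

theorem contDiff_tracePart (br : E3 →ₗ[ℝ] E3 →ₗ[ℝ] E3) (H : ℝ) :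
    ContDiff ℝ ∞ (tracePart br H) :=
  contDiff_const.add ((LinearMap.trace ℝ E3 ∘ₗ br).toContinuousLinearMap.contDiff)

/-- The first order data at a point of a surface in a metric Lie group, in an orthonormal frame of
the Lie algebra: the Gauss map `G`, the left translated differential `η` of the immersion, and the
differential `D` of the Gauss map. The composite of `D` and `η⁻¹` has its trace and its skew part
determined by `G`, and these do not vanish simultaneously. -/
structure GaussData (br : E3 →ₗ[ℝ] E3 →ₗ[ℝ] E3) (H : ℝ) (G : E3) (η D : E2 →L[ℝ] E3) : Prop where
  inj : Function.Injective η
  unit : ⟪G, G⟫ = 1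
  normal : ∀ u, ⟪G, η u⟫ = 0
  tangent : ∀ u, ⟪G, D u⟫ = 0
  trace : ∀ u v, ⟪η u, η u⟫ = 1 → ⟪η v, η v⟫ = 1 → ⟪η u, η v⟫ = 0 →
    ⟪D u, η u⟫ + ⟪D v, η v⟫ = tracePart br H G
  skew : ∀ u v, ⟪D u, η v⟫ - ⟪D v, η u⟫ = ⟪G, br (η u) (η v)⟫
  ne_zero : skewPart br G ≠ 0 ∨ tracePart br H G ≠ 0

/-- The image of the unit vector `G × κ` under the differential of a Gauss map of rank one with
kernel spanned by `κ`. -/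
def gaussVelocity (br : E3 →ₗ[ℝ] E3 →ₗ[ℝ] E3) (H : ℝ) (G κ : E3) : E3 :=
  -skewPart br G • κ + tracePart br H G • cross G κ

namespace GaussData

variable {br : E3 →ₗ[ℝ] E3 →ₗ[ℝ] E3} {H : ℝ} {G κ : E3} {η D : E2 →L[ℝ] E3}

theorem exists_preimage (h : GaussData br H G η D) {x : E3} (hx : ⟪G, x⟫ = 0) : ∃ u, η u = x := by
  have hle : LinearMap.range η.toLinearMap ≤ (ℝ ∙ G)ᗮ := by
    rintro _ ⟨u, rfl⟩
    rw [Submodule.mem_orthogonal_singleton_iff_inner_right]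
    exact h.normal u
  have hG : G ≠ 0 := by
    rintro rfl
    simpa using h.unit
  have h1 := Submodule.finrank_add_finrank_orthogonal (ℝ ∙ G)
  rw [finrank_span_singleton hG] at h1
  have h2 := LinearMap.finrank_range_of_inj (f := η.toLinearMap) h.inj
  have heq := Submodule.eq_of_le_of_finrank_le hle (by
    rw [h2]
    simp only [finrank_euclideanSpace, Fintype.card_fin] at h1 ⊢
    omega)
  have : x ∈ (ℝ ∙ G)ᗮ := by
    rw [Submodule.mem_orthogonal_singleton_iff_inner_right]
    exact hx
  rw [← heq] at this
  exact this

/-- If the differential of the Gauss map has a kernel, then it is determined by the Gauss map and the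
direction of that kernel. -/
theorem apply_eq (h : GaussData br H G η D) (hbr : ∀ x, br x x = 0) (hκ : IsFrame G κ) {k : E2}
    (hk : η k = κ) (hDk : D k = 0) (u : E2) :
    D u = ⟪cross G κ, η u⟫ • gaussVelocity br H G κ := by
  obtain ⟨n, hn⟩ := h.exists_preimage (inner_cross_left G κ)
  have hu : u = ⟪κ, η u⟫ • k + ⟪cross G κ, η u⟫ • n := by
    apply h.inj
    rw [map_add, map_smul, map_smul, hk, hn]
    exact hκ.expand_tangent (h.normal u)
  have htr := h.trace k n (by rw [hk, hκ.unit_right]) (by rw [hn, hκ.inner_cross_self_eq_one])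
    (by rw [hk, hn, inner_cross_right])
  have hsk := h.skew k n
  rw [hDk, inner_zero_left, zero_add, hn] at htr
  rw [hDk, inner_zero_left, zero_sub, hk, hn, ← crossBr_cross hbr, hκ.cross_right] at hsk
  have hDn : D n = gaussVelocity br H G κ := by
    rw [hκ.expand_tangent (h.tangent n), real_inner_comm, real_inner_comm _ (cross G κ), htr,
      show ⟪D n, κ⟫ = -skewPart br G by rw [skewPart, ← hsk, neg_neg]]
    rfl
  conv_lhs => rw [hu]
  rw [map_add, map_smul, map_smul, hDk, smul_zero, zero_add, hDn]

theorem velocity_ne_zero (h : GaussData br H G η D) (hκ : IsFrame G κ) :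
    gaussVelocity br H G κ ≠ 0 := by
  intro h0
  have h1 : ⟪κ, gaussVelocity br H G κ⟫ = -skewPart br G := by
    rw [gaussVelocity, inner_add_right, real_inner_smul_right, real_inner_smul_right,
      hκ.unit_right, inner_cross_right]; ring
  have h2 : ⟪cross G κ, gaussVelocity br H G κ⟫ = tracePart br H G := by
    rw [gaussVelocity, inner_add_right, real_inner_smul_right, real_inner_smul_right,
      hκ.inner_cross_self_eq_one, real_inner_comm, inner_cross_right]; ring
  rw [h0, inner_zero_right] at h1 h2
  rcases h.ne_zero with h3 | h3
  · exact h3 (by linarith)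
  · exact h3 h2.symm

theorem differential_ne_zero (h : GaussData br H G η D) (hbr : ∀ x, br x x = 0) : D ≠ 0 := by
  intro h0
  obtain ⟨κ, hκ⟩ := exists_isFrame h.unit
  obtain ⟨k, hk⟩ := h.exists_preimage hκ.orth
  obtain ⟨n, hn⟩ := h.exists_preimage (inner_cross_left G κ)
  have := h.apply_eq hbr hκ hk (by simp [h0]) n
  rw [hn, hκ.inner_cross_self_eq_one, one_smul, h0] at this
  exact h.velocity_ne_zero hκ this.symm

theorem exists_unit_kernel (h : GaussData br H G η D) {k : E2} (hk0 : k ≠ 0) (hDk : D k = 0) :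
    ∃ κ k', IsFrame G κ ∧ η k' = κ ∧ D k' = 0 := by
  have hn : ‖η k‖ ≠ 0 := by
    rw [norm_ne_zero_iff]
    intro h0
    exact hk0 (h.inj (by rw [h0, map_zero]))
  refine ⟨‖η k‖⁻¹ • η k, ‖η k‖⁻¹ • k, ⟨h.unit, ?_, ?_⟩, by rw [map_smul], by
    rw [map_smul, hDk, smul_zero]⟩
  · rw [real_inner_smul_left, real_inner_smul_right, real_inner_self_eq_norm_sq]
    field_simp
  · rw [real_inner_smul_right, h.normal, mul_zero]

theorem kernel_unique (h : GaussData br H G η D) (hbr : ∀ x, br x x = 0) {k k' : E2}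
    (hk0 : k ≠ 0) (hDk : D k = 0) (hDk' : D k' = 0) : ∃ c : ℝ, k' = c • k := by
  by_contra hc
  push Not at hc
  apply h.differential_ne_zero hbr
  have hli : LinearIndependent ℝ ![k, k'] := by
    rw [LinearIndependent.pair_iff' hk0]
    exact fun a ha => hc a ha.symm
  have hsp := hli.span_eq_top_of_card_eq_finrank' (by simp)
  ext1 u
  have hu : u ∈ Submodule.span ℝ (range ![k, k']) := by rw [hsp]; trivial
  have hle : Submodule.span ℝ (range ![k, k']) ≤ LinearMap.ker D.toLinearMap := by
    rw [Submodule.span_le]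
    rintro _ ⟨i, rfl⟩
    fin_cases i
    · exact hDk
    · exact hDk'
  exact hle hu

/-- The kernel direction of the differential of the Gauss map, in terms of any nonzero vector of its
image. -/
theorem kernel_of_image (h : GaussData br H G η D) (hbr : ∀ x, br x x = 0) {k : E2} (hk0 : k ≠ 0)
    (hDk : D k = 0) {u : E2} (hu : D u ≠ 0) :
    ∃ k', k' ≠ 0 ∧ D k' = 0 ∧
      η k' = skewPart br G • D u + tracePart br H G • cross G (D u) := by
  obtain ⟨κ, k₁, hκ, hk₁, hDk₁⟩ := h.exists_unit_kernel hk0 hDk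
  have hDu := h.apply_eq hbr hκ hk₁ hDk₁ u
  set θ := ⟪cross G κ, η u⟫
  have hθ : θ ≠ 0 := by
    intro h0
    rw [h0, zero_smul] at hDu
    exact hu hDu
  have hc : θ * (skewPart br G ^ 2 + tracePart br H G ^ 2) ≠ 0 := by
    refine mul_ne_zero hθ ?_
    rcases h.ne_zero with h3 | h3 <;> positivity
  refine ⟨-(θ * (skewPart br G ^ 2 + tracePart br H G ^ 2)) • k₁, ?_, ?_, ?_⟩
  · rw [smul_ne_zero_iff]
    refine ⟨neg_ne_zero.2 hc, ?_⟩
    rintro rfl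
    have := hκ.unit_right
    rw [← hk₁, map_zero, inner_zero_left] at this
    norm_num at this
  · rw [map_smul, hDk₁, smul_zero]
  · rw [map_smul, hk₁, hDu, cross_smul_right, gaussVelocity, cross_add_right, cross_smul_right,
      cross_smul_right, hκ.cross_left]
    module

end GaussData

/-! ### The kernel of the differential of the Gauss map -/

/-- The Gauss map `G` and the left translated differential `η` of a surface in a metric Lie group,
in a chart with domain `U` and in an orthonormal frame of the Lie algebra. -/
structure GaussChart (br : E3 →ₗ[ℝ] E3 →ₗ[ℝ] E3) (H : ℝ) (U : Set E2) (G : E2 → E3)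
    (η : E2 → E2 →L[ℝ] E3) : Prop where
  isOpen : IsOpen U
  br_self : ∀ x, br x x = 0
  smooth_G : ∀ x ∈ U, ContDiffAt ℝ ∞ G x
  smooth_η : ∀ x ∈ U, ContDiffAt ℝ ∞ η x
  data : ∀ x ∈ U, GaussData br H (G x) (η x) (fderiv ℝ G x)
  maurerCartan : ∀ x ∈ U, ∀ u v,
    fderiv ℝ η x u v - fderiv ℝ η x v u = -br (η x u) (η x v)

theorem ContDiffAt.eventually_differentiableAt {E F : Type*} [NormedAddCommGroup E]
    [NormedSpace ℝ E] [NormedAddCommGroup F] [NormedSpace ℝ F] {f : E → F} {x : E}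
    (hf : ContDiffAt ℝ ∞ f x) : ∀ᶠ y in 𝓝 x, DifferentiableAt ℝ f y :=
  ((hf.of_le (m := 1) (by norm_cast)).eventually (by simp)).mono
    fun _ hy => hy.differentiableAt (by simp)

namespace GaussChart

variable {br : E3 →ₗ[ℝ] E3 →ₗ[ℝ] E3} {H : ℝ} {U : Set E2} {G : E2 → E3} {η : E2 → E2 →L[ℝ] E3}

/-- The kernel of the differential of a Gauss map of rank one is spanned by a smooth unit field. -/
theorem exists_kernel_field (h : GaussChart br H U G η)
    (hker : ∀ x ∈ U, ∃ k, k ≠ 0 ∧ fderiv ℝ G x k = 0) {p : E2} (hp : p ∈ U) :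
    ∃ κ : E2 → E3, ContDiffAt ℝ ∞ κ p ∧ ∀ᶠ x in 𝓝 p, IsFrame (G x) (κ x) ∧
      ∃ k, η x k = κ x ∧ fderiv ℝ G x k = 0 := by
  obtain ⟨u, hu⟩ : ∃ u, fderiv ℝ G p u ≠ 0 := by
    by_contra hc
    push Not at hc
    exact (h.data p hp).differential_ne_zero h.br_self (by ext1 u; exact hc u)
  have hGp := h.smooth_G p hp
  have hDu : ContDiffAt ℝ ∞ (fun x => fderiv ℝ G x u) p :=
    (hGp.fderiv_right (m := ∞) (by simp)).clm_apply contDiffAt_const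
  have hev : ∀ᶠ x in 𝓝 p, fderiv ℝ G x u ≠ 0 := hDu.continuousAt.eventually_ne hu
  -- the image of `dG` is spanned by `dG u`, and the kernel direction is a function of the image
  set ξ : E2 → E3 := fun x => skewPart br (G x) • fderiv ℝ G x u +
    tracePart br H (G x) • cross (G x) (fderiv ℝ G x u) with hξ
  have hξs : ContDiffAt ℝ ∞ ξ p := by
    have h1 : ContDiffAt ℝ ∞ (fun x => skewPart br (G x)) p :=
      (contDiff_skewPart br).contDiffAt.comp p hGp
    have h2 : ContDiffAt ℝ ∞ (fun x => tracePart br H (G x)) p :=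
      (contDiff_tracePart br H).contDiffAt.comp p hGp
    have h3 : ContDiffAt ℝ ∞ (fun x => cross (G x) (fderiv ℝ G x u)) p :=
      contDiff_cross.contDiffAt.comp p (hGp.prodMk hDu)
    exact (h1.smul hDu).add (h2.smul h3)
  have hk : ∀ᶠ x in 𝓝 p, ∃ k, k ≠ 0 ∧ fderiv ℝ G x k = 0 ∧ η x k = ξ x := by
    filter_upwards [hev, h.isOpen.mem_nhds hp] with x hx hxU
    obtain ⟨k, hk0, hDk⟩ := hker x hxU
    exact (h.data x hxU).kernel_of_image h.br_self hk0 hDk hx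
  have hne : ∀ᶠ x in 𝓝 p, ξ x ≠ 0 := by
    filter_upwards [hk, h.isOpen.mem_nhds hp] with x ⟨k, hk0, _, hk⟩ hxU h0
    exact hk0 ((h.data x hxU).inj (by rw [hk, h0, map_zero]))
  refine ⟨fun x => ‖ξ x‖⁻¹ • ξ x, ?_, ?_⟩
  · exact ((hξs.norm ℝ hne.self_of_nhds).inv (norm_ne_zero_iff.2 hne.self_of_nhds)).smul hξs
  · filter_upwards [hk, hne, h.isOpen.mem_nhds hp] with x ⟨k, hk0, hDk, hk⟩ hx hxU
    have hn : ‖ξ x‖ ≠ 0 := norm_ne_zero_iff.2 hx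
    refine ⟨⟨(h.data x hxU).unit, ?_, ?_⟩, ‖ξ x‖⁻¹ • k, by rw [map_smul, hk], by
      rw [map_smul, hDk, smul_zero]⟩
    · rw [real_inner_smul_left, real_inner_smul_right, real_inner_self_eq_norm_sq]
      field_simp
    · rw [← hk, real_inner_smul_right, (h.data x hxU).normal, mul_zero]

theorem fderiv_inner_eq {E : Type*} [NormedAddCommGroup E] [NormedSpace ℝ E] {f g : E → E3} {x : E}
    {c : ℝ} (hf : DifferentiableAt ℝ f x) (hg : DifferentiableAt ℝ g x)
    (hc : ∀ᶠ y in 𝓝 x, ⟪f y, g y⟫ = c) (u : E) :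
    ⟪f x, fderiv ℝ g x u⟫ + ⟪fderiv ℝ f x u, g x⟫ = 0 := by
  have h1 := (hf.hasFDerivAt.inner ℝ hg.hasFDerivAt).unique
    ((hasFDerivAt_const c x).congr_of_eventuallyEq hc)
  have h2 := congrArg (fun L : E →L[ℝ] ℝ => L u) h1
  simpa using h2

/-- The unit field `κ` spanning the kernel of the differential of the Gauss map satisfies
`dκ = -[η, κ]` up to multiples of `κ`. The symmetry of the second derivative of `G` shows that `κ`
does not change in its own direction; the Maurer–Cartan equation gives the change in the direction of
`G × κ`. -/
theorem fderiv_kernel_field (h : GaussChart br H U G η) {x : E2} (hx : x ∈ U) {κ : E2 → E3}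
    (hκd : DifferentiableAt ℝ κ x)
    (hκ : ∀ᶠ y in 𝓝 x, IsFrame (G y) (κ y) ∧ ∃ k, η y k = κ y ∧ fderiv ℝ G y k = 0) (u : E2) :
    ∃ c : ℝ, fderiv ℝ κ x u + br (η x u) (κ x) = c • κ x := by
  have hGx := h.smooth_G x hx
  have hGd : DifferentiableAt ℝ G x := hGx.differentiableAt (by simp)
  have hηd : DifferentiableAt ℝ η x := (h.smooth_η x hx).differentiableAt (by simp)
  have hGd2 : DifferentiableAt ℝ (fderiv ℝ G) x :=
    (hGx.fderiv_right (m := 1) (by norm_cast)).differentiableAt (by simp)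
  have hsymm := hGx.isSymmSndFDerivAt (by simp; norm_cast)
  set ν : E2 → E3 := fun y => cross (G y) (κ y) with hν
  have hνd : DifferentiableAt ℝ ν x :=
    (contDiff_cross.differentiable (by simp)).differentiableAt.comp x (hGd.prodMk hκd)
  obtain ⟨hfr, k, hk, hDk⟩ := hκ.self_of_nhds
  have hdat := h.data x hx
  obtain ⟨n, hn⟩ := hdat.exists_preimage (inner_cross_left (G x) (κ x))
  have hn' : η x n = ν x := hn
  -- the frame equations
  have f1 := fderiv_inner_eq hκd hκd (hκ.mono fun y hy => hy.1.unit_right) k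
  have f2 := fderiv_inner_eq hGd hκd (hκ.mono fun y hy => hy.1.orth) k
  have f3 := fderiv_inner_eq hνd hνd (hκ.mono fun y hy => hy.1.inner_cross_self_eq_one) k
  have f4 := fderiv_inner_eq hGd hνd (hκ.mono fun y hy => inner_cross_left _ _) k
  have f5 := fderiv_inner_eq hκd hνd (hκ.mono fun y hy => inner_cross_right _ _) k
  rw [hDk, inner_zero_left, add_zero] at f2 f4
  rw [real_inner_comm (κ x) (fderiv ℝ κ x k)] at f1
  rw [real_inner_comm (ν x) (fderiv ℝ ν x k)] at f3
  set φ := ⟪ν x, fderiv ℝ κ x k⟫ with hφ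
  have hκk : fderiv ℝ κ x k = φ • ν x := by
    rw [hfr.expand_tangent f2, show ⟪κ x, fderiv ℝ κ x k⟫ = 0 by linarith, zero_smul, zero_add]
  have hνk : fderiv ℝ ν x k = -φ • κ x := by
    rw [hfr.expand_tangent f4, show ⟪cross (G x) (κ x), fderiv ℝ ν x k⟫ = 0 by
      change ⟪ν x, fderiv ℝ ν x k⟫ = 0; linarith, zero_smul, add_zero,
      show ⟪κ x, fderiv ℝ ν x k⟫ = -φ by
        rw [real_inner_comm] at hφ
        linarith]
  -- coefficients of the coframe dual to `κ`, `ν`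
  set α : E2 → E2 → ℝ := fun v y => ⟪κ y, η y v⟫ with hα
  set θ : E2 → E2 → ℝ := fun v y => ⟪ν y, η y v⟫ with hθ
  have hηv : ∀ v, DifferentiableAt ℝ (fun y => η y v) x := fun v =>
    hηd.clm_apply (differentiableAt_const v)
  have hαd : ∀ v, DifferentiableAt ℝ (α v) x := fun v => hκd.inner ℝ (hηv v)
  have hθd : ∀ v, DifferentiableAt ℝ (θ v) x := fun v => hνd.inner ℝ (hηv v)
  have hαk : α k x = 1 := by simp only [hα, hk, hfr.unit_right]
  have hαn : α n x = 0 := by simp only [hα, hn', hν, inner_cross_right]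
  have hθk : θ k x = 0 := by
    simp only [hθ, hk, hν]; rw [real_inner_comm, inner_cross_right]
  have hθn : θ n x = 1 := by simp only [hθ, hn', hν, hfr.inner_cross_self_eq_one]
  have hUx := h.isOpen.mem_nhds hx
  -- `dG` is the product of the form `θ` with `m`; as `G` is constant in the direction `k`, so are the
  -- coefficients of `m` with respect to `κ` and `ν`
  set m : E2 → E3 := fun y => gaussVelocity br H (G y) (κ y) with hm
  have hσd : DifferentiableAt ℝ (fun y => skewPart br (G y)) x :=
    ((contDiff_skewPart br).differentiable (by simp)).differentiableAt.comp x hGd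
  have hτd : DifferentiableAt ℝ (fun y => tracePart br H (G y)) x :=
    ((contDiff_tracePart br H).differentiable (by simp)).differentiableAt.comp x hGd
  have hmd : HasFDerivAt m _ x :=
    (hσd.hasFDerivAt.neg.smul hκd.hasFDerivAt).add (hτd.hasFDerivAt.smul hνd.hasFDerivAt)
  have hσk : fderiv ℝ (fun y => skewPart br (G y)) x k = 0 := by
    have := fderiv_comp x ((contDiff_skewPart br).differentiable (by simp)).differentiableAt hGd
    have h2 := congrArg (fun L : E2 →L[ℝ] ℝ => L k) this
    simpa [Function.comp_def, hDk] using h2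
  have hτk : fderiv ℝ (fun y => tracePart br H (G y)) x k = 0 := by
    have := fderiv_comp x ((contDiff_tracePart br H).differentiable (by simp)).differentiableAt hGd
    have h2 := congrArg (fun L : E2 →L[ℝ] ℝ => L k) this
    simpa [Function.comp_def, hDk] using h2
  have hmk : fderiv ℝ m x k = -(skewPart br (G x) * φ) • ν x - (tracePart br H (G x) * φ) • κ x := by
    rw [hmd.fderiv]
    simp only [add_apply, smul_apply, ContinuousLinearMap.smulRight_apply, neg_apply, Pi.neg_apply, hσk, hτk,
      hκk, hνk]
    module
  -- the second derivative of `G`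
  have hDG : ∀ v, (fun y => fderiv ℝ G y v) =ᶠ[𝓝 x] fun y => θ v y • m y := by
    intro v
    filter_upwards [hκ, hUx] with y ⟨hy, k', hk', hDk'⟩ hyU
    exact (h.data y hyU).apply_eq h.br_self hy hk' hDk' v
  have hD2 : ∀ u v, fderiv ℝ (fderiv ℝ G) x u v =
      fderiv ℝ (θ v) x u • m x + θ v x • fderiv ℝ m x u := by
    intro u v
    have h1 := (hGd2.hasFDerivAt.clm_apply (hasFDerivAt_const v x)).unique
      (((hθd v).hasFDerivAt.smul hmd.differentiableAt.hasFDerivAt).congr_of_eventuallyEq (hDG v))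
    have h2 := congrArg (fun L : E2 →L[ℝ] E3 => L u) h1
    simp at h2
    rw [h2]
    abel
  have hsk := hsymm k n
  rw [hD2, hD2, hθk, hθn, zero_smul, add_zero, one_smul, hmk] at hsk
  set q := fderiv ℝ (θ k) x n - fderiv ℝ (θ n) x k with hq
  set σ := skewPart br (G x) with hσ
  set τ := tracePart br H (G x) with hτ
  have hmx : m x = -σ • κ x + τ • ν x := rfl
  have hqm : -(σ * φ) • ν x - (τ * φ) • κ x = q • m x := by
    rw [hq, sub_smul, ← hsk]; abel
  have hκν : ⟪κ x, ν x⟫ = 0 := inner_cross_right _ _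
  have hνκ : ⟪ν x, κ x⟫ = 0 := by rw [real_inner_comm]; exact hκν
  have hνν : ⟪ν x, ν x⟫ = 1 := hfr.inner_cross_self_eq_one
  have e1 := congrArg (fun w => ⟪κ x, w⟫) hqm
  have e2 := congrArg (fun w => ⟪ν x, w⟫) hqm
  simp only [hmx, inner_add_right, inner_sub_right, real_inner_smul_right, hfr.unit_right, hκν, hνκ,
    hνν] at e1 e2
  -- a homogeneous linear system for `q` and `φ` with determinant `σ ^ 2 + τ ^ 2`
  have hst : σ ^ 2 + τ ^ 2 ≠ 0 := by
    rcases hdat.ne_zero with h3 | h3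
    · have : σ ≠ 0 := h3
      positivity
    · have : τ ≠ 0 := h3
      positivity
  have hφ0 : φ = 0 := by
    have : φ * (σ ^ 2 + τ ^ 2) = 0 := by linear_combination -τ * e1 - σ * e2
    exact (mul_eq_zero.1 this).resolve_right hst
  have hq0 : q = 0 := by
    have : q * (σ ^ 2 + τ ^ 2) = 0 := by linear_combination σ * e1 - τ * e2
    exact (mul_eq_zero.1 this).resolve_right hst
  rw [hφ0, zero_smul] at hκk
  rw [hφ0, neg_zero, zero_smul] at hνk
  -- the Maurer–Cartan equation
  have hηD : ∀ u v, fderiv ℝ η x u v =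
      fderiv ℝ (α v) x u • κ x + α v x • fderiv ℝ κ x u +
        (fderiv ℝ (θ v) x u • ν x + θ v x • fderiv ℝ ν x u) := by
    intro u v
    have hev : (fun y => η y v) =ᶠ[𝓝 x] fun y => α v y • κ y + θ v y • ν y := by
      filter_upwards [hκ, hUx] with y ⟨hy, _⟩ hyU
      exact hy.expand_tangent ((h.data y hyU).normal v)
    have h1 := (hηd.hasFDerivAt.clm_apply (hasFDerivAt_const v x)).unique
      ((((hαd v).hasFDerivAt.smul hκd.hasFDerivAt).add
        ((hθd v).hasFDerivAt.smul hνd.hasFDerivAt)).congr_of_eventuallyEq hev)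
    have h2 := congrArg (fun L : E2 →L[ℝ] E3 => L u) h1
    simp at h2
    rw [h2]
    abel
  have hMC := h.maurerCartan x hx k n
  rw [hηD, hηD, hαk, hαn, hθk, hθn, hκk, hνk, hk, hn'] at hMC
  have hκn : fderiv ℝ κ x n + br (ν x) (κ x) =
      (fderiv ℝ (α n) x k - fderiv ℝ (α k) x n) • κ x := by
    have hq' : fderiv ℝ (θ n) x k = fderiv ℝ (θ k) x n := by rw [hq] at hq0; linarith
    rw [hq'] at hMC
    rw [br_swap h.br_self (κ x) (ν x), ← hMC]
    module
  have hu : u = ⟪κ x, η x u⟫ • k + ⟪ν x, η x u⟫ • n := by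
    apply hdat.inj
    rw [map_add, map_smul, map_smul, hk, hn]
    exact hfr.expand_tangent (hdat.normal u)
  refine ⟨⟪ν x, η x u⟫ * (fderiv ℝ (α n) x k - fderiv ℝ (α k) x n), ?_⟩
  rw [mul_smul, ← hκn]
  conv_lhs => rw [hu]
  simp only [map_add, map_smul, hκk, hk, hn', LinearMap.add_apply, LinearMap.smul_apply,
    h.br_self, smul_zero, zero_add, smul_add]

end GaussChart

/-- A nowhere vanishing function whose derivative is everywhere a multiple of its value has a
constant direction. -/
theorem exists_eventually_eq_smul {E F : Type*} [NormedAddCommGroup E]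
    [NormedSpace ℝ E] [NormedAddCommGroup F] [InnerProductSpace ℝ F] {y : E → F} {p : E}
    (hd : ∀ᶠ x in 𝓝 p, DifferentiableAt ℝ y x) (hy : ∀ᶠ x in 𝓝 p, y x ≠ 0)
    (hD : ∀ᶠ x in 𝓝 p, ∀ u, ∃ c : ℝ, fderiv ℝ y x u = c • y x) :
    ∃ v : F, v ≠ 0 ∧ ∀ᶠ x in 𝓝 p, ∃ c : ℝ, c ≠ 0 ∧ y x = c • v := by
  set z : E → F := fun x => ‖y x‖⁻¹ • y x with hz
  obtain ⟨ε, hε, hball⟩ := Metric.eventually_nhds_iff_ball.1 (hd.and (hy.and hD))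
  have hz0 : ∀ x ∈ Metric.ball p ε, HasFDerivAt z (0 : E →L[ℝ] F) x := by
    intro x hx
    obtain ⟨h1, h2, h3⟩ := hball x hx
    have hn : ‖y x‖ ≠ 0 := norm_ne_zero_iff.2 h2
    have hN : DifferentiableAt ℝ (fun x => ‖y x‖) x := h1.norm ℝ h2
    have hi := ((hasDerivAt_inv hn).comp_hasFDerivAt x hN.hasFDerivAt).smul h1.hasFDerivAt
    refine (hi.congr_fderiv ?_ : HasFDerivAt z _ x)
    ext1 u
    obtain ⟨c, hc⟩ := h3 u
    have hNu : fderiv ℝ (fun x => ‖y x‖) x u = c * ‖y x‖ := by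
      have e1 := (hN.hasFDerivAt.pow 2)
      have e2 := h1.hasFDerivAt.inner ℝ h1.hasFDerivAt
      have e3 := e1.unique (e2.congr_of_eventuallyEq
        (Eventually.of_forall fun x => (real_inner_self_eq_norm_sq (y x)).symm))
      have e4 := congrArg (fun L : E →L[ℝ] ℝ => L u) e3
      simp [hc, real_inner_smul_left, real_inner_smul_right] at e4
      have : ‖y x‖ * (fderiv ℝ (fun x => ‖y x‖) x u - c * ‖y x‖) = 0 := by
        linear_combination e4 / 2
      have := (mul_eq_zero.1 this).resolve_left hn
      linarith
    change ‖y x‖⁻¹ • fderiv ℝ y x u +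
      ((-(‖y x‖ ^ 2)⁻¹) • fderiv ℝ (fun x => ‖y x‖) x u) • y x = (0 : F)
    rw [hc, hNu, smul_smul, ← add_smul, smul_eq_mul, smul_eq_zero]
    left
    field_simp
    ring
  have hconst : ∀ x ∈ Metric.ball p ε, z x = z p := by
    intro x hx
    exact (convex_ball p ε).is_const_of_fderivWithin_eq_zero (𝕜 := ℝ)
      (fun w hw => (hz0 w hw).differentiableAt.differentiableWithinAt)
      (fun w hw => by
        rw [fderivWithin_of_isOpen Metric.isOpen_ball hw]
        exact (hz0 w hw).fderiv) hx (Metric.mem_ball_self hε)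
  have hn : ∀ x ∈ Metric.ball p ε, ‖y x‖ ≠ 0 := fun x hx => norm_ne_zero_iff.2 (hball x hx).2.1
  refine ⟨z p, ?_, ?_⟩
  · rw [hz]
    have := hn p (Metric.mem_ball_self hε)
    exact smul_ne_zero (inv_ne_zero this) (norm_ne_zero_iff.1 this)
  · filter_upwards [Metric.ball_mem_nhds p hε] with x hx
    refine ⟨‖y x‖, hn x hx, ?_⟩
    rw [← hconst x hx, hz, smul_smul, mul_inv_cancel₀ (hn x hx), one_smul]

/-- A family of linear isomorphisms `A` with `d(A v) = -[η, A v]` carries a constant vector to the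
kernel direction of the differential of the Gauss map. -/
theorem GaussChart.exists_parallel_kernel {br : E3 →ₗ[ℝ] E3 →ₗ[ℝ] E3} {H : ℝ} {U : Set E2}
    {G : E2 → E3} {η : E2 → E2 →L[ℝ] E3} (h : GaussChart br H U G η) {A : E2 → E3 →L[ℝ] E3}
    (hA : ∀ x ∈ U, ContDiffAt ℝ ∞ A x) (hAinj : ∀ x ∈ U, Function.Injective (A x))
    (hAD : ∀ x ∈ U, ∀ u v, fderiv ℝ A x u v = -br (η x u) (A x v))
    (hker : ∀ x ∈ U, ∃ k, k ≠ 0 ∧ fderiv ℝ G x k = 0) {p : E2} (hp : p ∈ U) :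
    ∃ v : E3, v ≠ 0 ∧ ∀ᶠ x in 𝓝 p, ∃ k, fderiv ℝ G x k = 0 ∧ η x k = A x v := by
  obtain ⟨κ, hκs, hκ⟩ := h.exists_kernel_field hker hp
  have hUp := h.isOpen.mem_nhds hp
  have hbij : ∀ x ∈ U, ∃ L : E3 ≃L[ℝ] E3, (L : E3 →L[ℝ] E3) = A x := fun x hx =>
    ⟨(LinearEquiv.ofInjectiveEndo (A x).toLinearMap (hAinj x hx)).toContinuousLinearEquiv,
      by ext1 v; rfl⟩
  -- `κ` pulled back by `A` has derivative proportional to itself, hence a constant direction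
  set y : E2 → E3 := fun x => (A x).inverse (κ x) with hy
  have hAy : ∀ x ∈ U, A x (y x) = κ x := by
    intro x hx
    obtain ⟨L, hL⟩ := hbij x hx
    rw [hy]
    simp only
    rw [← hL, ContinuousLinearMap.inverse_equiv]
    exact L.apply_symm_apply _
  have hys : ContDiffAt ℝ ∞ y p := by
    obtain ⟨L, hL⟩ := hbij p hp
    have := contDiffAt_map_inverse (𝕜 := ℝ) (n := ∞) L
    rw [hL] at this
    exact (this.comp p (hA p hp)).clm_apply hκs
  obtain ⟨v, hv0, hv⟩ := exists_eventually_eq_smul (y := y) (p := p)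
    hys.eventually_differentiableAt
    (by
      filter_upwards [hκ, hUp] with x hx hxU h0
      have h1 := hAy x hxU
      rw [h0, map_zero] at h1
      have h2 := hx.1.unit_right
      rw [← h1, inner_zero_left] at h2
      norm_num at h2)
    (by
      filter_upwards [hκ.eventually_nhds, hUp, hys.eventually_differentiableAt,
        hκs.eventually_differentiableAt] with x hx hxU hxy hxκ u
      obtain ⟨c, hc⟩ := h.fderiv_kernel_field hxU hxκ hx u
      refine ⟨c, hAinj x hxU ?_⟩
      have hAd : DifferentiableAt ℝ A x := (hA x hxU).differentiableAt (by simp)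
      have hev : (fun z => A z (y z)) =ᶠ[𝓝 x] κ := by
        filter_upwards [h.isOpen.mem_nhds hxU] with z hz using hAy z hz
      have h1 := (hAd.hasFDerivAt.clm_apply hxy.hasFDerivAt).unique
        (hxκ.hasFDerivAt.congr_of_eventuallyEq hev)
      have h2 := congrArg (fun L : E2 →L[ℝ] E3 => L u) h1
      simp only [add_apply, ContinuousLinearMap.comp_apply, ContinuousLinearMap.flip_apply,
        hAD x hxU, hAy x hxU] at h2
      rw [map_smul, hAy x hxU, ← hc, ← h2]
      abel)
  refine ⟨v, hv0, ?_⟩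
  filter_upwards [hκ, hUp, hv] with x hx hxU ⟨c, hc0, hc⟩
  obtain ⟨k, hk, hDk⟩ := hx.2
  refine ⟨c⁻¹ • k, by rw [map_smul, hDk, smul_zero], ?_⟩
  rw [map_smul, hk, ← hAy x hxU, hc, map_smul, smul_smul, inv_mul_cancel₀ hc0, one_smul]

/-- If a field `f` with `df = -[η, f]` is tangent to the surface, then the Gauss map is constant in
its direction: the derivative of `⟪G, f⟫ = 0` gives `⟪dG u, f⟫ = ⟪G, [η u, f]⟫`, which is the whole
of the skew part of `⟪dG u, η k⟫` when `η k = f`. -/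
theorem GaussChart.fderiv_eq_zero_of_tangent {br : E3 →ₗ[ℝ] E3 →ₗ[ℝ] E3} {H : ℝ} {U : Set E2}
    {G : E2 → E3} {η : E2 → E2 →L[ℝ] E3} (h : GaussChart br H U G η) {f : E2 → E3} {x : E2}
    (hx : x ∈ U) (hf : DifferentiableAt ℝ f x) (hD : ∀ u, fderiv ℝ f x u = -br (η x u) (f x))
    (hT : ∀ᶠ y in 𝓝 x, ⟪G y, f y⟫ = 0) {k : E2} (hk : η x k = f x) : fderiv ℝ G x k = 0 := by
  have hdat := h.data x hx
  have hGd : DifferentiableAt ℝ G x := (h.smooth_G x hx).differentiableAt (by simp)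
  have key : ∀ u, ⟪fderiv ℝ G x k, η x u⟫ = 0 := by
    intro u
    have h1 := fderiv_inner_eq hGd hf hT u
    have h2 := hdat.skew u k
    rw [hD, inner_neg_right] at h1
    rw [hk] at h2
    linarith
  obtain ⟨u, hu⟩ := hdat.exists_preimage (hdat.tangent k)
  have := key u
  rw [hu] at this
  exact inner_self_eq_zero.1 this

/-! ### Coordinates in an orthonormal frame of the Lie algebra, and the potential -/

section Coordinates

set_option linter.unusedSectionVars false

variable {X : Type*} [TopologicalSpace X] [ChartedSpace E3 X] [Group X] [LieGroup (𝓡 3) ∞ X]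

namespace LeftInvariantMetric

variable (g : LeftInvariantMetric X)

/-- The inner product of the Lie algebra, as a bilinear form on the model space. -/
def lieForm : E3 →ₗ[ℝ] E3 →ₗ[ℝ] ℝ :=
  LinearMap.mk₂ ℝ (fun v w : E3 => g.lieInner v w)
    (fun v v' w => congrArg (fun L : E3 →L[ℝ] ℝ => L w) (map_add (g.inner 1) v v'))
    (fun c v w => congrArg (fun L : E3 →L[ℝ] ℝ => L w) (map_smul (g.inner 1) c v))
    (fun v w w' => map_add (g.inner 1 v) w w')
    (fun c v w => map_smul (g.inner 1 v) c w)

theorem lieForm_comm (v w : E3) : g.lieForm v w = g.lieForm w v := g.symm 1 v w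

/-- A frame of the Lie algebra, as a family of vectors of the model space. -/
def frameVec (e : Fin 3 → GroupLieAlgebra (𝓡 3) X) (i : Fin 3) : E3 := e i

/-- The coordinates of a vector of the Lie algebra in the frame `e`. -/
def coord (e : Fin 3 → GroupLieAlgebra (𝓡 3) X) : E3 →ₗ[ℝ] E3 where
  toFun v := !₂[g.lieForm v (frameVec e 0), g.lieForm v (frameVec e 1), g.lieForm v (frameVec e 2)]
  map_add' v w := by
    apply E3_ext <;> simp
  map_smul' c v := by
    apply E3_ext <;> simp

variable {g} {e : Fin 3 → GroupLieAlgebra (𝓡 3) X}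

theorem coord_zero (v : E3) : g.coord e v 0 = g.lieForm v (frameVec e 0) := rfl
theorem coord_one (v : E3) : g.coord e v 1 = g.lieForm v (frameVec e 1) := rfl
theorem coord_two (v : E3) : g.coord e v 2 = g.lieForm v (frameVec e 2) := rfl

theorem lieForm_frameVec (he : g.OrthonormalFrame e) (i j : Fin 3) :
    g.lieForm (frameVec e i) (frameVec e j) = if i = j then 1 else 0 := he i j

theorem coord_frameVec (he : g.OrthonormalFrame e) (i : Fin 3) :
    g.coord e (frameVec e i) = stdE i := by
  apply E3_ext
  · rw [coord_zero, lieForm_frameVec he]; fin_cases i <;> simp [stdE]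
  · rw [coord_one, lieForm_frameVec he]; fin_cases i <;> simp [stdE]
  · rw [coord_two, lieForm_frameVec he]; fin_cases i <;> simp [stdE]

theorem coord_surjective (he : g.OrthonormalFrame e) : Function.Surjective (g.coord e) := by
  intro x
  refine ⟨x 0 • frameVec e 0 + x 1 • frameVec e 1 + x 2 • frameVec e 2, ?_⟩
  rw [map_add, map_add, map_smul, map_smul, map_smul, coord_frameVec he, coord_frameVec he,
    coord_frameVec he]
  exact (stdE_sum x).symm

theorem coord_injective (he : g.OrthonormalFrame e) : Function.Injective (g.coord e) :=
  LinearMap.injective_iff_surjective.2 (coord_surjective he)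

/-- The coordinates in an orthonormal frame of the Lie algebra, as a continuous linear
isomorphism. -/
def coordEquiv (he : g.OrthonormalFrame e) : E3 ≃L[ℝ] E3 :=
  (LinearEquiv.ofBijective (g.coord e)
    ⟨coord_injective he, coord_surjective he⟩).toContinuousLinearEquiv

theorem inner_coord (he : g.OrthonormalFrame e) (v w : E3) :
    ⟪g.coord e v, g.coord e w⟫ = g.lieForm v w := by
  have hv : v = g.coord e v 0 • frameVec e 0 + g.coord e v 1 • frameVec e 1
      + g.coord e v 2 • frameVec e 2 := by
    apply coord_injective he
    rw [map_add, map_add, map_smul, map_smul, map_smul, coord_frameVec he, coord_frameVec he,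
      coord_frameVec he]
    exact stdE_sum _
  conv_rhs => rw [hv]
  simp only [map_add, map_smul, LinearMap.add_apply, LinearMap.smul_apply, smul_eq_mul]
  rw [inner_E3, coord_zero w, coord_one w, coord_two w, g.lieForm_comm w, g.lieForm_comm w,
    g.lieForm_comm w]

/-- The bracket of the Lie algebra, in the coordinates of an orthonormal frame. -/
def coordBr (he : g.OrthonormalFrame e) : E3 →ₗ[ℝ] E3 →ₗ[ℝ] E3 :=
  ((lieBrₗ X).compl₁₂ (coordEquiv he).symm.toLinearMap (coordEquiv he).symm.toLinearMap).compr₂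
    (g.coord e)

theorem coordBr_coord (he : g.OrthonormalFrame e) (v w : E3) :
    coordBr he (g.coord e v) (g.coord e w) = g.coord e (lieBr X v w) := by
  have h : ∀ v, (coordEquiv he).symm (g.coord e v) = v := fun v =>
    (coordEquiv he).symm_apply_apply v
  change g.coord e (lieBr X ((coordEquiv he).symm (g.coord e v))
    ((coordEquiv he).symm (g.coord e w))) = _
  rw [h, h]

theorem coordBr_self (he : g.OrthonormalFrame e) (x : E3) : coordBr he x x = 0 := by
  obtain ⟨v, rfl⟩ := coord_surjective he x
  rw [coordBr_coord, ← lieBrₗ_apply, lieBrₗ_self, map_zero]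

theorem coordBr_stdE (he : g.OrthonormalFrame e) (i j : Fin 3) :
    coordBr he (stdE i) (stdE j) = g.coord e (lieBr X (frameVec e i) (frameVec e j)) := by
  rw [← coord_frameVec he, ← coord_frameVec he, coordBr_coord]

theorem coordBr_stdE_of_bracket (he : g.OrthonormalFrame e) {i j k l : Fin 3} {a b : ℝ}
    (h : ⁅e i, e j⁆ = a • e k + b • e l) :
    coordBr he (stdE i) (stdE j) = a • stdE k + b • stdE l := by
  have h' : lieBr X (frameVec e i) (frameVec e j) = a • frameVec e k + b • frameVec e l := h
  rw [coordBr_stdE, h', map_add, map_smul, map_smul, coord_frameVec he, coord_frameVec he]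

theorem crossBr_unimodular {c : Fin 3 → ℝ} (h : g.IsUnimodularBasis e c) (x : E3) :
    crossBr (coordBr h.orthonormal) x =
      (x 0 * c 0) • stdE 0 + (x 1 * c 1) • stdE 1 + (x 2 * c 2) • stdE 2 := by
  have h0 := coordBr_stdE_of_bracket h.orthonormal (a := c 0) (b := 0) (k := 0) (l := 0)
    (by rw [h.bracket_12, zero_smul, add_zero])
  have h1 := coordBr_stdE_of_bracket h.orthonormal (a := c 1) (b := 0) (k := 1) (l := 1)
    (by rw [h.bracket_20, zero_smul, add_zero])
  have h2 := coordBr_stdE_of_bracket h.orthonormal (a := c 2) (b := 0) (k := 2) (l := 2)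
    (by rw [h.bracket_01, zero_smul, add_zero])
  rw [crossBr, h0, h1, h2]
  module

theorem crossBr_nonUnimodular {a b : ℝ} (h : g.IsNonUnimodularBasis e a b) (x : E3) :
    crossBr (coordBr h.orthonormal) x =
      (x 0 * ((1 - a) * b) + x 1 * (1 + a)) • stdE 0 +
        (-(x 0 * (1 - a)) + x 1 * ((1 + a) * b)) • stdE 1 := by
  have h0 := coordBr_stdE_of_bracket h.orthonormal h.bracket_21
  have h1 := coordBr_stdE_of_bracket h.orthonormal h.bracket_20
  have h2 := coordBr_stdE_of_bracket h.orthonormal (a := 0) (b := 0) (k := 0) (l := 0)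
    (by rw [h.bracket_01, zero_smul, add_zero])
  rw [crossBr, br_swap (coordBr_self h.orthonormal) (stdE 2) (stdE 1), h0, h1, h2]
  module

end LeftInvariantMetric

theorem isFrame_stdE : IsFrame (stdE 2) (stdE 0) :=
  ⟨by simp [stdE], by simp [stdE], by simp [inner_E3, stdE]⟩

theorem cross_stdE : cross (stdE 2) (stdE 0) = stdE 1 := by
  apply E3_ext <;> simp [cross_apply_zero, cross_apply_one, cross_apply_two, stdE]

theorem inner_stdE (x : E3) (i : Fin 3) : ⟪x, stdE i⟫ = x i := by
  fin_cases i <;> simp [inner_E3, stdE]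

theorem trace_br (br : E3 →ₗ[ℝ] E3 →ₗ[ℝ] E3) (x : E3) :
    LinearMap.trace ℝ E3 (br x) = br x (stdE 0) 0 + br x (stdE 1) 1 + br x (stdE 2) 2 := by
  rw [isFrame_stdE.trace_eq, cross_stdE, inner_stdE, inner_stdE, inner_stdE]

/-- Stereographic projection of the unit sphere of Euclidean three-space from `(0, 0, -1)`. -/
def stereo (x : E3) : OnePoint ℂ :=
  open Classical in
  if x 2 = -1 then OnePoint.infty
  else ((((x 0 : ℂ) + Complex.I * (x 1 : ℂ)) / (1 + (x 2 : ℂ)) : ℂ) : OnePoint ℂ)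

/-- A potential has a zero at infinity once its terms of degree four cancel, since no terms of odd
degree occur. -/
theorem tendsto_div_norm_pow_four {R : ℂ → ℂ} (C : ℝ) (hR : ∀ z, ‖R z‖ ≤ C * (1 + ‖z‖ ^ 2)) :
    Tendsto (fun z : ℂ => R z / (‖z‖ : ℂ) ^ 4) (cocompact ℂ) (𝓝 0) := by
  have h1 : Tendsto (fun z : ℂ => ‖z‖⁻¹) (cocompact ℂ) (𝓝 0) :=
    tendsto_inv_atTop_zero.comp (tendsto_norm_cocompact_atTop)
  have h2 : Tendsto (fun z : ℂ => C * (‖z‖⁻¹ ^ 4 + ‖z‖⁻¹ ^ 2)) (cocompact ℂ) (𝓝 0) := by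
    have := ((h1.pow 4).add (h1.pow 2)).const_mul C
    simpa using this
  refine squeeze_zero_norm' ?_ h2
  filter_upwards [(tendsto_norm_cocompact_atTop (E := ℂ)).eventually_gt_atTop 0] with z hz
  rw [norm_div, norm_pow, Complex.norm_real, norm_norm, div_le_iff₀ (by positivity)]
  refine (hR z).trans (le_of_eq ?_)
  field_simp

theorem normSq_coords (z : ℂ) : ((‖z‖ : ℝ) : ℂ) ^ 2 = ((z.re ^ 2 + z.im ^ 2 : ℝ) : ℂ) := by
  rw [← Complex.ofReal_pow, ← Complex.normSq_eq_norm_sq, Complex.normSq_apply]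
  push_cast; ring

theorem trace_eq_crossBr {br : E3 →ₗ[ℝ] E3 →ₗ[ℝ] E3} (hbr : ∀ x, br x x = 0) (x : E3) :
    LinearMap.trace ℝ E3 (br x) =
      crossBr br (cross x (stdE 0)) 0 + crossBr br (cross x (stdE 1)) 1 +
        crossBr br (cross x (stdE 2)) 2 := by
  rw [trace_br, crossBr_cross hbr, crossBr_cross hbr, crossBr_cross hbr]

theorem tracePart_unimodular {g : LeftInvariantMetric X} {e : Fin 3 → GroupLieAlgebra (𝓡 3) X}
    {c : Fin 3 → ℝ} (h : g.IsUnimodularBasis e c) (H : ℝ) (x : E3) :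
    tracePart (LeftInvariantMetric.coordBr h.orthonormal) H x = -2 * H := by
  rw [tracePart, trace_eq_crossBr (LeftInvariantMetric.coordBr_self _),
    LeftInvariantMetric.crossBr_unimodular h, LeftInvariantMetric.crossBr_unimodular h,
    LeftInvariantMetric.crossBr_unimodular h]
  simp [stdE, cross_apply_zero, cross_apply_one, cross_apply_two]

theorem skewPart_unimodular {g : LeftInvariantMetric X} {e : Fin 3 → GroupLieAlgebra (𝓡 3) X}
    {c : Fin 3 → ℝ} (h : g.IsUnimodularBasis e c) (x : E3) :
    skewPart (LeftInvariantMetric.coordBr h.orthonormal) x =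
      c 0 * x 0 ^ 2 + c 1 * x 1 ^ 2 + c 2 * x 2 ^ 2 := by
  rw [skewPart, LeftInvariantMetric.crossBr_unimodular h]
  simp [inner_E3, stdE]; ring

theorem tracePart_nonUnimodular {g : LeftInvariantMetric X}
    {e : Fin 3 → GroupLieAlgebra (𝓡 3) X} {a b : ℝ} (h : g.IsNonUnimodularBasis e a b) (H : ℝ)
    (x : E3) :
    tracePart (LeftInvariantMetric.coordBr h.orthonormal) H x = -2 * H + 2 * x 2 := by
  rw [tracePart, trace_eq_crossBr (LeftInvariantMetric.coordBr_self _),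
    LeftInvariantMetric.crossBr_nonUnimodular h, LeftInvariantMetric.crossBr_nonUnimodular h,
    LeftInvariantMetric.crossBr_nonUnimodular h]
  simp [stdE, cross_apply_zero, cross_apply_one]; ring

theorem skewPart_nonUnimodular {g : LeftInvariantMetric X}
    {e : Fin 3 → GroupLieAlgebra (𝓡 3) X} {a b : ℝ} (h : g.IsNonUnimodularBasis e a b) (x : E3) :
    skewPart (LeftInvariantMetric.coordBr h.orthonormal) x =
      2 * a * (x 0 * x 1) + b * (x 0 ^ 2 + x 1 ^ 2) - a * b * (x 0 ^ 2 - x 1 ^ 2) := by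
  rw [skewPart, LeftInvariantMetric.crossBr_nonUnimodular h]
  simp [inner_E3, stdE]; ring

/-- The potential of a unimodular group, in terms of the trace and the skew part of the differential
of the Gauss map. -/
theorem unimodularPotential_eq {g : LeftInvariantMetric X} {e : Fin 3 → GroupLieAlgebra (𝓡 3) X}
    {c : Fin 3 → ℝ} (h : g.IsUnimodularBasis e c) (H : ℝ) {x : E3} (hx : ⟪x, x⟫ = 1)
    (hx2 : x 2 ≠ -1) :
    unimodularPotential c H (((x 0 : ℂ) + Complex.I * (x 1 : ℂ)) / (1 + (x 2 : ℂ))) =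
      -((2 / (1 + x 2) ^ 2 : ℝ) : ℂ) * (tracePart (LeftInvariantMetric.coordBr h.orthonormal) H x +
        Complex.I * skewPart (LeftInvariantMetric.coordBr h.orthonormal) x) := by
  have ht := tracePart_unimodular h H x
  have hs := skewPart_unimodular h x
  have hd : 1 + x 2 ≠ 0 := fun h => hx2 (by linarith)
  set u := x 0 / (1 + x 2)
  set v := x 1 / (1 + x 2)
  have hz : ((x 0 : ℂ) + Complex.I * (x 1 : ℂ)) / (1 + (x 2 : ℂ)) = (u : ℂ) + Complex.I * v := by
    simp only [u, v]; push_cast; ring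
  have hn : ∀ a b : ℝ, ((‖(a : ℂ) + Complex.I * b‖ : ℝ) : ℂ) ^ 2 = ((a ^ 2 + b ^ 2 : ℝ) : ℂ) := by
    intro a b; rw [normSq_coords]; simp
  have h1 : (1 : ℂ) + ((u : ℂ) + Complex.I * v) ^ 2 =
      ((1 + u ^ 2 - v ^ 2 : ℝ) : ℂ) + Complex.I * ((2 * u * v : ℝ) : ℂ) := by
    push_cast; linear_combination (v : ℂ) ^ 2 * Complex.I_sq
  have h2 : (1 : ℂ) - ((u : ℂ) + Complex.I * v) ^ 2 =
      ((1 - u ^ 2 + v ^ 2 : ℝ) : ℂ) + Complex.I * ((-(2 * u * v) : ℝ) : ℂ) := by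
    push_cast; linear_combination -(v : ℂ) ^ 2 * Complex.I_sq
  rw [hz, unimodularPotential, ht, hs]
  simp only
  rw [h1, h2, hn, hn, hn]
  rw [inner_E3] at hx
  have hu : u * (1 + x 2) = x 0 := div_mul_cancel₀ _ hd
  have hv : v * (1 + x 2) = x 1 := div_mul_cancel₀ _ hd
  -- the real and imaginary parts `u`, `v` of the stereographic coordinate of a unit vector
  have huv : (1 + u ^ 2 + v ^ 2) * (1 + x 2) = 2 := by
    apply mul_right_cancel₀ hd
    rw [← hu, ← hv] at hx
    linear_combination hx
  have hs2 : (2 / (1 + x 2) ^ 2 : ℝ) = (1 + u ^ 2 + v ^ 2) ^ 2 / 2 := by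
    rw [div_eq_iff (pow_ne_zero 2 hd)]
    linear_combination -((1 + u ^ 2 + v ^ 2) * (1 + x 2) + 2) / 2 * huv
  have k0 : (1 + u ^ 2 + v ^ 2) ^ 2 / 2 * x 0 ^ 2 = 2 * u ^ 2 := by
    rw [← hu]
    linear_combination u ^ 2 * ((1 + u ^ 2 + v ^ 2) * (1 + x 2) + 2) / 2 * huv
  have k1 : (1 + u ^ 2 + v ^ 2) ^ 2 / 2 * x 1 ^ 2 = 2 * v ^ 2 := by
    rw [← hv]
    linear_combination v ^ 2 * ((1 + u ^ 2 + v ^ 2) * (1 + x 2) + 2) / 2 * huv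
  have k2 : (1 + u ^ 2 + v ^ 2) ^ 2 / 2 * x 2 ^ 2 = (1 - u ^ 2 - v ^ 2) ^ 2 / 2 := by
    have : (1 + u ^ 2 + v ^ 2) * x 2 = 1 - u ^ 2 - v ^ 2 := by linear_combination huv
    rw [← this]; ring
  have hsum : (1 + u ^ 2 + v ^ 2) ^ 2 / 2 * (c 0 * x 0 ^ 2 + c 1 * x 1 ^ 2 + c 2 * x 2 ^ 2) =
      c 0 * (2 * u ^ 2) + c 1 * (2 * v ^ 2) + c 2 * ((1 - u ^ 2 - v ^ 2) ^ 2 / 2) := by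
    rw [← k0, ← k1, ← k2]; ring
  have hsum' := congrArg (fun r : ℝ => (r : ℂ)) hsum
  rw [hs2]
  push_cast at hsum' ⊢
  linear_combination Complex.I * hsum'

/-- The potential of a non-unimodular group, in terms of the trace and the skew part of the
differential of the Gauss map. -/
theorem nonUnimodularPotential_eq {g : LeftInvariantMetric X}
    {e : Fin 3 → GroupLieAlgebra (𝓡 3) X} {a b : ℝ} (h : g.IsNonUnimodularBasis e a b) (H : ℝ)
    {x : E3} (hx : ⟪x, x⟫ = 1) (hx2 : x 2 ≠ -1) :
    nonUnimodularPotential a b H (((x 0 : ℂ) + Complex.I * (x 1 : ℂ)) / (1 + (x 2 : ℂ))) =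
      -((2 / (1 + x 2) ^ 2 : ℝ) : ℂ) * (tracePart (LeftInvariantMetric.coordBr h.orthonormal) H x +
        Complex.I * skewPart (LeftInvariantMetric.coordBr h.orthonormal) x) := by
  have ht := tracePart_nonUnimodular h H x
  have hs := skewPart_nonUnimodular h x
  have hd : 1 + x 2 ≠ 0 := fun h => hx2 (by linarith)
  set u := x 0 / (1 + x 2)
  set v := x 1 / (1 + x 2)
  have hz : ((x 0 : ℂ) + Complex.I * (x 1 : ℂ)) / (1 + (x 2 : ℂ)) = (u : ℂ) + Complex.I * v := by
    simp only [u, v]; push_cast; ring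
  have hn : ((‖(u : ℂ) + Complex.I * v‖ : ℝ) : ℂ) ^ 2 = ((u ^ 2 + v ^ 2 : ℝ) : ℂ) := by
    rw [normSq_coords]; simp
  have hn4 : ((‖(u : ℂ) + Complex.I * v‖ : ℝ) : ℂ) ^ 4 = ((u ^ 2 + v ^ 2 : ℝ) : ℂ) ^ 2 := by
    rw [← hn]; ring
  have hconj : (starRingEnd ℂ) ((u : ℂ) + Complex.I * v) = (u : ℂ) - Complex.I * v := by
    simp [sub_eq_add_neg]
  rw [hz, nonUnimodularPotential, ht, hs, hn, hn4, hconj]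
  rw [inner_E3] at hx
  have hu : u * (1 + x 2) = x 0 := div_mul_cancel₀ _ hd
  have hv : v * (1 + x 2) = x 1 := div_mul_cancel₀ _ hd
  -- the real and imaginary parts `u`, `v` of the stereographic coordinate of a unit vector
  have huv : (1 + u ^ 2 + v ^ 2) * (1 + x 2) = 2 := by
    apply mul_right_cancel₀ hd
    rw [← hu, ← hv] at hx
    linear_combination hx
  have hs2 : (2 / (1 + x 2) ^ 2 : ℝ) = (1 + u ^ 2 + v ^ 2) ^ 2 / 2 := by
    rw [div_eq_iff (pow_ne_zero 2 hd)]
    linear_combination -((1 + u ^ 2 + v ^ 2) * (1 + x 2) + 2) / 2 * huv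
  have k0 : (1 + u ^ 2 + v ^ 2) ^ 2 / 2 * x 0 ^ 2 = 2 * u ^ 2 := by
    rw [← hu]
    linear_combination u ^ 2 * ((1 + u ^ 2 + v ^ 2) * (1 + x 2) + 2) / 2 * huv
  have k1 : (1 + u ^ 2 + v ^ 2) ^ 2 / 2 * x 1 ^ 2 = 2 * v ^ 2 := by
    rw [← hv]
    linear_combination v ^ 2 * ((1 + u ^ 2 + v ^ 2) * (1 + x 2) + 2) / 2 * huv
  have k01 : (1 + u ^ 2 + v ^ 2) ^ 2 / 2 * (x 0 * x 1) = 2 * u * v := by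
    rw [← hu, ← hv]
    linear_combination u * v * ((1 + u ^ 2 + v ^ 2) * (1 + x 2) + 2) / 2 * huv
  have k2 : (1 + u ^ 2 + v ^ 2) * x 2 = 1 - u ^ 2 - v ^ 2 := by linear_combination huv
  have hsum : (1 + u ^ 2 + v ^ 2) ^ 2 / 2 * (2 * a * (x 0 * x 1) + b * (x 0 ^ 2 + x 1 ^ 2) -
        a * b * (x 0 ^ 2 - x 1 ^ 2)) =
      2 * a * (2 * u * v) + b * (2 * u ^ 2 + 2 * v ^ 2) - a * b * (2 * u ^ 2 - 2 * v ^ 2) := by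
    rw [← k0, ← k1, ← k01]; ring
  have hsum' := congrArg (fun r : ℝ => (r : ℂ)) hsum
  have hk2' := congrArg (fun r : ℝ => (r : ℂ)) k2
  rw [hs2]
  push_cast at hsum' hk2' ⊢
  linear_combination Complex.I * hsum' + (1 + (u : ℂ) ^ 2 + v ^ 2) * hk2' +
    2 * Complex.I * a * b * v ^ 2 * Complex.I_sq

/-- If the trace and the skew part of the differential of the Gauss map vanish at a unit vector,
then the potential vanishes at its stereographic projection. -/
theorem potentialZeroAt_stereo {g : LeftInvariantMetric X} {e : Fin 3 → GroupLieAlgebra (𝓡 3) X}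
    {H : ℝ} {R : ℂ → ℂ} (hR : g.IsHPotential e H R) (he : g.OrthonormalFrame e) {x : E3}
    (hx : ⟪x, x⟫ = 1) (hs : skewPart (LeftInvariantMetric.coordBr he) x = 0)
    (ht : tracePart (LeftInvariantMetric.coordBr he) H x = 0) : PotentialZeroAt R (stereo x) := by
  by_cases hx2 : x 2 = -1
  · have hx01 : x 0 = 0 ∧ x 1 = 0 := by
      rw [inner_E3, hx2] at hx
      constructor <;> nlinarith [sq_nonneg (x 0), sq_nonneg (x 1)]
    rw [stereo, if_pos hx2]
    rcases hR with ⟨c, h, rfl⟩ | ⟨a, b, h, rfl⟩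
    · rw [tracePart_unimodular h] at ht
      rw [skewPart_unimodular h, hx2, hx01.1, hx01.2] at hs
      have hH : H = 0 := by linarith
      have hc : c 2 = 0 := by linarith
      refine tendsto_div_norm_pow_four (4 * (|c 0| + |c 1|)) fun z => ?_
      have hw : ((‖1 + z ^ 2‖ : ℝ) : ℂ) ^ 2 - ((‖1 - z ^ 2‖ : ℝ) : ℂ) ^ 2 =
          ((4 * (z ^ 2).re : ℝ) : ℂ) := by
        rw [normSq_coords, normSq_coords, Complex.add_re, Complex.add_im, Complex.sub_re,
          Complex.sub_im, Complex.one_re, Complex.one_im]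
        push_cast; ring
      have hRz : unimodularPotential c H z = -(Complex.I / 2) *
          ((2 * ((c 0 - c 1) * (z ^ 2).re + (c 0 + c 1) * ‖z‖ ^ 2) : ℝ) : ℂ) := by
        simp only [unimodularPotential, hH, hc]
        push_cast at hw ⊢
        linear_combination -(Complex.I / 2) * ((c 0 - c 1) / 2) * hw
      rw [hRz, norm_mul, norm_neg, norm_div, Complex.norm_I, Complex.norm_ofNat, Complex.norm_real,
        Real.norm_eq_abs]
      have h1 : |(z ^ 2).re| ≤ ‖z‖ ^ 2 := (Complex.abs_re_le_norm _).trans (norm_pow z 2).le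
      have h2 : |(c 0 - c 1) * (z ^ 2).re| ≤ (|c 0| + |c 1|) * ‖z‖ ^ 2 := by
        rw [abs_mul]
        exact mul_le_mul (abs_sub _ _) h1 (abs_nonneg _) (by positivity)
      have h3 : |(c 0 + c 1) * ‖z‖ ^ 2| ≤ (|c 0| + |c 1|) * ‖z‖ ^ 2 := by
        rw [abs_mul, abs_of_nonneg (sq_nonneg ‖z‖)]
        exact mul_le_mul_of_nonneg_right (abs_add_le _ _) (sq_nonneg _)
      have h4 := abs_add_le ((c 0 - c 1) * (z ^ 2).re) ((c 0 + c 1) * ‖z‖ ^ 2)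
      rw [abs_mul, abs_two]
      have h5 : 0 ≤ |c 0| + |c 1| := by positivity
      have h6 : 0 ≤ (|c 0| + |c 1|) * ‖z‖ ^ 2 := by positivity
      linarith
    · rw [tracePart_nonUnimodular h, hx2] at ht
      have hH : H = -1 := by linarith
      refine tendsto_div_norm_pow_four (2 + 2 * |a| + |b| * (2 + 2 * |a|)) fun z => ?_
      have hRz : nonUnimodularPotential a b H z = -(2 * (1 + (‖z‖ : ℂ) ^ 2)) -
          a * (z ^ 2 - (starRingEnd ℂ z) ^ 2) -
          Complex.I * b * (2 * (‖z‖ : ℂ) ^ 2 - a * (z ^ 2 + (starRingEnd ℂ z) ^ 2)) := by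
        rw [nonUnimodularPotential, hH]; push_cast; ring
      have hz2 : ‖z ^ 2‖ = ‖z‖ ^ 2 := norm_pow z 2
      have hz3 : ‖(starRingEnd ℂ z) ^ 2‖ = ‖z‖ ^ 2 := by rw [norm_pow, RCLike.norm_conj]
      have n1 : ‖-(2 * (1 + (‖z‖ : ℂ) ^ 2))‖ = 2 * (1 + ‖z‖ ^ 2) := by
        have : -(2 * (1 + (‖z‖ : ℂ) ^ 2)) = -((2 * (1 + ‖z‖ ^ 2) : ℝ) : ℂ) := by push_cast; ring
        rw [this, norm_neg, Complex.norm_real, Real.norm_of_nonneg (by positivity)]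
      have n2 : ‖(a : ℂ) * (z ^ 2 - (starRingEnd ℂ z) ^ 2)‖ ≤ |a| * (2 * ‖z‖ ^ 2) := by
        rw [norm_mul, Complex.norm_real, Real.norm_eq_abs]
        refine mul_le_mul_of_nonneg_left ((norm_sub_le _ _).trans ?_) (abs_nonneg a)
        rw [hz2, hz3]; linarith
      have n3 : ‖(a : ℂ) * (z ^ 2 + (starRingEnd ℂ z) ^ 2)‖ ≤ |a| * (2 * ‖z‖ ^ 2) := by
        rw [norm_mul, Complex.norm_real, Real.norm_eq_abs]
        refine mul_le_mul_of_nonneg_left ((norm_add_le _ _).trans ?_) (abs_nonneg a)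
        rw [hz2, hz3]; linarith
      have n4 : ‖2 * (‖z‖ : ℂ) ^ 2‖ = 2 * ‖z‖ ^ 2 := by
        rw [norm_mul, norm_pow, Complex.norm_real, norm_norm, Complex.norm_ofNat]
      have n5 : ‖Complex.I * b * (2 * (‖z‖ : ℂ) ^ 2 - a * (z ^ 2 + (starRingEnd ℂ z) ^ 2))‖ ≤
          |b| * (2 * ‖z‖ ^ 2 + |a| * (2 * ‖z‖ ^ 2)) := by
        rw [norm_mul, norm_mul, Complex.norm_I, one_mul, Complex.norm_real, Real.norm_eq_abs]
        refine mul_le_mul_of_nonneg_left ((norm_sub_le _ _).trans ?_) (abs_nonneg b)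
        rw [n4]; linarith
      rw [hRz]
      refine (norm_sub_le _ _).trans ?_
      have n6 := (norm_sub_le (-(2 * (1 + (‖z‖ : ℂ) ^ 2))) (a * (z ^ 2 - (starRingEnd ℂ z) ^ 2)))
      rw [n1] at n6
      have ha := abs_nonneg a
      have hab := mul_nonneg (abs_nonneg b) (add_nonneg zero_le_two (mul_nonneg zero_le_two ha))
      nlinarith
  · rw [stereo, if_neg hx2]
    rcases hR with ⟨c, h, rfl⟩ | ⟨a, b, h, rfl⟩
    · refine (unimodularPotential_eq h H hx hx2).trans ?_
      rw [hs, ht]; simp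
    · refine (nonUnimodularPotential_eq h H hx hx2).trans ?_
      rw [hs, ht]; simp

end Coordinates

/-! ### Surfaces of constant mean curvature in charts -/

section Surface

set_option linter.unusedSectionVars false

variable {X : Type*} [TopologicalSpace X] [ChartedSpace E3 X] [Group X] [LieGroup (𝓡 3) ∞ X]
variable {S : Type*} [TopologicalSpace S] [ChartedSpace E2 S] [IsManifold (𝓡 2) ∞ S]

namespace LeftInvariantMetric

variable {g : LeftInvariantMetric X} {e : Fin 3 → GroupLieAlgebra (𝓡 3) X}
  {f : S → X} {N : ∀ p, TangentSpace (𝓡 3) (f p)} {H : ℝ} {R : ℂ → ℂ}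

/-- The Gauss map of a surface, in the coordinates of a frame of the Lie algebra. -/
def gaussCoord (g : LeftInvariantMetric X) (e : Fin 3 → GroupLieAlgebra (𝓡 3) X) (f : S → X)
    (N : ∀ p, TangentSpace (𝓡 3) (f p)) (p : S) : E3 :=
  g.coord e (gaussMap f N p)

/-- The left translated differential of a surface, in the chart at `p₀` and in the coordinates of an
orthonormal frame of the Lie algebra. -/
def chartDifferential (he : g.OrthonormalFrame e) (f : S → X) (p₀ : S) (x : E2) : E2 →L[ℝ] E3 :=
  (coordEquiv he : E3 →L[ℝ] E3).comp (darboux (fun y => f ((extChartAt (𝓡 2) p₀).symm y)) x)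

/-- The adjoint action of the inverse of the immersion, in the coordinates of an orthonormal frame
of the Lie algebra. -/
def adCoord (he : g.OrthonormalFrame e) (f : S → X) (p : S) : E3 →L[ℝ] E3 :=
  (coordEquiv he : E3 →L[ℝ] E3).comp (adInv (f p))

theorem contMDiffAt_surface_chart_symm {p₀ : S} {x : E2}
    (hx : x ∈ (extChartAt (𝓡 2) p₀).target) :
    ContMDiffAt 𝓘(ℝ, E2) (𝓡 2) ∞ (fun y => (extChartAt (𝓡 2) p₀).symm y) x :=
  (contMDiffOn_extChartAt_symm (n := ∞) p₀).contMDiffAt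
    ((isOpen_extChartAt_target p₀).mem_nhds hx)

theorem mfderiv_chart_symm_bijective {p₀ : S} {x : E2}
    (hx : x ∈ (extChartAt (𝓡 2) p₀).target) :
    Function.Bijective (mfderiv 𝓘(ℝ, E2) (𝓡 2) (extChartAt (𝓡 2) p₀).symm x) := by
  have h := isInvertible_mfderivWithin_extChartAt_symm (I := 𝓡 2) hx
  simp only [modelWithCornersSelf_coe, range_id, mfderivWithin_univ] at h
  exact h.bijective

theorem IsHSurface.contMDiffAt_chart (hf : g.IsHSurface f N H) {p₀ : S} {x : E2}
    (hx : x ∈ (extChartAt (𝓡 2) p₀).target) :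
    ContMDiffAt 𝓘(ℝ, E2) (𝓡 3) ∞ (fun y => f ((extChartAt (𝓡 2) p₀).symm y)) x :=
  ContMDiffAt.comp x (g := f) (f := fun y => (extChartAt (𝓡 2) p₀).symm y) hf.smooth.contMDiffAt
    (contMDiffAt_surface_chart_symm hx)

theorem IsHSurface.contDiffAt_gaussMap (hf : g.IsHSurface f N H) {p₀ : S} {x : E2}
    (hx : x ∈ (extChartAt (𝓡 2) p₀).target) :
    ContDiffAt (F := E3) ℝ ∞ (fun y => gaussMap f N ((extChartAt (𝓡 2) p₀).symm y)) x := by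
  refine contDiffAt_toLieAlgebra (F := fun y => f ((extChartAt (𝓡 2) p₀).symm y))
    (V := fun y => N ((extChartAt (𝓡 2) p₀).symm y)) ?_
  exact ContMDiffAt.comp x (g := fun p => (⟨f p, N p⟩ : TangentBundle (𝓡 3) X))
    (f := fun y => (extChartAt (𝓡 2) p₀).symm y) hf.smooth_normal.contMDiffAt
    (contMDiffAt_surface_chart_symm hx)

theorem IsHSurface.contDiffAt_gaussCoord (hf : g.IsHSurface f N H) (he : g.OrthonormalFrame e)
    {p₀ : S} {x : E2} (hx : x ∈ (extChartAt (𝓡 2) p₀).target) :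
    ContDiffAt ℝ ∞ (fun y => gaussCoord g e f N ((extChartAt (𝓡 2) p₀).symm y)) x :=
  (coordEquiv he).contDiff.contDiffAt.comp x (hf.contDiffAt_gaussMap hx)

theorem IsHSurface.chartDifferential_apply (hf : g.IsHSurface f N H) (he : g.OrthonormalFrame e)
    {p₀ : S} {x : E2} (hx : x ∈ (extChartAt (𝓡 2) p₀).target) (u : E2) :
    chartDifferential he f p₀ x u = g.coord e (leftDifferential f ((extChartAt (𝓡 2) p₀).symm x)
      (mfderiv 𝓘(ℝ, E2) (𝓡 2) (extChartAt (𝓡 2) p₀).symm x u)) := by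
  have h1 := darboux_apply ((hf.contMDiffAt_chart hx).mdifferentiableAt (by simp)) u
  refine congrArg (g.coord e) (h1.trans ?_)
  refine congrArg (toLieAlgebra (f ((extChartAt (𝓡 2) p₀).symm x))) ?_
  exact mfderiv_comp_apply (I' := 𝓡 2) x (hf.smooth.contMDiffAt.mdifferentiableAt (by simp))
    ((contMDiffAt_surface_chart_symm hx).mdifferentiableAt (by simp)) u

/-- The Gauss map with values in the model space. -/
def gaussE (f : S → X) (N : ∀ p, TangentSpace (𝓡 3) (f p)) (p : S) : E3 := gaussMap f N p

theorem IsHSurface.contMDiff_gaussE (hf : g.IsHSurface f N H) :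
    ContMDiff (𝓡 2) 𝓘(ℝ, E3) ∞ (gaussE f N) := by
  intro p
  have hx := mem_extChartAt_target (I := 𝓡 2) p
  have h1 := (hf.contDiffAt_gaussMap hx).contMDiffAt
  have h2 := ContMDiffAt.comp p (g := fun y => gaussE f N ((extChartAt (𝓡 2) p).symm y))
    (f := extChartAt (𝓡 2) p) h1 contMDiffAt_extChartAt
  refine h2.congr_of_eventuallyEq ?_
  filter_upwards [extChartAt_source_mem_nhds (I := 𝓡 2) p] with q hq
  rw [Function.comp_apply, (extChartAt (𝓡 2) p).left_inv hq]

theorem IsHSurface.fderiv_gaussCoord (hf : g.IsHSurface f N H) (he : g.OrthonormalFrame e)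
    {p₀ : S} {x : E2} (hx : x ∈ (extChartAt (𝓡 2) p₀).target) (u : E2) :
    fderiv ℝ (fun y => gaussCoord g e f N ((extChartAt (𝓡 2) p₀).symm y)) x u =
      g.coord e (gaussDifferential f N ((extChartAt (𝓡 2) p₀).symm x)
        (mfderiv 𝓘(ℝ, E2) (𝓡 2) (extChartAt (𝓡 2) p₀).symm x u)) := by
  have h0 := ((hf.contDiffAt_gaussMap hx).differentiableAt (by simp)).hasFDerivAt
  have h1 := ((coordEquiv he).hasFDerivAt.comp x h0).fderiv
  have h2 := congrArg (fun L : E2 →L[ℝ] E3 => L u) h1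
  refine h2.trans (congrArg (g.coord e) ?_)
  have h3 := mfderiv_comp_apply (I := 𝓘(ℝ, E2)) (I' := 𝓡 2) (I'' := 𝓘(ℝ, E3))
    (g := gaussE f N) x (hf.contMDiff_gaussE.contMDiffAt.mdifferentiableAt (by simp))
    ((contMDiffAt_surface_chart_symm hx).mdifferentiableAt (by simp)) u
  rw [mfderiv_eq_fderiv] at h3
  exact h3

end LeftInvariantMetric

end Surface

section Surface

set_option linter.unusedSectionVars false

variable {X : Type*} [TopologicalSpace X] [ChartedSpace E3 X] [Group X] [LieGroup (𝓡 3) ∞ X]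
variable {S : Type*} [TopologicalSpace S] [ChartedSpace E2 S] [IsManifold (𝓡 2) ∞ S]

theorem IsFrame.trace_eq_of_orthonormal {G u v : E3} (h : IsFrame G u) (hv : ⟪v, v⟫ = 1)
    (huv : ⟪u, v⟫ = 0) (hGv : ⟪G, v⟫ = 0) (T : E3 →ₗ[ℝ] E3) :
    LinearMap.trace ℝ E3 T = ⟪T u, u⟫ + ⟪T v, v⟫ + ⟪T G, G⟫ := by
  have hv' := h.expand_tangent hGv
  rw [huv, zero_smul, zero_add] at hv'
  have hc : ⟪cross G u, v⟫ ^ 2 = 1 := by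
    rw [hv', real_inner_smul_left, real_inner_smul_right, h.inner_cross_self_eq_one] at hv
    nlinarith
  rw [h.trace_eq T]
  conv_rhs => rw [hv', map_smul, real_inner_smul_left, real_inner_smul_right, ← mul_assoc, ← sq, hc]
  rw [one_mul]

theorem fderiv_clm_apply_const {E F G : Type*} [NormedAddCommGroup E] [NormedSpace ℝ E]
    [NormedAddCommGroup F] [NormedSpace ℝ F] [NormedAddCommGroup G] [NormedSpace ℝ G]
    {η : E → F →L[ℝ] G} {x : E} (hη : DifferentiableAt ℝ η x) (u : E) (v : F) :
    fderiv ℝ (fun y => η y v) x u = fderiv ℝ η x u v := by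
  rw [fderiv_clm_apply hη (differentiableAt_const v)]
  simp

namespace LeftInvariantMetric

variable {g : LeftInvariantMetric X} {e : Fin 3 → GroupLieAlgebra (𝓡 3) X}
  {f : S → X} {N : ∀ p, TangentSpace (𝓡 3) (f p)} {H : ℝ} {R : ℂ → ℂ}

theorem lieForm_toLieAlgebra (g : LeftInvariantMetric X) (x : X) (v w : TangentSpace (𝓡 3) x) :
    g.lieForm (toLieAlgebra x v) (toLieAlgebra x w) = g.inner x v w := by
  have h1 : ∀ y : X, y = 1 → ∀ a b : E3, ((g.inner y : E3 →L[ℝ] E3 →L[ℝ] ℝ) a b) =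
      g.lieForm a b := by
    rintro _ rfl a b
    rfl
  exact (h1 _ (inv_mul_cancel x) _ _).symm.trans (g.left_invariant x⁻¹ x v w)

theorem inner_coord_toLieAlgebra (he : g.OrthonormalFrame e) (x : X)
    (v w : TangentSpace (𝓡 3) x) :
    ⟪g.coord e (toLieAlgebra x v), g.coord e (toLieAlgebra x w)⟫ = g.inner x v w :=
  (inner_coord he _ _).trans (lieForm_toLieAlgebra g x v w)

theorem koszul_self (he : g.OrthonormalFrame e) (x y : GroupLieAlgebra (𝓡 3) X) :
    g.koszul x y x = ⟪coordBr he (g.coord e x) (g.coord e y), g.coord e x⟫ := by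
  have key : ∀ x y : E3, (g.lieForm (lieBr X x y) x - g.lieForm (lieBr X y x) x +
      g.lieForm (lieBr X x x) y) / 2 =
        ⟪coordBr he (g.coord e x) (g.coord e y), g.coord e x⟫ := by
    intro x y
    have h2 : lieBr X y x = -lieBr X x y := br_swap (lieBrₗ_self X) x y
    have h3 : lieBr X x x = 0 := lieBrₗ_self X x
    rw [coordBr_coord, inner_coord he, h2, h3, map_neg, map_zero, LinearMap.neg_apply, LinearMap.zero_apply]
    ring
  exact key x y

theorem IsHPotential.orthonormalFrame (hR : g.IsHPotential e H R) : g.OrthonormalFrame e := by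
  rcases hR with ⟨c, h, -⟩ | ⟨a, b, h, -⟩
  · exact h.orthonormal
  · exact h.orthonormal

theorem inner_gaussCoord_self (hf : g.IsHSurface f N H) (he : g.OrthonormalFrame e) (p : S) :
    ⟪gaussCoord g e f N p, gaussCoord g e f N p⟫ = 1 :=
  (inner_coord_toLieAlgebra he (f p) (N p) (N p)).trans (hf.unit_normal p)

theorem potential_nondegenerate (hf : g.IsHSurface f N H) (hR : g.IsHPotential e H R)
    (hnz : ∀ p, ¬ PotentialZeroAt R (g.sphereGaussMap e f N p)) (he : g.OrthonormalFrame e)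
    (p : S) : skewPart (coordBr he) (gaussCoord g e f N p) ≠ 0 ∨
      tracePart (coordBr he) H (gaussCoord g e f N p) ≠ 0 := by
  by_contra! h
  exact hnz p (potentialZeroAt_stereo hR he (inner_gaussCoord_self hf he p) h.1 h.2)

theorem IsHSurface.contDiffAt_chartDifferential (hf : g.IsHSurface f N H)
    (he : g.OrthonormalFrame e) {p₀ : S} {x : E2} (hx : x ∈ (extChartAt (𝓡 2) p₀).target) :
    ContDiffAt ℝ ∞ (chartDifferential he f p₀) x :=
  contDiffAt_const.clm_comp (contDiffAt_darboux (hf.contMDiffAt_chart hx))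

theorem IsHSurface.maurerCartan_chart (hf : g.IsHSurface f N H)
    (he : g.OrthonormalFrame e) {p₀ : S} {x : E2} (hx : x ∈ (extChartAt (𝓡 2) p₀).target)
    (u v : E2) : fderiv ℝ (chartDifferential he f p₀) x u v -
      fderiv ℝ (chartDifferential he f p₀) x v u =
      -coordBr he (chartDifferential he f p₀ x u) (chartDifferential he f p₀ x v) := by
  have hd := (contDiffAt_darboux (hf.contMDiffAt_chart hx)).differentiableAt (by simp)
  have h1 : ∀ u v, fderiv ℝ (chartDifferential he f p₀) x u v = g.coord e
      (fderiv ℝ (darboux (fun y => f ((extChartAt (𝓡 2) p₀).symm y))) x u v) := by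
    intro u v
    have h2 := ((hasFDerivAt_const (coordEquiv he : E3 →L[ℝ] E3) x).clm_comp hd.hasFDerivAt).fderiv
    have h3 := congrArg (fun L : E2 →L[ℝ] E2 →L[ℝ] E3 => L u v) h2
    refine h3.trans ?_
    simp
    rfl
  rw [h1, h1, ← map_sub, darboux_maurerCartan (hf.contMDiffAt_chart hx), map_neg]
  exact congrArg Neg.neg (coordBr_coord he _ _).symm

theorem IsHSurface.inner_chartDifferential (hf : g.IsHSurface f N H) (he : g.OrthonormalFrame e)
    {p₀ : S} {x : E2} (hx : x ∈ (extChartAt (𝓡 2) p₀).target) (u v : E2) :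
    ⟪chartDifferential he f p₀ x u, chartDifferential he f p₀ x v⟫ =
      g.firstFundamentalForm f ((extChartAt (𝓡 2) p₀).symm x)
        (mfderiv 𝓘(ℝ, E2) (𝓡 2) (extChartAt (𝓡 2) p₀).symm x u)
        (mfderiv 𝓘(ℝ, E2) (𝓡 2) (extChartAt (𝓡 2) p₀).symm x v) := by
  rw [hf.chartDifferential_apply he hx, hf.chartDifferential_apply he hx]
  exact inner_coord_toLieAlgebra he _ _ _

theorem IsHSurface.inner_gaussCoord_chartDifferential (hf : g.IsHSurface f N H)
    (he : g.OrthonormalFrame e)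
    {p₀ : S} {x : E2} (hx : x ∈ (extChartAt (𝓡 2) p₀).target) (u : E2) :
    ⟪gaussCoord g e f N ((extChartAt (𝓡 2) p₀).symm x), chartDifferential he f p₀ x u⟫ = 0 := by
  rw [hf.chartDifferential_apply he hx]
  exact (inner_coord_toLieAlgebra he _ _ _).trans (hf.normal _ _)

theorem IsHSurface.injective_chartDifferential (hf : g.IsHSurface f N H)
    (he : g.OrthonormalFrame e) {p₀ : S} {x : E2} (hx : x ∈ (extChartAt (𝓡 2) p₀).target) :
    Function.Injective (chartDifferential he f p₀ x) := by
  intro u v huv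
  rw [hf.chartDifferential_apply he hx, hf.chartDifferential_apply he hx] at huv
  exact (mfderiv_chart_symm_bijective hx).1 (hf.immersion _ (toLieAlgebra_injective _
    (coord_injective he huv)))

theorem secondFundamentalForm_self (he : g.OrthonormalFrame e) (f : S → X)
    (N : ∀ p, TangentSpace (𝓡 3) (f p)) (p : S) (v : TangentSpace (𝓡 2) p) :
    g.secondFundamentalForm f N p v v =
      -⟪g.coord e (gaussDifferential f N p v), g.coord e (leftDifferential f p v)⟫ +
      ⟪coordBr he (gaussCoord g e f N p) (g.coord e (leftDifferential f p v)),
        g.coord e (leftDifferential f p v)⟫ := by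
  have h1 : g.secondFundamentalForm f N p v v =
    -(g.lieForm (gaussDifferential f N p v) (leftDifferential f p v) +
      g.koszul (leftDifferential f p v) (gaussMap f N p) (leftDifferential f p v)) := rfl
  rw [h1, koszul_self he]
  have h2 := inner_coord he (gaussDifferential f N p v) (leftDifferential f p v)
  have h3 := br_swap (coordBr_self he) (g.coord e (leftDifferential f p v))
    (gaussCoord g e f N p)
  rw [h3, inner_neg_left]
  refine (congrArg (fun r : ℝ => -(r + ⟪coordBr he (g.coord e (leftDifferential f p v))
    (g.coord e (gaussMap f N p)), g.coord e (leftDifferential f p v)⟫)) h2.symm).trans ?_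
  rw [neg_add]
  rfl

/-- In a chart, a surface of constant mean curvature satisfies the structure equations; the
hypothesis on the potential makes its Gauss map nondegenerate. -/
theorem IsHSurface.gaussChart (hf : g.IsHSurface f N H) (hR : g.IsHPotential e H R)
    (hnz : ∀ p, ¬ PotentialZeroAt R (g.sphereGaussMap e f N p)) (he : g.OrthonormalFrame e)
    (p₀ : S) : GaussChart (coordBr he) H (extChartAt (𝓡 2) p₀).target
      (fun x => gaussCoord g e f N ((extChartAt (𝓡 2) p₀).symm x))
      (chartDifferential he f p₀) where
  isOpen := isOpen_extChartAt_target p₀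
  br_self := coordBr_self he
  smooth_G x hx := hf.contDiffAt_gaussCoord he hx
  smooth_η x hx := hf.contDiffAt_chartDifferential he hx
  maurerCartan x hx u v := hf.maurerCartan_chart he hx u v
  data x hx := by
    have hmem := (isOpen_extChartAt_target (I := 𝓡 2) p₀).mem_nhds hx
    have hGd := (hf.contDiffAt_gaussCoord he hx).differentiableAt (by simp)
    have hηd := (hf.contDiffAt_chartDifferential he hx).differentiableAt (by simp)
    have hnorm := hf.inner_gaussCoord_chartDifferential he hx
    refine ⟨hf.injective_chartDifferential he hx, inner_gaussCoord_self hf he _, hnorm, ?_, ?_, ?_,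
      potential_nondegenerate hf hR hnz he _⟩
    · intro u
      have := GaussChart.fderiv_inner_eq hGd hGd (Eventually.of_forall fun y =>
        inner_gaussCoord_self hf he ((extChartAt (𝓡 2) p₀).symm y)) u
      rw [real_inner_comm _ (fderiv ℝ _ x u)] at this
      linarith
    · intro u v hu hv huv
      have hfr : IsFrame (gaussCoord g e f N ((extChartAt (𝓡 2) p₀).symm x))
        (chartDifferential he f p₀ x u) := ⟨inner_gaussCoord_self hf he _, hu, hnorm u⟩
      have htr := hfr.trace_eq_of_orthonormal hv huv (hnorm v)
        (coordBr he (gaussCoord g e f N ((extChartAt (𝓡 2) p₀).symm x)))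
      have hm := hf.mean_curvature ((extChartAt (𝓡 2) p₀).symm x) _ _
        ((hf.inner_chartDifferential he hx u u).symm.trans hu)
        ((hf.inner_chartDifferential he hx v v).symm.trans hv)
        ((hf.inner_chartDifferential he hx u v).symm.trans huv)
      rw [secondFundamentalForm_self he, secondFundamentalForm_self he,
        ← hf.fderiv_gaussCoord he hx, ← hf.fderiv_gaussCoord he hx,
        ← hf.chartDifferential_apply he hx, ← hf.chartDifferential_apply he hx] at hm
      rw [coordBr_self, inner_zero_left] at htr
      rw [tracePart, htr]
      linarith
    · intro u v
      have h1 := fun u v => GaussChart.fderiv_inner_eq hGd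
        (hηd.clm_apply (differentiableAt_const v) :
          DifferentiableAt ℝ (fun y => chartDifferential he f p₀ y v) x)
        (eventually_of_mem hmem fun y hy => hf.inner_gaussCoord_chartDifferential he hy v) u
      have h2 := h1 u v
      have h3 := h1 v u
      rw [fderiv_clm_apply_const hηd] at h2 h3
      have h4 := congrArg (fun z => ⟪gaussCoord g e f N ((extChartAt (𝓡 2) p₀).symm x), z⟫)
        (hf.maurerCartan_chart he hx u v)
      simp only [inner_sub_right, inner_neg_right] at h4
      linarith

theorem IsHSurface.contDiffAt_adCoord (hf : g.IsHSurface f N H) (he : g.OrthonormalFrame e)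
    {p₀ : S} {x : E2} (hx : x ∈ (extChartAt (𝓡 2) p₀).target) :
    ContDiffAt ℝ ∞ (fun y => adCoord he f ((extChartAt (𝓡 2) p₀).symm y)) x :=
  contDiffAt_const.clm_comp (contDiffAt_adInv (hf.contMDiffAt_chart hx))

theorem injective_adCoord (he : g.OrthonormalFrame e) (f : S → X) (p : S) :
    Function.Injective (adCoord he f p) :=
  (coordEquiv he).injective.comp (adInv_injective (f p))

theorem IsHSurface.fderiv_adCoord (hf : g.IsHSurface f N H) (he : g.OrthonormalFrame e)
    {p₀ : S} {x : E2} (hx : x ∈ (extChartAt (𝓡 2) p₀).target) (u : E2) (v : E3) :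
    fderiv ℝ (fun y => adCoord he f ((extChartAt (𝓡 2) p₀).symm y)) x u v =
      -coordBr he (chartDifferential he f p₀ x u)
        (adCoord he f ((extChartAt (𝓡 2) p₀).symm x) v) := by
  have hd := (contDiffAt_adInv (hf.contMDiffAt_chart hx)).differentiableAt (by simp)
  have h2 := ((hasFDerivAt_const (coordEquiv he : E3 →L[ℝ] E3) x).clm_comp hd.hasFDerivAt).fderiv
  have h3 := congrArg (fun L : E2 →L[ℝ] E3 →L[ℝ] E3 => L u v) h2
  refine h3.trans ?_
  have h4 := fderiv_adInv (hf.contMDiffAt_chart hx) v u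
  simp only [add_apply, ContinuousLinearMap.compL_apply, ContinuousLinearMap.comp_apply]
  simp
  refine (congrArg (g.coord e) h4).trans ?_
  rw [map_neg]
  exact congrArg Neg.neg (coordBr_coord he _ _).symm

end LeftInvariantMetric

end Surface

/-! ### Smoothness of the stereographic projection -/

/-- The two standard stereographic coordinates of the unit sphere: for `σ = 1` the projection from
`(0, 0, -1)`, and for `σ = -1` its inverse, the conjugate of the projection from `(0, 0, 1)`. -/
def stereoCoord (σ : ℝ) (x : E3) : ℂ :=
  ((x 0 : ℂ) + (σ : ℂ) * Complex.I * (x 1 : ℂ)) / ((1 + σ * x 2 : ℝ) : ℂ)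

/-- The parametrization of the unit sphere inverse to `stereoCoord σ`. -/
def stereoParam (σ : ℝ) (q : ℂ) : E3 :=
  (1 + q.re ^ 2 + q.im ^ 2)⁻¹ • !₂[2 * q.re, σ * (2 * q.im), σ * (1 - q.re ^ 2 - q.im ^ 2)]

theorem contDiff_stereoParam (σ : ℝ) : ContDiff ℝ ∞ (stereoParam σ) := by
  have hre : ContDiff ℝ ∞ (fun q : ℂ => q.re) := Complex.reCLM.contDiff
  have him : ContDiff ℝ ∞ (fun q : ℂ => q.im) := Complex.imCLM.contDiff
  have hd : ContDiff ℝ ∞ (fun q : ℂ => 1 + q.re ^ 2 + q.im ^ 2) := by fun_prop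
  refine (hd.inv fun q => by positivity).smul ?_
  rw [contDiff_euclidean]
  intro i
  fin_cases i <;> simp <;> fun_prop

theorem contDiffAt_stereoCoord {σ : ℝ} {x : E3} (hx : 1 + σ * x 2 ≠ 0) :
    ContDiffAt ℝ ∞ (stereoCoord σ) x := by
  have h : ∀ i, ContDiff ℝ ∞ (fun y : E3 => ((y i : ℝ) : ℂ)) := fun i =>
    Complex.ofRealCLM.contDiff.comp (contDiff_euclidean.1 contDiff_id i)
  have h2 : ContDiff ℝ ∞ (fun y : E3 => ((1 + σ * y 2 : ℝ) : ℂ)) := by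
    simp only [Complex.ofReal_add, Complex.ofReal_mul]
    exact contDiff_const.add (contDiff_const.mul (h 2))
  have h3 : ContDiff ℝ ∞ (fun y : E3 => (y 0 : ℂ) + (σ : ℂ) * Complex.I * (y 1 : ℂ)) :=
    (h 0).add (contDiff_const.mul (h 1))
  have hx' : ((1 + σ * x 2 : ℝ) : ℂ) ≠ 0 := Complex.ofReal_ne_zero.2 hx
  have h4 : ContDiffAt ℝ ∞ (fun y : E3 => ((1 + σ * y 2 : ℝ) : ℂ)⁻¹) x :=
    ContDiffAt.inv h2.contDiffAt hx'
  have h5 : stereoCoord σ = fun y => ((y 0 : ℂ) + (σ : ℂ) * Complex.I * (y 1 : ℂ)) *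
      ((1 + σ * y 2 : ℝ) : ℂ)⁻¹ := rfl
  rw [h5]
  exact h3.contDiffAt.mul h4

theorem stereoCoord_re (σ : ℝ) (x : E3) : (stereoCoord σ x).re = x 0 / (1 + σ * x 2) := by
  rw [stereoCoord, Complex.div_ofReal_re]; simp

theorem stereoCoord_im (σ : ℝ) (x : E3) : (stereoCoord σ x).im = σ * x 1 / (1 + σ * x 2) := by
  rw [stereoCoord, Complex.div_ofReal_im]; simp

theorem stereoParam_stereoCoord {σ : ℝ} (hσ : σ ^ 2 = 1) {x : E3} (h1 : ⟪x, x⟫ = 1)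
    (hx : 1 + σ * x 2 ≠ 0) : stereoParam σ (stereoCoord σ x) = x := by
  rw [inner_E3] at h1
  have key : 1 + (x 0 / (1 + σ * x 2)) ^ 2 + (σ * x 1 / (1 + σ * x 2)) ^ 2 =
      2 / (1 + σ * x 2) := by
    field_simp
    linear_combination h1 + (x 1 ^ 2 + x 2 ^ 2) * hσ
  apply E3_ext <;> rw [stereoParam, stereoCoord_re, stereoCoord_im, key]
  · simp; field_simp
  · simp; field_simp
    linear_combination (x 1) * hσ
  · have : 1 - (x 0 / (1 + σ * x 2)) ^ 2 - (σ * x 1 / (1 + σ * x 2)) ^ 2 =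
      2 - 2 / (1 + σ * x 2) := by linarith
    simp [this]; field_simp
    linear_combination (x 2) * hσ

/-- Near every point of the unit sphere, the stereographic projection is a smooth map with a smooth
left inverse, in a chart of the Riemann sphere. -/
theorem exists_chart_stereo (n : E3) :
    ∃ c ∈ atlas ℂ (OnePoint ℂ), ∃ (s : E3 → ℂ) (ρ : ℂ → E3), ContDiffAt ℝ ∞ s n ∧
      ContDiff ℝ ∞ ρ ∧ ∀ᶠ x in 𝓝 n, ⟪x, x⟫ = 1 →
        stereo x ∈ c.source ∧ c (stereo x) = s x ∧ ρ (s x) = x := by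
  have hcont : ∀ σ : ℝ, Continuous (fun x : E3 => 1 + σ * x 2) := fun σ => by fun_prop
  have hzero : ∀ z : ℂ, RiemannSphere.chartZero ((z : ℂ) : OnePoint ℂ) = z := fun z =>
    (OnePoint.isOpenEmbedding_coe (X := ℂ)).toOpenPartialHomeomorph_left_inv
  by_cases h2 : n 2 = -1
  · have hne : 1 + (-1) * n 2 ≠ 0 := by rw [h2]; norm_num
    refine ⟨RiemannSphere.chartInfty, Or.inr rfl, stereoCoord (-1), stereoParam (-1),
      contDiffAt_stereoCoord hne, contDiff_stereoParam _, ?_⟩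
    filter_upwards [(hcont (-1)).continuousAt.eventually_ne hne] with x hx h1
    have key : RiemannSphere.inv (stereo x) = ((stereoCoord (-1) x : ℂ) : OnePoint ℂ) := by
      rw [inner_E3] at h1
      by_cases hx2 : x 2 = -1
      · have h3 : x 0 = 0 ∧ x 1 = 0 := by
          rw [hx2] at h1
          constructor <;> nlinarith [sq_nonneg (x 0), sq_nonneg (x 1)]
        rw [stereo, if_pos hx2, RiemannSphere.inv_infty, stereoCoord, h3.1, h3.2]
        simp
      · have h4 : (1 + x 2 : ℝ) ≠ 0 := fun h => hx2 (by linarith)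
        have h4' : (1 + (x 2 : ℂ)) ≠ 0 := by
          rw [← Complex.ofReal_one, ← Complex.ofReal_add]
          exact Complex.ofReal_ne_zero.2 h4
        have hx' : (1 - (x 2 : ℂ)) ≠ 0 := by
          have : 1 - x 2 ≠ 0 := fun h => hx (by linarith)
          rw [← Complex.ofReal_one, ← Complex.ofReal_sub]
          exact Complex.ofReal_ne_zero.2 this
        have h5 : ((x 0 : ℂ) + Complex.I * x 1) * ((x 0 : ℂ) - Complex.I * x 1) =
            (1 + x 2) * (1 - x 2) := by
          have h1' : (x 0 : ℂ) * x 0 + x 1 * x 1 + x 2 * x 2 = 1 := by exact_mod_cast h1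
          linear_combination h1' - (x 1 : ℂ) ^ 2 * Complex.I_sq
        have h6 : (x 0 : ℂ) + Complex.I * x 1 ≠ 0 := by
          intro h0
          rw [h0, zero_mul] at h5
          exact mul_ne_zero h4' hx' h5.symm
        rw [stereo, if_neg hx2, RiemannSphere.inv_coe (div_ne_zero h6 h4'), stereoCoord]
        congr 1
        push_cast
        rw [inv_div, div_eq_div_iff h6 (by convert hx' using 1; ring)]
        linear_combination -h5
    refine ⟨?_, ?_, stereoParam_stereoCoord (by norm_num) h1 hx⟩
    · have : RiemannSphere.inv (stereo x) ∈ RiemannSphere.chartZero.source := by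
        rw [key]
        simp [RiemannSphere.chartZero]
      simpa [RiemannSphere.chartInfty, RiemannSphere.invHomeomorph] using this
    · change RiemannSphere.chartZero (RiemannSphere.inv (stereo x)) = _
      rw [key]
      exact hzero _
  · have hne : 1 + 1 * n 2 ≠ 0 := fun h => h2 (by linarith)
    refine ⟨RiemannSphere.chartZero, Or.inl rfl, stereoCoord 1, stereoParam 1,
      contDiffAt_stereoCoord hne, contDiff_stereoParam _, ?_⟩
    filter_upwards [(hcont 1).continuousAt.eventually_ne hne] with x hx h1
    have hx2 : x 2 ≠ -1 := fun h => hx (by rw [h]; norm_num)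
    have key : stereo x = ((stereoCoord 1 x : ℂ) : OnePoint ℂ) := by
      rw [stereo, if_neg hx2, stereoCoord]
      simp
    rw [key]
    exact ⟨by simp [RiemannSphere.chartZero], hzero _,
      stereoParam_stereoCoord (by norm_num) h1 hx⟩

section StereoComp

variable {E : Type*} [NormedAddCommGroup E] [NormedSpace ℝ E] {M : Type*} [TopologicalSpace M]
  [ChartedSpace E M] {F : M → E3} {p : M}

theorem contMDiffAt_stereo_comp (hF : ContMDiffAt 𝓘(ℝ, E) 𝓘(ℝ, E3) ∞ F p)
    (h1 : ∀ q, ⟪F q, F q⟫ = 1) :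
    ContMDiffAt 𝓘(ℝ, E) 𝓘(ℝ, ℂ) ∞ (fun q => stereo (F q)) p := by
  obtain ⟨c, hc, s, ρ, hs, hρ, hev⟩ := exists_chart_stereo (F p)
  have hev' := hF.continuousAt.eventually hev
  obtain ⟨h2, h3, -⟩ := hev'.self_of_nhds (h1 p)
  have h4 : ContMDiffAt 𝓘(ℝ, ℂ) 𝓘(ℝ, ℂ) ∞ c.symm (s (F p)) :=
    contMDiffAt_symm_of_mem_maximalAtlas (IsManifold.subset_maximalAtlas hc)
      (h3 ▸ c.map_source h2)
  have h5 := ContMDiffAt.comp p (f := fun q => s (F q)) h4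
    (ContMDiffAt.comp p (f := F) hs.contMDiffAt hF)
  refine h5.congr_of_eventuallyEq ?_
  filter_upwards [hev'] with q hq
  obtain ⟨h6, h7, -⟩ := hq (h1 q)
  rw [Function.comp_apply, ← h7, c.left_inv h6]

/-- The stereographic projection is an immersion of the unit sphere. -/
theorem mfderiv_stereo_comp_eq_zero_iff (hF : ContMDiffAt 𝓘(ℝ, E) 𝓘(ℝ, E3) ∞ F p)
    (h1 : ∀ q, ⟪F q, F q⟫ = 1) (w : TangentSpace 𝓘(ℝ, E) p) :
    mfderiv 𝓘(ℝ, E) 𝓘(ℝ, ℂ) (fun q => stereo (F q)) p w = 0 ↔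
      mfderiv 𝓘(ℝ, E) 𝓘(ℝ, E3) F p w = 0 := by
  obtain ⟨c, hc, s, ρ, hs, hρ, hev⟩ := exists_chart_stereo (F p)
  have hev' := hF.continuousAt.eventually hev
  obtain ⟨h2, h3, -⟩ := hev'.self_of_nhds (h1 p)
  have hg := (contMDiffAt_stereo_comp hF h1).mdifferentiableAt (by simp)
  have hFd := hF.mdifferentiableAt (by simp)
  constructor
  · intro h
    have hcd : MDifferentiableAt 𝓘(ℝ, ℂ) 𝓘(ℝ, ℂ) c (stereo (F p)) :=
      mdifferentiableAt_atlas hc h2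
    have hρd : MDifferentiableAt 𝓘(ℝ, ℂ) 𝓘(ℝ, E3) ρ (c (stereo (F p))) :=
      (hρ.contMDiff.contMDiffAt).mdifferentiableAt (by simp)
    have e1 : F =ᶠ[𝓝 p] (fun q => ρ (c (stereo (F q)))) := by
      filter_upwards [hev'] with q hq
      obtain ⟨-, h7, h8⟩ := hq (h1 q)
      rw [h7, h8]
    have e2 := mfderiv_comp_apply (I := 𝓘(ℝ, E)) (I' := 𝓘(ℝ, ℂ)) (I'' := 𝓘(ℝ, E3)) p
      (g := fun q => ρ (c q)) (f := fun q => stereo (F q))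
      (MDifferentiableAt.comp (stereo (F p)) hρd hcd) hg w
    rw [h, map_zero] at e2
    rw [e1.mfderiv_eq]
    exact e2
  · intro h
    have h4 : MDifferentiableAt 𝓘(ℝ, ℂ) 𝓘(ℝ, ℂ) c.symm (s (F p)) :=
      mdifferentiableAt_atlas_symm hc (h3 ▸ c.map_source h2)
    have hsd : MDifferentiableAt 𝓘(ℝ, E3) 𝓘(ℝ, ℂ) s (F p) :=
      hs.contMDiffAt.mdifferentiableAt (by simp)
    have e1 : (fun q => stereo (F q)) =ᶠ[𝓝 p] (fun q => c.symm (s (F q))) := by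
      filter_upwards [hev'] with q hq
      obtain ⟨h6, h7, -⟩ := hq (h1 q)
      rw [← h7, c.left_inv h6]
    have e2 := mfderiv_comp_apply (I := 𝓘(ℝ, E)) (I' := 𝓘(ℝ, E3)) (I'' := 𝓘(ℝ, ℂ)) p
      (g := fun q => c.symm (s q)) (f := F)
      (MDifferentiableAt.comp (F p) h4 hsd) hFd w
    rw [h, map_zero] at e2
    rw [e1.mfderiv_eq]
    exact e2

end StereoComp

/-! ### The rank of the Gauss map -/

theorem finrank_range_le_one_iff {V : Type*} [AddCommGroup V] [Module ℝ V] (T : E2 →ₗ[ℝ] V) :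
    Module.finrank ℝ (LinearMap.range T) ≤ 1 ↔ ∃ w, w ≠ 0 ∧ T w = 0 := by
  have h1 := LinearMap.finrank_range_add_finrank_ker T
  rw [finrank_euclideanSpace, Fintype.card_fin] at h1
  have h2 : 0 < Module.finrank ℝ (LinearMap.ker T) ↔ ∃ w, w ≠ 0 ∧ T w = 0 := by
    rw [Module.finrank_pos_iff, Submodule.nontrivial_iff_ne_bot, Submodule.ne_bot_iff]
    simp only [LinearMap.mem_ker]
    exact exists_congr fun w => and_comm
  rw [← h2]
  omega

theorem one_le_finrank_range {V : Type*} [AddCommGroup V] [Module ℝ V] {T : E2 →ₗ[ℝ] V}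
    (hT : T ≠ 0) : 1 ≤ Module.finrank ℝ (LinearMap.range T) := by
  rw [Nat.one_le_iff_ne_zero, Ne, Submodule.finrank_eq_zero, LinearMap.range_eq_bot]
  exact hT

section Surface

set_option linter.unusedSectionVars false

variable {X : Type*} [TopologicalSpace X] [ChartedSpace E3 X] [Group X] [LieGroup (𝓡 3) ∞ X]
variable {S : Type*} [TopologicalSpace S] [ChartedSpace E2 S] [IsManifold (𝓡 2) ∞ S]

namespace LeftInvariantMetric

variable {g : LeftInvariantMetric X} {e : Fin 3 → GroupLieAlgebra (𝓡 3) X}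
  {f : S → X} {N : ∀ p, TangentSpace (𝓡 3) (f p)} {H : ℝ} {R : ℂ → ℂ}

theorem IsHSurface.contMDiff_gaussCoord (hf : g.IsHSurface f N H) (he : g.OrthonormalFrame e) :
    ContMDiff (𝓡 2) 𝓘(ℝ, E3) ∞ (gaussCoord g e f N) := fun p =>
  ContMDiffAt.comp p (g := fun v : E3 => g.coord e v) (f := gaussE f N)
    (coordEquiv he).contDiff.contMDiff.contMDiffAt hf.contMDiff_gaussE.contMDiffAt

theorem IsHSurface.fderiv_gaussCoord_eq_mfderiv (hf : g.IsHSurface f N H)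
    (he : g.OrthonormalFrame e) {p₀ : S} {x : E2} (hx : x ∈ (extChartAt (𝓡 2) p₀).target)
    (u : E2) : fderiv ℝ (fun y => gaussCoord g e f N ((extChartAt (𝓡 2) p₀).symm y)) x u =
      mfderiv (𝓡 2) 𝓘(ℝ, E3) (gaussCoord g e f N) ((extChartAt (𝓡 2) p₀).symm x)
        (mfderiv 𝓘(ℝ, E2) (𝓡 2) (extChartAt (𝓡 2) p₀).symm x u) := by
  have h3 := mfderiv_comp_apply (I := 𝓘(ℝ, E2)) (I' := 𝓡 2) (I'' := 𝓘(ℝ, E3))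
    (g := gaussCoord g e f N) x
    ((hf.contMDiff_gaussCoord he).contMDiffAt.mdifferentiableAt (by simp))
    ((contMDiffAt_surface_chart_symm hx).mdifferentiableAt (by simp)) u
  rw [mfderiv_eq_fderiv] at h3
  exact h3

theorem IsHSurface.mfderiv_sphereGaussMap_eq_zero_iff (hf : g.IsHSurface f N H)
    (he : g.OrthonormalFrame e) {p₀ : S} {x : E2} (hx : x ∈ (extChartAt (𝓡 2) p₀).target)
    (u : E2) : mfderiv (𝓡 2) 𝓘(ℝ, ℂ) (g.sphereGaussMap e f N) ((extChartAt (𝓡 2) p₀).symm x)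
        (mfderiv 𝓘(ℝ, E2) (𝓡 2) (extChartAt (𝓡 2) p₀).symm x u) = 0 ↔
      fderiv ℝ (fun y => gaussCoord g e f N ((extChartAt (𝓡 2) p₀).symm y)) x u = 0 := by
  rw [hf.fderiv_gaussCoord_eq_mfderiv he hx]
  exact mfderiv_stereo_comp_eq_zero_iff (hf.contMDiff_gaussCoord he _)
    (inner_gaussCoord_self hf he) _

theorem IsHSurface.rankAt_le_one_iff (hf : g.IsHSurface f N H)
    (he : g.OrthonormalFrame e) {p₀ : S} {x : E2} (hx : x ∈ (extChartAt (𝓡 2) p₀).target) :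
    rankAt (g.sphereGaussMap e f N) ((extChartAt (𝓡 2) p₀).symm x) ≤ 1 ↔ ∃ k, k ≠ 0 ∧
      fderiv ℝ (fun y => gaussCoord g e f N ((extChartAt (𝓡 2) p₀).symm y)) x k = 0 := by
  have hb := mfderiv_chart_symm_bijective hx
  refine (finrank_range_le_one_iff (V := ℂ) (mfderiv (𝓡 2) 𝓘(ℝ, ℂ) (g.sphereGaussMap e f N)
    ((extChartAt (𝓡 2) p₀).symm x)).toLinearMap).trans ?_
  constructor
  · rintro ⟨w, hw, h⟩
    obtain ⟨k, rfl⟩ := hb.2 w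
    refine ⟨k, ?_, (hf.mfderiv_sphereGaussMap_eq_zero_iff he hx k).1 h⟩
    rintro rfl
    exact hw (map_zero _)
  · rintro ⟨k, hk, h⟩
    refine ⟨_, ?_, (hf.mfderiv_sphereGaussMap_eq_zero_iff he hx k).2 h⟩
    exact fun h0 => hk (hb.1 (h0.trans (map_zero _).symm))

theorem IsHSurface.one_le_rankAt (hf : g.IsHSurface f N H) (hR : g.IsHPotential e H R)
    (hnz : ∀ p, ¬ PotentialZeroAt R (g.sphereGaussMap e f N p)) (p : S) :
    1 ≤ rankAt (g.sphereGaussMap e f N) p := by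
  have he := hR.orthonormalFrame
  have hx := mem_extChartAt_target (I := 𝓡 2) p
  refine one_le_finrank_range (V := ℂ) fun h0 => ?_
  refine ((hf.gaussChart hR hnz he p).data _ hx).differential_ne_zero (coordBr_self he) ?_
  ext1 u
  refine (hf.mfderiv_sphereGaussMap_eq_zero_iff he hx u).1 ?_
  rw [extChartAt_to_inv]
  exact congrArg (fun L : E2 →ₗ[ℝ] ℂ => L _) h0

end LeftInvariantMetric

end Surface

/-! ### Right invariant fields tangent to the surface -/

/-- If a linear equation `η x k = y x` has an injective coefficient depending smoothly on `x`, then,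
wherever it is solvable, its solution is given by a smooth function of `x`. -/
theorem exists_contDiffAt_solution {η : E2 → E2 →L[ℝ] E3} {y : E2 → E3} {p : E2}
    (hη : ContDiffAt ℝ ∞ η p) (hy : ContDiffAt ℝ ∞ y p) (hinj : Function.Injective (η p)) :
    ∃ W : E2 → E2, ContDiffAt ℝ ∞ W p ∧ ∀ᶠ x in 𝓝 p, ∀ k, η x k = y x → W x = k := by
  -- a left inverse at `p`: composed with it, the coefficient is invertible near `p`
  obtain ⟨L, hL⟩ := LinearMap.exists_leftInverse_of_injective (η p).toLinearMap
    (LinearMap.ker_eq_bot.2 hinj)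
  set L' : E3 →L[ℝ] E2 := L.toContinuousLinearMap with hL'
  set T : E2 → E2 →L[ℝ] E2 := fun x => L'.comp (η x) with hT
  have hTs : ContDiffAt ℝ ∞ T p := contDiffAt_const.clm_comp hη
  have hTp : T p = ((ContinuousLinearEquiv.refl ℝ E2 : E2 ≃L[ℝ] E2) : E2 →L[ℝ] E2) := by
    ext1 u
    exact congrArg (fun M : E2 →ₗ[ℝ] E2 => M u) hL
  have hinvT : ContDiffAt ℝ ∞ (fun x => (T x).inverse) p := by
    have := contDiffAt_map_inverse (𝕜 := ℝ) (n := ∞) (ContinuousLinearEquiv.refl ℝ E2)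
    rw [← hTp] at this
    exact this.comp p hTs
  refine ⟨fun x => (T x).inverse (L' (y x)), hinvT.clm_apply (L'.contDiff.contDiffAt.comp p hy), ?_⟩
  have hev : ∀ᶠ x in 𝓝 p, T x ∈ range ((↑) : (E2 ≃L[ℝ] E2) → E2 →L[ℝ] E2) := by
    refine hTs.continuousAt.eventually ?_
    rw [hTp]
    exact ContinuousLinearEquiv.nhds _
  filter_upwards [hev] with x hx k hk
  obtain ⟨e, he⟩ := hx
  have h1 : L' (y x) = e k := by
    rw [← hk]
    exact (congrArg (fun M : E2 →L[ℝ] E2 => M k) he).symm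
  rw [← he, ContinuousLinearMap.inverse_equiv, h1]
  exact e.symm_apply_apply k

/-- A vector field of class `C¹` has a continuous local flow which stays close to the initial
point. -/
theorem exists_local_flow {W : E2 → E2} {p : E2} (hW : ContDiffAt ℝ 1 W p) {U : Set E2}
    (hU : U ∈ 𝓝 p) : ∃ V ∈ 𝓝 p, ∃ ε > (0 : ℝ), ∃ α : E2 × ℝ → E2,
      ContinuousOn α (V ×ˢ Ioo (-ε) ε) ∧ ∀ x ∈ V, α (x, 0) = x ∧
        ∀ t ∈ Ioo (-ε) ε, α (x, t) ∈ U ∧ HasDerivAt (fun s => α (x, s)) (W (α (x, t))) t := by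
  obtain ⟨ε, hε, a, r, L, K, hr, hP⟩ := IsPicardLindelof.of_contDiffAt_one hW
  obtain ⟨α, hα, hcont⟩ := (hP 0).exists_forall_mem_closedBall_eq_hasDerivWithinAt_continuousOn
  simp only [zero_sub, zero_add] at hα hcont
  have hpr : p ∈ Metric.closedBall p (r : ℝ) := Metric.mem_closedBall_self hr.le
  have hnhd : Metric.closedBall p (r : ℝ) ×ˢ Icc (-ε) ε ∈ 𝓝 (p, (0 : ℝ)) :=
    prod_mem_nhds (Metric.closedBall_mem_nhds p hr) (Icc_mem_nhds (by linarith) hε)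
  have hU' : α ⁻¹' U ∈ 𝓝 (p, (0 : ℝ)) := by
    refine (hcont.continuousAt hnhd).preimage_mem_nhds ?_
    rw [(hα p hpr).1]
    exact hU
  obtain ⟨V, hV, J, hJ, hVJ⟩ := mem_nhds_prod_iff.1 (inter_mem hU' hnhd)
  obtain ⟨δ, hδ, hδJ⟩ := Metric.mem_nhds_iff.1 hJ
  rw [Real.ball_eq_Ioo, zero_sub, zero_add] at hδJ
  have hsub : V ×ˢ Ioo (-δ) δ ⊆ α ⁻¹' U ∩ Metric.closedBall p (r : ℝ) ×ˢ Icc (-ε) ε :=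
    (prod_mono_right hδJ).trans hVJ
  refine ⟨V, hV, δ, hδ, α, hcont.mono (hsub.trans inter_subset_right), fun x hx => ?_⟩
  have hxr : x ∈ Metric.closedBall p (r : ℝ) :=
    (hsub (mk_mem_prod hx (⟨by linarith, hδ⟩ : (0 : ℝ) ∈ Ioo (-δ) δ))).2.1
  refine ⟨(hα x hxr).1, fun t ht => ⟨(hsub (mk_mem_prod hx ht)).1, ?_⟩⟩
  refine ((hα x hxr).2 t (hsub (mk_mem_prod hx ht)).2.2).hasDerivAt ?_
  refine mem_of_superset (isOpen_Ioo.mem_nhds ht) fun s hs => (hsub (mk_mem_prod hx hs)).2.2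

section Surface

set_option linter.unusedSectionVars false

variable {X : Type*} [TopologicalSpace X] [ChartedSpace E3 X] [Group X] [LieGroup (𝓡 3) ∞ X]
variable {S : Type*} [TopologicalSpace S] [ChartedSpace E2 S] [IsManifold (𝓡 2) ∞ S]

namespace LeftInvariantMetric

variable {g : LeftInvariantMetric X} {e : Fin 3 → GroupLieAlgebra (𝓡 3) X}
  {f : S → X} {N : ∀ p, TangentSpace (𝓡 3) (f p)} {H : ℝ} {R : ℂ → ℂ}

theorem chartDifferential_eq_adCoord_iff (hf : g.IsHSurface f N H) (he : g.OrthonormalFrame e)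
    {p₀ : S} {x : E2} (hx : x ∈ (extChartAt (𝓡 2) p₀).target) (u : E2) (v : E3) :
    chartDifferential he f p₀ x u = adCoord he f ((extChartAt (𝓡 2) p₀).symm x) v ↔
      mfderiv 𝓘(ℝ, E2) (𝓡 3) (fun y => f ((extChartAt (𝓡 2) p₀).symm y)) x u =
        rightInvariantField v (f ((extChartAt (𝓡 2) p₀).symm x)) := by
  have h1 := darboux_apply ((hf.contMDiffAt_chart hx).mdifferentiableAt (by simp)) u
  have h2 := adInv_apply (f ((extChartAt (𝓡 2) p₀).symm x)) v
  have h3 : chartDifferential he f p₀ x u = adCoord he f ((extChartAt (𝓡 2) p₀).symm x) v ↔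
      darboux (fun y => f ((extChartAt (𝓡 2) p₀).symm y)) x u =
        adInv (f ((extChartAt (𝓡 2) p₀).symm x)) v := (coordEquiv he).injective.eq_iff
  rw [h3, h1, h2]
  exact (toLieAlgebra_injective _).eq_iff

/-- The right invariant field with value `v` at the identity is tangent to the surface. -/
def IsTangent (he : g.OrthonormalFrame e) (f : S → X) (N : ∀ p, TangentSpace (𝓡 3) (f p))
    (v : E3) : Prop :=
  ∀ p, ⟪gaussCoord g e f N p, adCoord he f p v⟫ = 0

theorem IsTangent.invariantUnderFlow (hf : g.IsHSurface f N H) (hR : g.IsHPotential e H R)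
    (hnz : ∀ p, ¬ PotentialZeroAt R (g.sphereGaussMap e f N p)) (he : g.OrthonormalFrame e)
    {v : E3} (hv : IsTangent he f N v) :
    InvariantUnderFlow f (rightInvariantField (X := X) v) := by
  intro p
  set ψ := extChartAt (𝓡 2) p with hψ
  have hx₀ : ψ p ∈ ψ.target := mem_extChartAt_target p
  obtain ⟨W, hW, hWη⟩ := exists_contDiffAt_solution (hf.contDiffAt_chartDifferential he hx₀)
    ((hf.contDiffAt_adCoord he hx₀).clm_apply (contDiffAt_const (c := v)))
    (hf.injective_chartDifferential he hx₀)
  have hU : {x | x ∈ ψ.target ∧ mfderiv 𝓘(ℝ, E2) (𝓡 3) (fun y => f (ψ.symm y)) x (W x) =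
      rightInvariantField v (f (ψ.symm x))} ∈ 𝓝 (ψ p) := by
    filter_upwards [(isOpen_extChartAt_target p).mem_nhds hx₀, hWη] with x hx hWx
    refine ⟨hx, (chartDifferential_eq_adCoord_iff hf he hx _ _).1 ?_⟩
    obtain ⟨k, hk⟩ := ((hf.gaussChart hR hnz he p).data x hx).exists_preimage (hv (ψ.symm x))
    rw [hWx k hk, hk]
  obtain ⟨V, hV, ε, hε, α, hcont, hα⟩ :=
    exists_local_flow (hW.of_le (by norm_cast)) hU
  refine ⟨ψ.source ∩ ψ ⁻¹' V, inter_mem (extChartAt_source_mem_nhds p)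
    ((continuousAt_extChartAt p).preimage_mem_nhds hV), ε, hε, fun t q => ψ.symm (α (ψ q, t)),
    ?_, fun q hq => ?_, fun q hq t ht => ?_⟩
  · have h1 : ContinuousOn (fun z : ℝ × S => (ψ z.2, z.1)) (Ioo (-ε) ε ×ˢ (ψ.source ∩ ψ ⁻¹' V)) :=
      ((continuousOn_extChartAt p).comp continuousOn_snd (fun z hz => hz.2.1)).prodMk
        continuousOn_fst
    have h2 := hcont.comp h1 (fun z hz => ⟨hz.2.2, hz.1⟩)
    exact (continuousOn_extChartAt_symm p).comp h2
      (fun z hz => ((hα _ hz.2.2).2 _ hz.1).1.1)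
  · change ψ.symm (α (ψ q, 0)) = q
    rw [(hα _ hq.2).1, ψ.left_inv hq.1]
  · obtain ⟨⟨h1, h2⟩, h3⟩ := (hα _ hq.2).2 t ht
    have h4 := ((hf.contMDiffAt_chart h1).mdifferentiableAt (by simp)).hasMFDerivAt
    have h5 := HasMFDerivAt.comp t h4 h3.hasFDerivAt.hasMFDerivAt
    refine HasMFDerivAt.hasMFDerivWithinAt (h5.congr_mfderiv ?_)
    refine ContinuousLinearMap.ext_ring ?_
    refine (congrArg (mfderiv 𝓘(ℝ, E2) (𝓡 3) (fun y => f (ψ.symm y)) (α (ψ q, t)))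
      (one_smul ℝ (W (α (ψ q, t))))).trans (h2.trans ?_)
    exact (one_smul ℝ (rightInvariantField v (f (ψ.symm (α (ψ q, t)))) : E3)).symm

end LeftInvariantMetric

end Surface

/-- A continuous curve is differentiable if its image under an immersion is. -/
theorem exists_hasDerivAt_of_immersion {K : E2 → E3} {b : ℝ → E2} {m : E3}
    (hK : ContDiffAt ℝ ∞ K (b 0)) (hinj : Function.Injective (fderiv ℝ K (b 0)))
    (hb : ContinuousAt b 0) (hKb : HasDerivAt (fun t => K (b t)) m 0) :
    ∃ w, HasDerivAt b w 0 := by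
  obtain ⟨L, hL⟩ := LinearMap.exists_leftInverse_of_injective (fderiv ℝ K (b 0)).toLinearMap
    (LinearMap.ker_eq_bot.2 hinj)
  set L' : E3 →L[ℝ] E2 := L.toContinuousLinearMap with hL'
  have h1 : HasStrictFDerivAt (fun x => L' (K x))
      ((ContinuousLinearEquiv.refl ℝ E2 : E2 ≃L[ℝ] E2) : E2 →L[ℝ] E2) (b 0) := by
    refine (L'.hasStrictFDerivAt.comp (b 0) (hK.hasStrictFDerivAt (by simp))).congr_fderiv ?_
    ext1 u
    exact congrArg (fun M : E2 →ₗ[ℝ] E2 => M u) hL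
  have h2 : HasDerivAt (fun t => L' (K (b t))) (L' m) 0 :=
    L'.hasFDerivAt.comp_hasDerivAt (0 : ℝ) hKb
  have h3 := h1.to_localInverse.hasFDerivAt.comp_hasDerivAt (0 : ℝ) h2
  exact ⟨_, h3.congr_of_eventuallyEq
    ((hb.eventually h1.eventually_left_inverse).mono fun t ht => ht.symm)⟩

section Surface

set_option linter.unusedSectionVars false

variable {X : Type*} [TopologicalSpace X] [ChartedSpace E3 X] [Group X] [LieGroup (𝓡 3) ∞ X]
variable {S : Type*} [TopologicalSpace S] [ChartedSpace E2 S] [IsManifold (𝓡 2) ∞ S]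

namespace LeftInvariantMetric

variable {g : LeftInvariantMetric X} {e : Fin 3 → GroupLieAlgebra (𝓡 3) X}
  {f : S → X} {N : ∀ p, TangentSpace (𝓡 3) (f p)} {H : ℝ} {R : ℂ → ℂ}

/-- A right invariant field whose flow preserves the surface is tangent to it. -/
theorem isTangent_of_invariantUnderFlow (hf : g.IsHSurface f N H) (he : g.OrthonormalFrame e)
    {v : E3} (hv : InvariantUnderFlow f (rightInvariantField (X := X) v)) :
    IsTangent he f N v := by
  intro p
  obtain ⟨U, hU, ε, hε, Φ, hcont, hΦ0, hΦ⟩ := hv p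
  have hp := mem_of_mem_nhds hU
  have hI : Ioo (-ε) ε ∈ 𝓝 (0 : ℝ) := Ioo_mem_nhds (by linarith) hε
  set ψ := extChartAt (𝓡 2) p with hψ
  set φ := extChartAt (𝓡 3) (f p) with hφ
  have hx₀ : ψ p ∈ ψ.target := mem_extChartAt_target p
  have hψp : ψ.symm (ψ p) = p := extChartAt_to_inv p
  have hc : ContinuousAt (fun t => Φ t p) 0 := by
    have h1 : ContinuousOn (fun t : ℝ => Function.uncurry Φ (t, p)) (Ioo (-ε) ε) :=
      hcont.comp (by fun_prop) (fun t ht => ⟨ht, hp⟩)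
    exact h1.continuousAt hI
  set b : ℝ → E2 := fun t => ψ (Φ t p) with hb
  have hb0 : b 0 = ψ p := by rw [hb]; exact congrArg ψ (hΦ0 p hp)
  have hψc : ContinuousAt ψ (Φ 0 p) := by
    rw [hΦ0 p hp]; exact continuousAt_extChartAt p
  have hbc : ContinuousAt b 0 :=
    ContinuousAt.comp (f := fun t => Φ t p) (x := (0 : ℝ)) hψc hc
  have hsrc : ∀ᶠ t in 𝓝 (0 : ℝ), Φ t p ∈ ψ.source := by
    refine hc.eventually_mem ?_
    rw [hΦ0 p hp]
    exact extChartAt_source_mem_nhds p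
  have hfc : HasMFDerivAt 𝓘(ℝ, ℝ) (𝓡 3) (fun t => f (Φ t p)) 0
      ((1 : ℝ →L[ℝ] ℝ).smulRight (rightInvariantField v (f (Φ 0 p)))) :=
    (hΦ p hp 0 ⟨by linarith, hε⟩).hasMFDerivAt hI
  have hφ0 : f (Φ 0 p) ∈ (chartAt E3 (f p)).source := by
    rw [hΦ0 p hp]; exact mem_chart_source E3 (f p)
  have hfb : (fun t => f (ψ.symm (b t))) =ᶠ[𝓝 0] fun t => f (Φ t p) :=
    hsrc.mono fun t ht => congrArg f (ψ.left_inv ht)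
  have hF := hf.contMDiffAt_chart hx₀
  have hφF : ContMDiffAt (𝓡 3) 𝓘(ℝ, E3) ∞ φ (f (ψ.symm (ψ p))) :=
    contMDiffAt_extChartAt' (by rw [hψp]; exact mem_chart_source E3 (f p))
  have hK := ContMDiffAt.comp (ψ p) (g := φ) (f := fun y => f (ψ.symm y)) hφF hF
  -- `t ↦ Φ t p` is only assumed continuous; it is differentiable because its image under the
  -- immersion is
  obtain ⟨w, hw⟩ : ∃ w, HasDerivAt b w 0 := by
    have hKb : MDifferentiableAt 𝓘(ℝ, ℝ) 𝓘(ℝ, E3) (fun t => φ (f (Φ t p))) 0 :=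
      MDifferentiableAt.comp (0 : ℝ) (g := φ) (f := fun t => f (Φ t p))
        ((contMDiffAt_extChartAt' (n := ∞) hφ0).mdifferentiableAt (by simp))
        hfc.mdifferentiableAt
    have hKb' : DifferentiableAt ℝ (fun t => φ (f (ψ.symm (b t)))) 0 :=
      (mdifferentiableAt_iff_differentiableAt.1 hKb).congr_of_eventuallyEq
        (hfb.mono fun t ht => congrArg φ ht)
    refine exists_hasDerivAt_of_immersion (K := fun y => φ (f (ψ.symm y))) ?_ ?_ hbc
      hKb'.hasDerivAt
    · rw [hb0]; exact contMDiffAt_iff_contDiffAt.1 hK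
    · rw [hb0, ← mfderiv_eq_fderiv]
      intro u u' huu
      have h1 : ∀ u, mfderiv 𝓘(ℝ, E2) 𝓘(ℝ, E3) (fun y => φ (f (ψ.symm y))) (ψ p) u =
          mfderiv (𝓡 3) 𝓘(ℝ, E3) φ (f (ψ.symm (ψ p)))
            (mfderiv (𝓡 2) (𝓡 3) f (ψ.symm (ψ p))
              (mfderiv 𝓘(ℝ, E2) (𝓡 2) ψ.symm (ψ p) u)) := by
        intro u
        have h2 := mfderiv_comp_apply (I := 𝓘(ℝ, E2)) (I' := 𝓡 3) (I'' := 𝓘(ℝ, E3)) (ψ p)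
          (g := φ) (f := fun y => f (ψ.symm y)) (hφF.mdifferentiableAt (by simp))
          (hF.mdifferentiableAt (by simp)) u
        have h3 := mfderiv_comp_apply (I := 𝓘(ℝ, E2)) (I' := 𝓡 2) (I'' := 𝓡 3) (ψ p)
          (g := f) (f := ψ.symm) (hf.smooth.contMDiffAt.mdifferentiableAt (by simp))
          ((contMDiffAt_surface_chart_symm hx₀).mdifferentiableAt (by simp)) u
        exact h2.trans (congrArg _ h3)
      have huu' := (h1 u).symm.trans (huu.trans (h1 u'))
      have hinv := (isInvertible_mfderiv_extChartAt (I := 𝓡 3) (x := f p)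
        (y := f (ψ.symm (ψ p))) (by rw [hψp]; exact mem_extChartAt_source (f p))).injective
      exact (mfderiv_chart_symm_bijective hx₀).1 (hf.immersion _ (hinv huu'))
  have hF' : HasMFDerivAt 𝓘(ℝ, E2) (𝓡 3) (fun y => f (ψ.symm y)) (b 0)
      (mfderiv 𝓘(ℝ, E2) (𝓡 3) (fun y => f (ψ.symm y)) (b 0)) := by
    rw [hb0]; exact (hF.mdifferentiableAt (by simp)).hasMFDerivAt
  have h5 := (HasMFDerivAt.comp (0 : ℝ) hF' hw.hasFDerivAt.hasMFDerivAt).congr_of_eventuallyEq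
    hfb.symm
  have h6 := hasMFDerivAt_unique h5 hfc
  have h7 : mfderiv 𝓘(ℝ, E2) (𝓡 3) (fun y => f (ψ.symm y)) (b 0) w =
      rightInvariantField v (f (Φ 0 p)) := by
    have h8 := congrArg (fun T : ℝ →L[ℝ] E3 => T 1) h6
    refine Eq.trans ?_ (h8.trans (one_smul ℝ (rightInvariantField v (f (Φ 0 p)) : E3)))
    exact (congrArg (mfderiv 𝓘(ℝ, E2) (𝓡 3) (fun y => f (ψ.symm y)) (b 0))
      (one_smul ℝ w)).symm
  have h9 : mfderiv 𝓘(ℝ, E2) (𝓡 3) (fun y => f (ψ.symm y)) (ψ p) w =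
      rightInvariantField v (f (ψ.symm (ψ p))) := by
    have key : ∀ x q, x = ψ p → q = ψ.symm (ψ p) →
        (mfderiv 𝓘(ℝ, E2) (𝓡 3) (fun y => f (ψ.symm y)) x w : E3) =
          (rightInvariantField v (f q) : E3) →
        (mfderiv 𝓘(ℝ, E2) (𝓡 3) (fun y => f (ψ.symm y)) (ψ p) w : E3) =
          rightInvariantField v (f (ψ.symm (ψ p))) := by
      rintro _ _ rfl rfl h; exact h
    exact key (b 0) (Φ 0 p) hb0 ((hΦ0 p hp).trans hψp.symm) h7
  have h10 := (chartDifferential_eq_adCoord_iff hf he hx₀ w v).2 h9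
  have h11 := hf.inner_gaussCoord_chartDifferential he hx₀ w
  rw [h10] at h11
  rw [hψp] at h11
  exact h11

/-- A right invariant field tangent to the surface spans the kernel of the differential of the Gauss
map. -/
theorem IsTangent.exists_kernel (hf : g.IsHSurface f N H) (hR : g.IsHPotential e H R)
    (hnz : ∀ p, ¬ PotentialZeroAt R (g.sphereGaussMap e f N p)) {he : g.OrthonormalFrame e}
    {v : E3} (hv : IsTangent he f N v) {p₀ : S} {x : E2}
    (hx : x ∈ (extChartAt (𝓡 2) p₀).target) :
    ∃ k, chartDifferential he f p₀ x k = adCoord he f ((extChartAt (𝓡 2) p₀).symm x) v ∧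
      fderiv ℝ (fun y => gaussCoord g e f N ((extChartAt (𝓡 2) p₀).symm y)) x k = 0 := by
  have hG := hf.gaussChart hR hnz he p₀
  obtain ⟨k, hk⟩ := (hG.data x hx).exists_preimage (hv ((extChartAt (𝓡 2) p₀).symm x))
  have hA := (hf.contDiffAt_adCoord he hx).differentiableAt (by simp)
  refine ⟨k, hk, hG.fderiv_eq_zero_of_tangent hx (hA.clm_apply (differentiableAt_const v))
    (fun u => ?_) (Eventually.of_forall fun y => hv _) hk⟩
  rw [fderiv_clm_apply_const hA, hf.fderiv_adCoord he hx]

theorem adCoord_ne_zero (he : g.OrthonormalFrame e) (f : S → X) (p : S) {v : E3} (hv : v ≠ 0) :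
    adCoord he f p v ≠ 0 := fun h =>
  hv (injective_adCoord he f p (h.trans (map_zero _).symm))

theorem IsTangent.rankAt_le_one (hf : g.IsHSurface f N H) (hR : g.IsHPotential e H R)
    (hnz : ∀ p, ¬ PotentialZeroAt R (g.sphereGaussMap e f N p)) {he : g.OrthonormalFrame e}
    {v : E3} (hv : IsTangent he f N v) (hv0 : v ≠ 0) (p : S) :
    rankAt (g.sphereGaussMap e f N) p ≤ 1 := by
  have hx := mem_extChartAt_target (I := 𝓡 2) p
  obtain ⟨k, hk, hDk⟩ := hv.exists_kernel hf hR hnz hx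
  have h := (hf.rankAt_le_one_iff he hx).2 ⟨k, ?_, hDk⟩
  · rwa [extChartAt_to_inv] at h
  · rintro rfl
    rw [map_zero] at hk
    exact adCoord_ne_zero he f _ hv0 hk.symm

/-- The kernel of the differential of the Gauss map at `p` contains the direction of the right
invariant field with value `v` at the identity. -/
def IsKernelAt (he : g.OrthonormalFrame e) (f : S → X) (N : ∀ p, TangentSpace (𝓡 3) (f p))
    (v : E3) (p : S) : Prop :=
  ∃ w : TangentSpace (𝓡 2) p, mfderiv (𝓡 2) 𝓘(ℝ, E3) (gaussCoord g e f N) p w = 0 ∧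
    g.coord e (leftDifferential f p w) = adCoord he f p v

theorem isKernelAt_chart_iff (hf : g.IsHSurface f N H) (he : g.OrthonormalFrame e) (v : E3)
    {p₀ : S} {x : E2} (hx : x ∈ (extChartAt (𝓡 2) p₀).target) :
    IsKernelAt he f N v ((extChartAt (𝓡 2) p₀).symm x) ↔ ∃ k,
      fderiv ℝ (fun y => gaussCoord g e f N ((extChartAt (𝓡 2) p₀).symm y)) x k = 0 ∧
        chartDifferential he f p₀ x k = adCoord he f ((extChartAt (𝓡 2) p₀).symm x) v := by
  constructor
  · rintro ⟨w, h1, h2⟩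
    obtain ⟨k, rfl⟩ := (mfderiv_chart_symm_bijective hx).2 w
    exact ⟨k, (hf.fderiv_gaussCoord_eq_mfderiv he hx k).trans h1,
      (hf.chartDifferential_apply he hx k).trans h2⟩
  · rintro ⟨k, h1, h2⟩
    exact ⟨_, (hf.fderiv_gaussCoord_eq_mfderiv he hx k).symm.trans h1,
      (hf.chartDifferential_apply he hx k).symm.trans h2⟩

/-- As the differential of the Gauss map does not vanish, its kernel is at most a line. -/
theorem IsKernelAt.exists_smul (hf : g.IsHSurface f N H) (hR : g.IsHPotential e H R)
    (hnz : ∀ p, ¬ PotentialZeroAt R (g.sphereGaussMap e f N p)) {he : g.OrthonormalFrame e}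
    {v v' : E3} {p : S} (hv : IsKernelAt he f N v p) (hv0 : v ≠ 0) (hv' : IsKernelAt he f N v' p) :
    ∃ c : ℝ, v' = c • v := by
  have hx := mem_extChartAt_target (I := 𝓡 2) p
  rw [← extChartAt_to_inv (I := 𝓡 2) p, isKernelAt_chart_iff hf he _ hx] at hv hv'
  obtain ⟨k, hDk, hk⟩ := hv
  obtain ⟨k', hDk', hk'⟩ := hv'
  have hk0 : k ≠ 0 := by
    rintro rfl
    rw [map_zero] at hk
    exact adCoord_ne_zero he f _ hv0 hk.symm
  obtain ⟨c, hc⟩ := ((hf.gaussChart hR hnz he p).data _ hx).kernel_unique (coordBr_self he)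
    hk0 hDk hDk'
  refine ⟨c, injective_adCoord he f ((extChartAt (𝓡 2) p).symm (extChartAt (𝓡 2) p p)) ?_⟩
  rw [map_smul, ← hk, ← map_smul, ← hc]
  exact hk'.symm

theorem IsKernelAt.smul {he : g.OrthonormalFrame e} {v : E3} {p : S}
    (hv : IsKernelAt he f N v p) (c : ℝ) : IsKernelAt he f N (c • v) p := by
  obtain ⟨w, h1, h2⟩ := hv
  refine ⟨c • w, ?_, ?_⟩
  · rw [map_smul, h1]; exact smul_zero c
  · have h3 : leftDifferential f p (c • w) = (c • leftDifferential f p w : E3) := by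
      have h4 : mfderiv (𝓡 2) (𝓡 3) f p (c • w) = c • mfderiv (𝓡 2) (𝓡 3) f p w := map_smul _ _ _
      exact (congrArg (toLieAlgebra (f p)) h4).trans
        (map_smul (mfderiv (𝓡 3) (𝓡 3) (fun z : X => (f p)⁻¹ * z) (f p)) c _)
    exact (congrArg (g.coord e) h3).trans ((map_smul _ c _).trans
      ((congrArg (fun z : E3 => c • z) h2).trans (map_smul _ c v).symm))

theorem exists_isKernelAt_eventually (hf : g.IsHSurface f N H) (hR : g.IsHPotential e H R)
    (hnz : ∀ p, ¬ PotentialZeroAt R (g.sphereGaussMap e f N p)) (he : g.OrthonormalFrame e)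
    (hrank : ∀ p, rankAt (g.sphereGaussMap e f N) p ≤ 1) (p : S) :
    ∃ v : E3, v ≠ 0 ∧ ∀ᶠ q in 𝓝 p, IsKernelAt he f N v q := by
  have hx := mem_extChartAt_target (I := 𝓡 2) p
  obtain ⟨v, hv0, hv⟩ := (hf.gaussChart hR hnz he p).exists_parallel_kernel
    (A := fun x => adCoord he f ((extChartAt (𝓡 2) p).symm x))
    (fun x hx => hf.contDiffAt_adCoord he hx) (fun x _ => injective_adCoord he f _)
    (fun x hx u v => hf.fderiv_adCoord he hx u v)
    (fun x hx => (hf.rankAt_le_one_iff he hx).1 (hrank _)) hx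
  refine ⟨v, hv0, ?_⟩
  filter_upwards [extChartAt_source_mem_nhds (I := 𝓡 2) p,
    (continuousAt_extChartAt (I := 𝓡 2) p).eventually hv] with q hq hqv
  have h := (isKernelAt_chart_iff hf he v ((extChartAt (𝓡 2) p).map_source hq)).2 hqv
  rwa [(extChartAt (𝓡 2) p).left_inv hq] at h

/-- If the Gauss map has rank at most one, then some nonzero right invariant field is everywhere in
the kernel of its differential: such fields exist locally and are locally unique up to scaling. -/
theorem exists_isKernelAt [ConnectedSpace S] (hf : g.IsHSurface f N H)
    (hR : g.IsHPotential e H R)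
    (hnz : ∀ p, ¬ PotentialZeroAt R (g.sphereGaussMap e f N p)) (he : g.OrthonormalFrame e)
    (hrank : ∀ p, rankAt (g.sphereGaussMap e f N) p ≤ 1) :
    ∃ v : E3, v ≠ 0 ∧ ∀ p, IsKernelAt he f N v p := by
  obtain ⟨p⟩ := (inferInstance : Nonempty S)
  obtain ⟨v, hv0, hv⟩ := exists_isKernelAt_eventually hf hR hnz he hrank p
  have hloc : ∀ q, ∃ V ∈ 𝓝 q, ∀ r ∈ V, IsKernelAt he f N v r →
      ∀ s ∈ V, IsKernelAt he f N v s := by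
    intro q
    obtain ⟨v', hv0', hv'⟩ := exists_isKernelAt_eventually hf hR hnz he hrank q
    refine ⟨_, hv', fun r hr hrv s hs => ?_⟩
    obtain ⟨c, hc⟩ := IsKernelAt.exists_smul hf hR hnz hr hv0' hrv
    rw [hc]
    exact IsKernelAt.smul hs c
  have hclopen : IsClopen {q | IsKernelAt he f N v q} := by
    constructor
    · rw [← isOpen_compl_iff, isOpen_iff_mem_nhds]
      intro q hq
      obtain ⟨V, hV, h⟩ := hloc q
      filter_upwards [hV] with r hr hrv
      exact hq (h r hr hrv q (mem_of_mem_nhds hV))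
    · rw [isOpen_iff_mem_nhds]
      intro q hq
      obtain ⟨V, hV, h⟩ := hloc q
      filter_upwards [hV] with r hr
      exact h q (mem_of_mem_nhds hV) hq r hr
  have huniv := hclopen.eq_univ ⟨p, hv.self_of_nhds⟩
  refine ⟨v, hv0, fun q => ?_⟩
  have : q ∈ {q | IsKernelAt he f N v q} := huniv ▸ mem_univ q
  exact this

theorem IsKernelAt.inner_eq_zero (hf : g.IsHSurface f N H) {he : g.OrthonormalFrame e} {v : E3}
    {p : S} (hv : IsKernelAt he f N v p) : ⟪gaussCoord g e f N p, adCoord he f p v⟫ = 0 := by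
  obtain ⟨w, -, h⟩ := hv
  rw [← h]
  exact (inner_coord_toLieAlgebra he _ _ _).trans (hf.normal _ _)

end LeftInvariantMetric

end Surface

/-! ### Maps of rank one directed by an autonomous vector field -/

section RankOne

variable {F : Type*} [NormedAddCommGroup F] [NormedSpace ℝ F]

theorem exists_integralCurve_of_lipschitz_of_bounded [CompleteSpace F] {Z : F → F} {K L : ℝ≥0}
    (hZ : ContDiff ℝ 1 Z) (hK : LipschitzWith K Z) (hL : ∀ x, ‖Z x‖ ≤ L) (x : F) :
    ∃ c : ℝ → F, c 0 = x ∧ ∀ t, HasDerivAt c (Z (c t)) t := by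
  have hP : ∀ x₀ : F, IsPicardLindelof (fun _ => Z) (tmin := -1) (tmax := 1) ⟨0, by simp⟩ x₀ L 0
      L K := fun x₀ =>
    IsPicardLindelof.of_time_independent (fun x _ => hL x) hK.lipschitzOnWith (by simp)
  have hloc : ∀ x₀ : F, ∃ c : ℝ → F, c 0 = x₀ ∧
      IsMIntegralCurveOn (I := 𝓘(ℝ, F)) c (fun y => (Z y : TangentSpace 𝓘(ℝ, F) y))
        (Ioo (-1) 1) := by
    intro x₀
    obtain ⟨α, hα0, hα⟩ := (hP x₀).exists_eq_forall_mem_Icc_hasDerivWithinAt₀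
    exact ⟨α, hα0, fun t ht =>
      ((hα t (Ioo_subset_Icc_self ht)).mono Ioo_subset_Icc_self).hasFDerivWithinAt
        |>.hasMFDerivWithinAt⟩
  have hsec : ContMDiff 𝓘(ℝ, F) 𝓘(ℝ, F).tangent 1
      (fun y => (⟨y, Z y⟩ : TangentBundle 𝓘(ℝ, F) F)) :=
    contMDiff_vectorSpace_iff_contDiff.2 hZ
  obtain ⟨c, hc0, hc⟩ := exists_isMIntegralCurve_of_isMIntegralCurveOn hsec one_pos hloc x
  refine ⟨c, hc0, fun t => ?_⟩
  have h : HasFDerivAt c ((1 : ℝ →L[ℝ] ℝ).smulRight (Z (c t))) t :=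
    hasMFDerivAt_iff_hasFDerivAt.1 (hc t)
  simpa using h.hasDerivAt

theorem contDiff_integralCurve {Z : F → F} (hZ : ContDiff ℝ ∞ Z) {c : ℝ → F}
    (hc : ∀ t, HasDerivAt c (Z (c t)) t) : ContDiff ℝ ∞ c := by
  have hd : deriv c = fun t => Z (c t) := funext fun t => (hc t).deriv
  have hdiff : Differentiable ℝ c := fun t => (hc t).differentiableAt
  have h : ∀ n : ℕ, ContDiff ℝ n c := by
    intro n
    induction n with
    | zero => exact contDiff_zero.2 hdiff.continuous
    | succ n ih =>
      have h1 : ContDiff ℝ ((n : WithTop ℕ∞) + 1) c := by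
        rw [contDiff_succ_iff_deriv]
        refine ⟨hdiff, by simp, ?_⟩
        rw [hd]
        exact (hZ.of_le (by exact_mod_cast le_top)).comp ih
      exact_mod_cast h1
  exact contDiff_infty.2 h

/-- Along a segment, a map of rank one directed by the field `Z` follows the integral curves of `Z`:
in the derivative `θ ⊗ Z` of the map, the time `τ` is the integral of `θ` along the segment. The last
clause says in which direction the curve is followed, when `θ` has a constant sign on the segment. -/
theorem eq_integralCurve_of_segment {V : Type*} [NormedAddCommGroup V] [NormedSpace ℝ V]
    {Z : F → F} {K : ℝ≥0} (hK : LipschitzWith K Z) {c : ℝ → F}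
    (hc : ∀ t, HasDerivAt c (Z (c t)) t) {U : Set V} {Y : V → F} {θ : V → V →L[ℝ] ℝ}
    (hθ : ContinuousOn θ U) (hY : ∀ x ∈ U, HasFDerivAt Y ((θ x).smulRight (Z (Y x))) x)
    {x w : V} (hx : ∀ s ∈ Icc (0 : ℝ) 1, x + s • w ∈ U) {t : ℝ} (ht : c t = Y x) :
    ∃ τ : ℝ → ℝ, Continuous τ ∧ τ 0 = t ∧ (∀ s ∈ Icc (0 : ℝ) 1, Y (x + s • w) = c (τ s)) ∧
      ∀ ε : ℝ, (∀ s ∈ Icc (0 : ℝ) 1, 0 < ε * θ (x + s • w) w) → 0 < ε * (τ 1 - t) := by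
  set h : ℝ → ℝ := IccExtend (zero_le_one' ℝ) (fun s => θ (x + (s : ℝ) • w) w) with hh
  have hcont : Continuous h := by
    refine Continuous.Icc_extend' ?_
    have h1 : ContinuousOn (fun s : ℝ => θ (x + s • w)) (Icc 0 1) :=
      hθ.comp (by fun_prop) hx
    exact (h1.clm_apply continuousOn_const).comp_continuous continuous_subtype_val
      (fun s => s.2)
  have hval : ∀ s ∈ Icc (0 : ℝ) 1, h s = θ (x + s • w) w := fun s hs =>
    IccExtend_of_mem _ _ hs
  set τ : ℝ → ℝ := fun s => t + ∫ r in (0 : ℝ)..s, h r with hτ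
  have hτd : ∀ s, HasDerivAt τ (h s) s := fun s =>
    (hcont.integral_hasStrictDerivAt 0 s).hasDerivAt.const_add t
  have hτc : Continuous τ := continuous_iff_continuousAt.2 fun s => (hτd s).continuousAt
  have hτ0 : τ 0 = t := by simp [hτ]
  refine ⟨τ, hτc, hτ0, ?_, ?_⟩
  · obtain ⟨M, hM⟩ := isCompact_Icc.exists_bound_of_continuousOn
      (hcont.continuousOn (s := Icc (0 : ℝ) 1))
    have hM0 : 0 ≤ M := (norm_nonneg _).trans (hM 0 (by simp))
    have hYd : ∀ s ∈ Icc (0 : ℝ) 1,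
        HasDerivAt (fun s : ℝ => Y (x + s • w)) (h s • Z (Y (x + s • w))) s := by
      intro s hs
      have h1 : HasDerivAt (fun s : ℝ => x + s • w) w s := by
        simpa using ((hasDerivAt_id s).smul_const w).const_add x
      have h2 := (hY _ (hx s hs)).comp_hasDerivAt s h1
      rw [hval s hs]
      exact h2
    have hcd : ∀ s, HasDerivAt (fun s => c (τ s)) (h s • Z (c (τ s))) s := fun s =>
      (hc (τ s)).scomp s (hτd s)
    refine ODE_solution_unique_of_mem_Icc_right (v := fun s y => h s • Z y)
      (s := fun _ => univ) (K := M.toNNReal * K) ?_ ?_ ?_ (fun _ _ => mem_univ _) ?_ ?_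
      (fun _ _ => mem_univ _) ?_
    · intro s hs
      refine LipschitzOnWith.of_dist_le_mul fun y _ z _ => ?_
      rw [dist_eq_norm, ← smul_sub, norm_smul, ← dist_eq_norm, NNReal.coe_mul, mul_assoc,
        Real.coe_toNNReal M hM0]
      exact mul_le_mul (hM s (Ico_subset_Icc_self hs)) (hK.dist_le_mul y z) dist_nonneg hM0
    · exact fun s hs => (hYd s hs).continuousAt.continuousWithinAt
    · exact fun s hs => (hYd s (Ico_subset_Icc_self hs)).hasDerivWithinAt
    · exact fun s _ => (hcd s).continuousAt.continuousWithinAt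
    · exact fun s _ => (hcd s).hasDerivWithinAt
    · simp [hτ0, ht]
  · intro ε hpos
    have : 0 < ∫ r in (0 : ℝ)..1, ε * h r :=
      intervalIntegral.intervalIntegral_pos_of_pos_on
        ((continuous_const.mul hcont).intervalIntegrable 0 1)
        (fun s hs => by rw [hval s (Ioo_subset_Icc_self hs)]; exact hpos s (Ioo_subset_Icc_self hs))
        one_pos
    rw [intervalIntegral.integral_const_mul] at this
    simpa only [hτ, add_sub_cancel_left] using this

theorem exists_regular_parametrization {I : Set ℝ} (ho : IsOpen I) (hc : IsPreconnected I)
    (hne : I.Nonempty) :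
    ∃ ρ : ℝ → ℝ, ContDiff ℝ ∞ ρ ∧ (∀ t, deriv ρ t ≠ 0) ∧ range ρ = I := by
  have hmem := hc.mem_intervals
  simp only [mem_insert_iff, mem_singleton_iff] at hmem
  set a := sInf I
  set b := sSup I
  have hmax : ∀ x ∈ I, ∃ y ∈ I, x < y := by
    intro x hx
    obtain ⟨ε, hε, h⟩ := Metric.isOpen_iff.1 ho x hx
    refine ⟨x + ε / 2, h ?_, by linarith⟩
    rw [Metric.mem_ball, Real.dist_eq]
    rw [show x + ε / 2 - x = ε / 2 by ring, abs_of_pos (by linarith)]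
    linarith
  have hmin : ∀ x ∈ I, ∃ y ∈ I, y < x := by
    intro x hx
    obtain ⟨ε, hε, h⟩ := Metric.isOpen_iff.1 ho x hx
    refine ⟨x - ε / 2, h ?_, by linarith⟩
    rw [Metric.mem_ball, Real.dist_eq]
    rw [show x - ε / 2 - x = -(ε / 2) by ring, abs_neg, abs_of_pos (by linarith)]
    linarith
  obtain ⟨z, hz⟩ := hne
  rcases hmem with h | h | h | h | h | h | h | h | h | h
  · rw [h] at hz hmax
    obtain ⟨y, hy, hlt⟩ := hmax b ⟨hz.1.trans hz.2, le_rfl⟩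
    exact absurd hy.2 (not_le.2 hlt)
  · rw [h] at hz hmin
    obtain ⟨y, hy, hlt⟩ := hmin a ⟨le_rfl, hz.1.trans_lt hz.2⟩
    exact absurd hy.1 (not_le.2 hlt)
  · rw [h] at hz hmax
    obtain ⟨y, hy, hlt⟩ := hmax b ⟨hz.1.trans_le hz.2, le_rfl⟩
    exact absurd hy.2 (not_le.2 hlt)
  · rw [h] at hz ⊢
    have hab : 0 < b - a := by linarith [hz.1, hz.2]
    have hpi := Real.pi_pos
    have hd : ∀ t, HasDerivAt (fun t => a + (b - a) * (Real.arctan t / Real.pi + 1 / 2))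
        ((b - a) * (1 / (1 + t ^ 2) / Real.pi)) t := fun t =>
      ((((Real.hasDerivAt_arctan t).div_const _).add_const _).const_mul _).const_add _
    refine ⟨fun t => a + (b - a) * (Real.arctan t / Real.pi + 1 / 2), ?_, fun t => ?_, ?_⟩
    · have := Real.contDiff_arctan (n := ∞)
      fun_prop
    · rw [(hd t).deriv]; positivity
    · ext y
      constructor
      · rintro ⟨t, rfl⟩
        have h1 := Real.neg_pi_div_two_lt_arctan t
        have h2 := Real.arctan_lt_pi_div_two t
        have h3 : -(1 / 2) < Real.arctan t / Real.pi := by rw [lt_div_iff₀ hpi]; linarith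
        have h4 : Real.arctan t / Real.pi < 1 / 2 := by rw [div_lt_iff₀ hpi]; linarith
        constructor <;> simp only <;> nlinarith
      · rintro ⟨h1, h2⟩
        obtain ⟨t, ht⟩ : ∃ t, Real.arctan t = Real.pi * ((y - a) / (b - a) - 1 / 2) := by
          have : Real.pi * ((y - a) / (b - a) - 1 / 2) ∈ range Real.arctan := by
            rw [Real.range_arctan]
            have h3 : 0 < (y - a) / (b - a) := div_pos (by linarith) hab
            have h4 : (y - a) / (b - a) < 1 := by rw [div_lt_one hab]; linarith
            constructor <;> nlinarith
          exact this
        refine ⟨t, ?_⟩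
        simp only [ht]
        field_simp
        ring
  · rw [h] at hz hmin
    obtain ⟨y, hy, hlt⟩ := hmin a self_mem_Ici
    exact absurd hy (not_le.2 hlt)
  · rw [h]
    refine ⟨fun t => a + Real.exp t, by fun_prop, fun t => ?_, ?_⟩
    · rw [((Real.hasDerivAt_exp t).const_add a).deriv]; positivity
    · ext y
      constructor
      · rintro ⟨t, rfl⟩
        have := Real.exp_pos t
        simp only [mem_Ioi]; linarith
      · intro hy
        refine ⟨Real.log (y - a), ?_⟩
        simp only [mem_Ioi] at hy
        simp only [Real.exp_log (sub_pos.2 hy)]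
        ring
  · rw [h] at hz hmax
    obtain ⟨y, hy, hlt⟩ := hmax b self_mem_Iic
    exact absurd hy (not_le.2 hlt)
  · rw [h]
    refine ⟨fun t => b - Real.exp t, by fun_prop, fun t => ?_, ?_⟩
    · rw [((Real.hasDerivAt_exp t).const_sub b).deriv]
      exact neg_ne_zero.2 (Real.exp_pos t).ne'
    · ext y
      constructor
      · rintro ⟨t, rfl⟩
        have := Real.exp_pos t
        simp only [mem_Iio]; linarith
      · intro hy
        refine ⟨Real.log (b - y), ?_⟩
        simp only [mem_Iio] at hy
        simp only [Real.exp_log (sub_pos.2 hy)]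
        ring
  · rw [h]
    exact ⟨id, contDiff_id, fun t => by simp, range_id⟩
  · rw [h] at hz
    exact absurd hz (notMem_empty z)

end RankOne

section RankOne

variable {F : Type*} [NormedAddCommGroup F] [NormedSpace ℝ F]

/-- The image of a connected surface under a map of rank one directed by the field `Z` is an open arc
of an integral curve of `Z`. The curve may be periodic, and a priori the set of all times at which it
meets the image may be disconnected, so the arc is the component of that set containing time zero. -/
theorem exists_image_integralCurve_eq_range {S : Type*} [TopologicalSpace S] [ChartedSpace E2 S]
    [ConnectedSpace S] {Z : F → F} {K : ℝ≥0} (hK : LipschitzWith K Z) {c : ℝ → F}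
    (hc : ∀ t, HasDerivAt c (Z (c t)) t) {Ψ : S → F} {p₁ : S} (hc0 : c 0 = Ψ p₁)
    (hΨ : ∀ p₀ : S, ∃ θ : E2 → E2 →L[ℝ] ℝ, ContinuousOn θ (extChartAt (𝓡 2) p₀).target ∧
      ∀ x ∈ (extChartAt (𝓡 2) p₀).target, θ x ≠ 0 ∧
        HasFDerivAt (fun y => Ψ ((extChartAt (𝓡 2) p₀).symm y))
          ((θ x).smulRight (Z (Ψ ((extChartAt (𝓡 2) p₀).symm x)))) x) :
    ∃ I : Set ℝ, IsOpen I ∧ IsPreconnected I ∧ I.Nonempty ∧ c '' I = range Ψ := by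
  set J : Set ℝ := c ⁻¹' range Ψ with hJ
  have h0J : (0 : ℝ) ∈ J := ⟨p₁, hc0.symm⟩
  have hJo : IsOpen J := by
    rw [isOpen_iff_mem_nhds]
    rintro t ⟨p, hp⟩
    obtain ⟨θ, hθ, hΨ'⟩ := hΨ p
    set ψ := extChartAt (𝓡 2) p with hψ
    have hx₀ : ψ p ∈ ψ.target := mem_extChartAt_target p
    have htar : ψ.target ∈ 𝓝 (ψ p) := (isOpen_extChartAt_target (I := 𝓡 2) p).mem_nhds hx₀
    obtain ⟨w, hw⟩ : ∃ w, 0 < θ (ψ p) w := by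
      obtain ⟨w, hw⟩ : ∃ w, θ (ψ p) w ≠ 0 := by
        by_contra! h
        exact (hΨ' _ hx₀).1 (ContinuousLinearMap.ext h)
      rcases hw.lt_or_gt with h | h
      · exact ⟨-w, by rw [map_neg]; linarith⟩
      · exact ⟨w, h⟩
    have hev : ∀ᶠ s : ℝ in 𝓝 0, ψ p + s • w ∈ ψ.target ∧ 0 < θ (ψ p + s • w) w := by
      have h1 : Tendsto (fun s : ℝ => ψ p + s • w) (𝓝 0) (𝓝 (ψ p)) := by
        have h : ContinuousAt (fun s : ℝ => ψ p + s • w) 0 := by fun_prop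
        simpa using h.tendsto
      have h2 : ∀ᶠ x in 𝓝 (ψ p), x ∈ ψ.target ∧ 0 < θ x w := by
        refine Filter.Eventually.and htar ?_
        have h3 : ContinuousAt (fun x => θ x w) (ψ p) :=
          (hθ.continuousAt htar).clm_apply continuousAt_const
        exact h3.eventually (lt_mem_nhds hw)
      exact h1.eventually h2
    obtain ⟨δ, hδ, hball⟩ := Metric.eventually_nhds_iff_ball.1 hev
    -- the curve is followed forwards or backwards along `ε • w`, according to the sign of `ε`
    have hseg : ∀ ε : ℝ, |ε| = δ / 2 → ∃ t', 0 < ε * (t' - t) ∧ uIcc t t' ⊆ J := by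
      intro ε hε
      have hs : ∀ s ∈ Icc (0 : ℝ) 1, s * ε ∈ Metric.ball (0 : ℝ) δ := by
        intro s hs
        rw [mem_ball_zero_iff, Real.norm_eq_abs, abs_mul, hε, abs_of_nonneg hs.1]
        nlinarith [hs.2]
      obtain ⟨τ, hτc, hτ0, hτ, hpos⟩ := eq_integralCurve_of_segment hK hc hθ
        (fun x hx => (hΨ' x hx).2) (x := ψ p) (w := ε • w)
        (fun s hs' => by rw [smul_smul]; exact (hball _ (hs s hs')).1) (t := t)
        (by rw [extChartAt_to_inv]; exact hp.symm)
      refine ⟨τ 1, hpos ε fun s hs' => ?_, ?_⟩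
      · rw [map_smul, smul_smul, smul_eq_mul, ← mul_assoc]
        have hε0 : ε ≠ 0 := by
          rintro rfl
          rw [abs_zero] at hε
          linarith
        exact mul_pos (mul_self_pos.2 hε0) (hball _ (hs s hs')).2
      · have h1 := intermediate_value_uIcc (f := τ) (a := 0) (b := 1) hτc.continuousOn
        rw [hτ0, uIcc_of_le (zero_le_one' ℝ)] at h1
        intro r hr
        obtain ⟨s, hs', rfl⟩ := h1 hr
        exact ⟨_, hτ s hs'⟩
    obtain ⟨t₁, h1, h1J⟩ := hseg (δ / 2) (abs_of_pos (by linarith))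
    obtain ⟨t₂, h2, h2J⟩ := hseg (-(δ / 2)) (by rw [abs_neg]; exact abs_of_pos (by linarith))
    have h1' : t < t₁ := by
      have := pos_of_mul_pos_right h1 (by linarith : (0 : ℝ) ≤ δ / 2)
      linarith
    have h2' : t₂ < t := by
      have := pos_of_mul_pos_right (by linarith : 0 < (δ / 2) * (t - t₂))
        (by linarith : (0 : ℝ) ≤ δ / 2)
      linarith
    rw [uIcc_of_le h1'.le] at h1J
    rw [uIcc_of_ge h2'.le] at h2J
    refine mem_of_superset (Icc_mem_nhds h2' h1') ?_
    rw [← Icc_union_Icc_eq_Icc h2'.le h1'.le]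
    exact union_subset h2J h1J
  set I := connectedComponentIn J 0 with hI
  -- the points on the arc form an open and closed set: two points of a small ball are joined by a
  -- segment, along which the time varies continuously within the component
  have hloc : ∀ p₀ : S, ∃ V ∈ 𝓝 p₀, ∀ p ∈ V, (∃ t ∈ I, c t = Ψ p) →
      ∀ q ∈ V, ∃ t ∈ I, c t = Ψ q := by
    intro p₀
    obtain ⟨θ, hθ, hΨ'⟩ := hΨ p₀
    set ψ := extChartAt (𝓡 2) p₀ with hψ
    have hx₀ : ψ p₀ ∈ ψ.target := mem_extChartAt_target p₀
    obtain ⟨r, hr, hball⟩ := Metric.isOpen_iff.1 (isOpen_extChartAt_target (I := 𝓡 2) p₀) _ hx₀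
    refine ⟨ψ.source ∩ ψ ⁻¹' Metric.ball (ψ p₀) r, inter_mem (extChartAt_source_mem_nhds p₀)
      ((continuousAt_extChartAt p₀).preimage_mem_nhds (Metric.ball_mem_nhds _ hr)), ?_⟩
    rintro p ⟨hp, hpb⟩ ⟨t, htI, ht⟩ q ⟨hq, hqb⟩
    obtain ⟨τ, hτc, hτ0, hτ, -⟩ := eq_integralCurve_of_segment hK hc hθ
      (fun x hx => (hΨ' x hx).2) (x := ψ p) (w := ψ q - ψ p)
      (fun s hs => hball ((convex_ball (ψ p₀) r).add_smul_sub_mem hpb hqb hs)) (t := t)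
      (by rw [ψ.left_inv hp]; exact ht)
    refine ⟨τ 1, ?_, ?_⟩
    · have hpre : IsPreconnected (τ '' Icc (0 : ℝ) 1) :=
        isPreconnected_Icc.image _ hτc.continuousOn
      have ht' : t ∈ τ '' Icc (0 : ℝ) 1 := ⟨0, by simp, hτ0⟩
      have hsub : τ '' Icc (0 : ℝ) 1 ⊆ J := by
        rintro _ ⟨s, hs, rfl⟩
        exact ⟨_, hτ s hs⟩
      have h1 := hpre.subset_connectedComponentIn ht' hsub
      rw [← connectedComponentIn_eq htI] at h1
      exact h1 ⟨1, by simp, rfl⟩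
    · have h1 := hτ 1 (by simp)
      rw [one_smul, add_sub_cancel, ψ.left_inv hq] at h1
      exact h1.symm
  have hclopen : IsClopen {p | ∃ t ∈ I, c t = Ψ p} := by
    constructor
    · rw [← isOpen_compl_iff, isOpen_iff_mem_nhds]
      intro q hq
      obtain ⟨V, hV, h⟩ := hloc q
      filter_upwards [hV] with r hr hrv
      exact hq (h r hr hrv q (mem_of_mem_nhds hV))
    · rw [isOpen_iff_mem_nhds]
      intro q hq
      obtain ⟨V, hV, h⟩ := hloc q
      filter_upwards [hV] with r hr
      exact h q (mem_of_mem_nhds hV) hq r hr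
  have huniv := hclopen.eq_univ ⟨p₁, 0, mem_connectedComponentIn h0J, hc0⟩
  refine ⟨I, hJo.connectedComponentIn, isPreconnected_connectedComponentIn,
    ⟨0, mem_connectedComponentIn h0J⟩, ?_⟩
  apply Subset.antisymm
  · rintro _ ⟨t, ht, rfl⟩
    exact connectedComponentIn_subset J 0 ht
  · rintro _ ⟨p, rfl⟩
    have hp : p ∈ {p | ∃ t ∈ I, c t = Ψ p} := huniv ▸ mem_univ p
    obtain ⟨t, ht, h⟩ := hp
    exact ⟨t, ht, h⟩

end RankOne

/-! ### The image of a Gauss map of rank one -/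

/-- The vector field on pairs `(G, κ)` along which the Gauss map `G` of rank one and the unit vector
`κ` spanning the kernel of its differential move. -/
def gaussField (br : E3 →ₗ[ℝ] E3 →ₗ[ℝ] E3) (H : ℝ) (z : E3 × E3) : E3 × E3 :=
  (gaussVelocity br H z.1 z.2, br z.2 (cross z.1 z.2) - ⟪z.2, br z.2 (cross z.1 z.2)⟫ • z.2)

theorem contDiff_gaussField (br : E3 →ₗ[ℝ] E3 →ₗ[ℝ] E3) (H : ℝ) :
    ContDiff ℝ ∞ (gaussField br H) := by
  have hbr : ContDiff ℝ ∞ (fun z : E3 × E3 => br z.2 (cross z.1 z.2)) := by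
    have h1 : ContDiff ℝ ∞ (fun x : E3 => (br x).toContinuousLinearMap) :=
      (LinearMap.toContinuousLinearMap.toLinearMap ∘ₗ br).toContinuousLinearMap.contDiff
    exact (h1.comp contDiff_snd).clm_apply contDiff_cross
  have hs := (contDiff_skewPart br).comp (contDiff_fst (E := E3) (F := E3))
  have ht := (contDiff_tracePart br H).comp (contDiff_fst (E := E3) (F := E3))
  exact ((hs.neg.smul contDiff_snd).add (ht.smul contDiff_cross)).prodMk
    (hbr.sub ((contDiff_snd.inner ℝ hbr).smul contDiff_snd))

/-- A smooth field coincides on a given ball with a complete field, Lipschitz and bounded. -/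
theorem exists_cutoff {Z : E3 × E3 → E3 × E3} (hZ : ContDiff ℝ ∞ Z) :
    ∃ (Z' : E3 × E3 → E3 × E3) (K L : ℝ≥0), ContDiff ℝ ∞ Z' ∧ LipschitzWith K Z' ∧
      (∀ z, ‖Z' z‖ ≤ L) ∧ ∀ z, ‖z‖ ≤ 1 → Z' z = Z z := by
  let χ : ContDiffBump (0 : E3 × E3) := ⟨1, 2, one_pos, one_lt_two⟩
  have hZ' : ContDiff ℝ ∞ (fun z => χ z • Z z) := χ.contDiff.smul hZ
  have hc : HasCompactSupport (fun z => χ z • Z z) := χ.hasCompactSupport.smul_right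
  obtain ⟨K, hK⟩ := ContDiff.lipschitzWith_of_hasCompactSupport hc hZ' (by simp)
  obtain ⟨C, hC⟩ := hZ'.continuous.bounded_above_of_compact_support hc
  refine ⟨_, K, C.toNNReal, hZ', hK, fun z => (hC z).trans (Real.le_coe_toNNReal C),
    fun z hz => ?_⟩
  rw [χ.one_of_mem_closedBall (by simpa using hz), one_smul]

/-- In a chart, the Gauss map of rank one and the unit vector spanning the kernel of its differential
move along `gaussField`. -/
theorem GaussChart.hasFDerivAt_pair {br : E3 →ₗ[ℝ] E3 →ₗ[ℝ] E3} {H : ℝ} {U : Set E2}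
    {G : E2 → E3} {η : E2 → E2 →L[ℝ] E3} (h : GaussChart br H U G η) {f : E2 → E3} {x : E2}
    (hx : x ∈ U) (hf : ContDiffAt ℝ ∞ f x) (hf0 : ∀ y, f y ≠ 0)
    (hD : ∀ u, fderiv ℝ f x u = -br (η x u) (f x)) (hT : ⟪G x, f x⟫ = 0) {k : E2}
    (hk : η x k = f x) (hDk : fderiv ℝ G x k = 0) :
    HasFDerivAt (fun y => (G y, ‖f y‖⁻¹ • f y))
      (((innerSL ℝ (cross (G x) (‖f x‖⁻¹ • f x))).comp (η x)).smulRight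
        (gaussField br H (G x, ‖f x‖⁻¹ • f x))) x := by
  have hdat := h.data x hx
  have hfd := hf.differentiableAt (by simp)
  have hGd := (h.smooth_G x hx).differentiableAt (by simp)
  have hnd : DifferentiableAt ℝ (fun y => ‖f y‖) x := hfd.norm ℝ (hf0 x)
  have hn0 : ∀ y, ‖f y‖ ≠ 0 := fun y => norm_ne_zero_iff.2 (hf0 y)
  set κ : E2 → E3 := fun y => ‖f y‖⁻¹ • f y with hκ
  have hκd : DifferentiableAt ℝ κ x := (hnd.inv (hn0 x)).smul hfd
  have hκ1 : ∀ y, ⟪κ y, κ y⟫ = 1 := fun y => by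
    have := hn0 y
    simp only [hκ]
    rw [real_inner_smul_left, real_inner_smul_right, real_inner_self_eq_norm_sq]
    field_simp
  have hfκ : ∀ y, ‖f y‖ • κ y = f y := fun y => smul_inv_smul₀ (hn0 y) _
  have hfr : IsFrame (G x) (κ x) := ⟨hdat.unit, hκ1 x, by
    simp only [hκ]; rw [real_inner_smul_right, hT, mul_zero]⟩
  have hG := hdat.apply_eq h.br_self hfr (k := ‖f x‖⁻¹ • k) (by rw [map_smul, hk])
    (by rw [map_smul, hDk, smul_zero])
  have hκD : ∀ u, fderiv ℝ κ x u = ⟪cross (G x) (κ x), η x u⟫ •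
      (br (κ x) (cross (G x) (κ x)) - ⟪κ x, br (κ x) (cross (G x) (κ x))⟫ • κ x) := by
    intro u
    have h1 : HasFDerivAt f _ x := (hnd.hasFDerivAt.smul hκd.hasFDerivAt).congr_of_eventuallyEq
      (Eventually.of_forall fun y => (hfκ y).symm)
    have h2 := congrArg (fun L : E2 →L[ℝ] E3 => L u) h1.fderiv
    simp only [add_apply, smul_apply, ContinuousLinearMap.smulRight_apply] at h2
    have h3 := GaussChart.fderiv_inner_eq hκd hκd (Eventually.of_forall hκ1) u
    rw [real_inner_comm (κ x) (fderiv ℝ κ x u)] at h3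
    have h3' : ⟪κ x, fderiv ℝ κ x u⟫ = 0 := by linarith
    have h4 : fderiv ℝ f x u = ‖f x‖ • ⟪cross (G x) (κ x), η x u⟫ •
        br (κ x) (cross (G x) (κ x)) := by
      have h5 := hfr.expand_tangent (hdat.normal u)
      have h6 : br (η x u) (f x) = ‖f x‖ • br (η x u) (κ x) :=
        (congrArg (br (η x u)) (hfκ x).symm).trans (map_smul _ _ _)
      rw [hD, h6]
      conv_lhs => rw [h5]
      simp only [map_add, map_smul, LinearMap.add_apply, LinearMap.smul_apply, h.br_self,
        br_swap h.br_self (κ x) (cross (G x) (κ x))]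
      module
    rw [h4] at h2
    have h6 := congrArg (fun z => ⟪κ x, z⟫) h2
    simp only [inner_add_right, real_inner_smul_right, hκ1, h3', mul_zero, zero_add, mul_one]
      at h6
    rw [← h6] at h2
    have h7 : ‖f x‖ • fderiv ℝ κ x u = ‖f x‖ • (⟪cross (G x) (κ x), η x u⟫ •
        (br (κ x) (cross (G x) (κ x)) - ⟪κ x, br (κ x) (cross (G x) (κ x))⟫ • κ x)) := by
      rw [← sub_eq_iff_eq_add.2 h2]
      module
    exact smul_right_injective _ (hn0 x) h7
  refine (hGd.hasFDerivAt.prodMk hκd.hasFDerivAt).congr_fderiv ?_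
  ext1 u
  exact Prod.ext (hG u) (hκD u)

section Surface

set_option linter.unusedSectionVars false

variable {X : Type*} [TopologicalSpace X] [ChartedSpace E3 X] [Group X] [LieGroup (𝓡 3) ∞ X]
variable {S : Type*} [TopologicalSpace S] [ChartedSpace E2 S] [IsManifold (𝓡 2) ∞ S]

namespace LeftInvariantMetric

variable {g : LeftInvariantMetric X} {e : Fin 3 → GroupLieAlgebra (𝓡 3) X}
  {f : S → X} {N : ∀ p, TangentSpace (𝓡 3) (f p)} {H : ℝ} {R : ℂ → ℂ}

/-- The Gauss map together with the normalized tangent field, of a surface tangent to the right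
invariant field with value `v` at the identity. -/
def gaussPair (he : g.OrthonormalFrame e) (f : S → X) (N : ∀ p, TangentSpace (𝓡 3) (f p)) (v : E3)
    (p : S) : E3 × E3 :=
  (gaussCoord g e f N p, ‖adCoord he f p v‖⁻¹ • adCoord he f p v)

theorem IsTangent.isFrame_gaussPair (hf : g.IsHSurface f N H) {he : g.OrthonormalFrame e}
    {v : E3} (hv : IsTangent he f N v) (hv0 : v ≠ 0) (p : S) :
    IsFrame (gaussPair he f N v p).1 (gaussPair he f N v p).2 := by
  have hn : ‖adCoord he f p v‖ ≠ 0 := norm_ne_zero_iff.2 (adCoord_ne_zero he f p hv0)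
  refine ⟨inner_gaussCoord_self hf he p, ?_, ?_⟩
  · simp only [gaussPair]
    rw [real_inner_smul_left, real_inner_smul_right, real_inner_self_eq_norm_sq]
    field_simp
  · simp only [gaussPair]
    rw [real_inner_smul_right, hv p, mul_zero]

theorem IsTangent.norm_gaussPair_le (hf : g.IsHSurface f N H) {he : g.OrthonormalFrame e}
    {v : E3} (hv : IsTangent he f N v) (hv0 : v ≠ 0) (p : S) : ‖gaussPair he f N v p‖ ≤ 1 := by
  have h := hv.isFrame_gaussPair hf hv0 p
  have h1 : ∀ x : E3, ⟪x, x⟫ = 1 → ‖x‖ = 1 := fun x hx => by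
    rw [real_inner_self_eq_norm_sq] at hx
    exact (pow_eq_one_iff_of_nonneg (norm_nonneg _) two_ne_zero).1 hx
  rw [Prod.norm_def, h1 _ h.unit_left, h1 _ h.unit_right, max_self]

theorem IsTangent.exists_hasFDerivAt_gaussPair (hf : g.IsHSurface f N H)
    (hR : g.IsHPotential e H R)
    (hnz : ∀ p, ¬ PotentialZeroAt R (g.sphereGaussMap e f N p)) {he : g.OrthonormalFrame e}
    {v : E3} (hv : IsTangent he f N v) (hv0 : v ≠ 0) (p₀ : S) :
    ∃ θ : E2 → E2 →L[ℝ] ℝ, ContinuousOn θ (extChartAt (𝓡 2) p₀).target ∧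
      ∀ x ∈ (extChartAt (𝓡 2) p₀).target, θ x ≠ 0 ∧
        HasFDerivAt (fun y => gaussPair he f N v ((extChartAt (𝓡 2) p₀).symm y))
          ((θ x).smulRight (gaussField (coordBr he) H
            (gaussPair he f N v ((extChartAt (𝓡 2) p₀).symm x)))) x := by
  have hchart := hf.gaussChart hR hnz he p₀
  have hder : ∀ x ∈ (extChartAt (𝓡 2) p₀).target,
      HasFDerivAt (fun y => gaussPair he f N v ((extChartAt (𝓡 2) p₀).symm y))
        (((innerSL ℝ (cross (gaussPair he f N v ((extChartAt (𝓡 2) p₀).symm x)).1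
          (gaussPair he f N v ((extChartAt (𝓡 2) p₀).symm x)).2)).comp
            (chartDifferential he f p₀ x)).smulRight (gaussField (coordBr he) H
            (gaussPair he f N v ((extChartAt (𝓡 2) p₀).symm x)))) x := by
    intro x hx
    obtain ⟨k, hk, hDk⟩ := hv.exists_kernel hf hR hnz hx
    have hA := hf.contDiffAt_adCoord he hx
    refine hchart.hasFDerivAt_pair hx (hA.clm_apply contDiffAt_const)
      (fun y => adCoord_ne_zero he f _ hv0) (fun u => ?_) (hv _) hk hDk
    rw [fderiv_clm_apply_const (hA.differentiableAt (by simp)), hf.fderiv_adCoord he hx]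
  refine ⟨_, fun x hx => ?_, fun x hx => ⟨?_, hder x hx⟩⟩
  · have h1 := contDiff_cross.continuous.continuousAt.comp (hder x hx).continuousAt
    have h2 := ((innerSL ℝ (E := E3)).continuous.continuousAt.comp h1).clm_comp
      (hf.contDiffAt_chartDifferential he hx).continuousAt
    exact h2.continuousWithinAt
  · intro h0
    obtain ⟨u, hu⟩ := (hchart.data x hx).exists_preimage
      (inner_cross_left _ (gaussPair he f N v ((extChartAt (𝓡 2) p₀).symm x)).2)
    have h1 := congrArg (fun L : E2 →L[ℝ] ℝ => L u) h0
    simp only [ContinuousLinearMap.comp_apply, innerSL_apply_apply, zero_apply] at h1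
    rw [hu] at h1
    have h2 := (hv.isFrame_gaussPair hf hv0 ((extChartAt (𝓡 2) p₀).symm x)).inner_cross_self_eq_one
    exact one_ne_zero (h2.symm.trans h1)

/-- If a right invariant field is tangent to the surface, then the image of the Gauss map is a regular
curve: it is the projection of an arc of an integral curve of `gaussField`. -/
theorem IsTangent.isRegularCurve [ConnectedSpace S] (hf : g.IsHSurface f N H)
    (hR : g.IsHPotential e H R)
    (hnz : ∀ p, ¬ PotentialZeroAt R (g.sphereGaussMap e f N p)) {he : g.OrthonormalFrame e}
    {v : E3} (hv : IsTangent he f N v) (hv0 : v ≠ 0) :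
    IsRegularCurve (range (g.sphereGaussMap e f N)) := by
  obtain ⟨p₁⟩ := (inferInstance : Nonempty S)
  obtain ⟨Z, K, L, hZ, hK, hL, hZeq⟩ := exists_cutoff (contDiff_gaussField (coordBr he) H)
  have hZΨ : ∀ p, Z (gaussPair he f N v p) = gaussField (coordBr he) H (gaussPair he f N v p) :=
    fun p => hZeq _ (hv.norm_gaussPair_le hf hv0 p)
  obtain ⟨c, hc0, hc⟩ := exists_integralCurve_of_lipschitz_of_bounded (hZ.of_le (by norm_cast))
    hK hL (gaussPair he f N v p₁)
  obtain ⟨I, hIo, hIc, hIne, hI⟩ := exists_image_integralCurve_eq_range hK hc hc0 (fun p₀ => by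
    obtain ⟨θ, hθ, h⟩ := hv.exists_hasFDerivAt_gaussPair hf hR hnz hv0 p₀
    refine ⟨θ, hθ, fun x hx => ?_⟩
    rw [hZΨ]
    exact h x hx)
  obtain ⟨ρ, hρ, hρ', hρI⟩ := exists_regular_parametrization hIo hIc hIne
  have hmem : ∀ r, ∃ p, gaussPair he f N v p = c (ρ r) := fun r => by
    have h1 : c (ρ r) ∈ c '' I := mem_image_of_mem c (hρI ▸ mem_range_self r)
    rw [hI] at h1
    exact h1
  have hunit : ∀ r, ⟪(c (ρ r)).1, (c (ρ r)).1⟫ = 1 := fun r => by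
    obtain ⟨p, hp⟩ := hmem r
    rw [← hp]
    exact inner_gaussCoord_self hf he p
  have hsm : ContDiff ℝ ∞ (fun r => (c (ρ r)).1) :=
    contDiff_fst.comp ((contDiff_integralCurve hZ hc).comp hρ)
  refine ⟨fun r => stereo (c (ρ r)).1, fun r =>
    contMDiffAt_stereo_comp hsm.contMDiff.contMDiffAt hunit, fun r h0 => ?_, ?_⟩
  · have h1 := (mfderiv_stereo_comp_eq_zero_iff hsm.contMDiff.contMDiffAt hunit (1 : ℝ)).1
      (congrArg (fun T : ℝ →L[ℝ] ℂ => T 1) h0)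
    rw [mfderiv_eq_fderiv] at h1
    have hρd : HasDerivAt ρ (deriv ρ r) r := (hρ.differentiable (by simp) r).hasDerivAt
    have h2 : HasDerivAt (fun r => (c (ρ r)).1) (deriv ρ r • (Z (c (ρ r))).1) r :=
      ((ContinuousLinearMap.fst ℝ E3 E3).hasFDerivAt.comp_hasDerivAt r
        ((hc (ρ r)).scomp r hρd)).congr_deriv (by simp)
    have h3 : deriv ρ r • (Z (c (ρ r))).1 = 0 := h2.deriv.symm.trans (fderiv_apply_one_eq_deriv.symm.trans h1)
    obtain ⟨p, hp⟩ := hmem r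
    rw [← hp, hZΨ] at h3
    have hx := mem_extChartAt_target (I := 𝓡 2) p
    have h4 := ((hf.gaussChart hR hnz he p).data _ hx)
    rw [extChartAt_to_inv] at h4
    exact h4.velocity_ne_zero (hv.isFrame_gaussPair hf hv0 p)
      ((smul_eq_zero.1 h3).resolve_left (hρ' r))
  · have h1 : range (fun r => stereo (c (ρ r)).1) = (fun z : E3 × E3 => stereo z.1) '' (c '' I) := by
      rw [← hρI, ← range_comp, ← range_comp]
      rfl
    rw [h1, hI, ← range_comp]
    rfl

end LeftInvariantMetric

end Surface

end

theorem mainTheorem8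
    {X : Type*} [TopologicalSpace X] [ChartedSpace E3 X] [Group X] [LieGroup (𝓡 3) ∞ X]
    [T2Space X] [SimplyConnectedSpace X]
    (g : LeftInvariantMetric X)
    {S : Type*} [TopologicalSpace S] [ChartedSpace E2 S] [IsManifold (𝓡 2) ∞ S]
    [T2Space S] [SecondCountableTopology S] [ConnectedSpace S]
    (e : Fin 3 → GroupLieAlgebra (𝓡 3) X) (H : ℝ) (R : ℂ → ℂ) (hR : g.IsHPotential e H R)
    (f : S → X) (N : ∀ p, TangentSpace (𝓡 3) (f p)) (hf : g.IsHSurface f N H)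
    (hnz : ∀ p, ¬ PotentialZeroAt R (g.sphereGaussMap e f N p)) :
    ((∀ p, rankAt (g.sphereGaussMap e f N) p ≤ 1) ↔ InvariantUnderRightInvariantField f) ∧
    (InvariantUnderRightInvariantField f →
      (∀ p, rankAt (g.sphereGaussMap e f N) p = 1) ∧
      IsRegularCurve (range (g.sphereGaussMap e f N))) := by

  have he := hR.orthonormalFrame
  have hinv : InvariantUnderRightInvariantField f →
      ∃ v : E3, v ≠ 0 ∧ LeftInvariantMetric.IsTangent he f N v := by
    rintro ⟨v, hv0, hv⟩
    exact ⟨v, hv0, LeftInvariantMetric.isTangent_of_invariantUnderFlow hf he hv⟩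
  refine ⟨⟨fun hrank => ?_, fun h => ?_⟩, fun h => ?_⟩
  · obtain ⟨v, hv0, hv⟩ := LeftInvariantMetric.exists_isKernelAt hf hR hnz he hrank
    have hT : LeftInvariantMetric.IsTangent he f N v := fun p => (hv p).inner_eq_zero hf
    exact ⟨v, hv0, hT.invariantUnderFlow hf hR hnz⟩
  · obtain ⟨v, hv0, hv⟩ := hinv h
    exact hv.rankAt_le_one hf hR hnz hv0
  · obtain ⟨v, hv0, hv⟩ := hinv h
    exact ⟨fun p => le_antisymm (hv.rankAt_le_one hf hR hnz hv0 p) (hf.one_le_rankAt hR hnz p),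
      hv.isRegularCurve hf hR hnz hv0⟩
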